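/- Conventions. A 2-tangle is given by an unoriented tangle diagram in a rectangle with the four endpoints NW, SW (left side) and NE, SE (right side). Two diagrams are ambient isotopic if they are related by planar isotopies (fixing the endpoints) and Reidemeister moves I, II, III. Diagrams are taken in general position with respect to the horizontal coordinate, so that they are cut into elementary slices, each with one crossing or one vertical tangent. Let $K$ be a field, $A\in K$ nonzero, and $n\ge 0$ such that the quantum integers $[k]=\sum_{j=0}^{k-1}A^{2k-2-4j}$ are nonzero for $1\le k\le 2n$ (this guarantees that the Jones–Wenzl projectors below exist; it holds for $K=\mathbb{Q}(A)$ with $A$ an indeterminate). Let $\mathcal{S}(a,b)$ be the relative Kauffman bracket skein module over $K$ of the disc with $a$ marked points on the left and $b$ on the right: the $K$-vector space generated by diagrams with the blackboard framing up to isotopy, modulo (crossing) $=A\,$($A$-smoothing)$\,+A^{-1}\,$($B$-smoothing) and $D\sqcup\bigcirc=-(A^2+A^{-2})D$. The $m$-th Jones–Wenzl projector $f^{(m)}\in\mathcal{S}(m,m)$ is the nonzero idempotent that is annihilated by every hook (an arc joining two neighbouring points) on either side. Let $TL_4^n\subset\mathcal{S}(2n,2n)$ be the subspace of all elements $(f^{(n)}\otimes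 f^{(n)})\,x\,(f^{(n)}\otimes f^{(n)})$, i.e. skein elements of the disc with four clusters of $n$ points at the corners and a projector $f^{(n)}$ at each cluster. For $0\le i\le n$ let $B_{n,i}\in TL_4^n$ be the element given by two trivalent vertices joined by a horizontal edge of color $2i$: the left vertex has the outer edges NW and SW, the right vertex has the outer edges NE and SE, all of color $n$; an edge of color $m$ carries $f^{(m)}$, and at each vertex $n-i$ strands join the two outer edges and $i$ strands run from each outer edge to the middle edge. For a 2-tangle diagram $T$ let $T^n$ be the skein element obtained by replacing every component of $T$ by $n$ parallel strands decorated with $f^{(n)}$. Theorem. The elements $B_{n,0},\dots,B_{n,n}$ form a basis of $TL_4^n$, and for every 2-tangle diagram $T$ (in particular for every rational one) there are unique coefficients $\gamma_i(T)\in K$ with $$T^n=\sum_{i=0}^n\gamma_i(T)\,B_{n,i}.$$ If $T$ and $T'$ are ambient isotopic 2-tangle diagrams, then for each $0\le i\le n$ one has $\gamma_i(T)=0$ if and only if $\gamma_i(T')=0$, and for $0\le i\le n-1$ $$\frac{\gamma_i(T)}{\gamma_n(T)}=\frac{\gamma_i(T')}{\gamma_n(T')}$$ (a statement about elements of $K$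 when $\gamma_n(T)\ne0$; when $\gamma_n(T)=0$ the ratios are to be read as $\infty$ or undefined, simultaneously for $T$ and $T'$). That is, the ratios $\gamma_i(T)/\gamma_n(T)$, $0\le i\le n-1$, are ambient isotopy invariants of $T$. -/

import Mathlib

noncomputable section

namespace ColoredTangle

/-! ## Tangle diagrams

An unoriented tangle diagram in a rectangle, in general position with respect to the horizontal
coordinate, is cut by vertical lines into elementary slices, each of which contains exactly one
crossing or one point with a vertical tangent.  The diagram is read from left to right; the points
on a vertical line are numbered `0, 1, 2, …` from top to bottom. -/

/-- The elementary pieces.  `birth` is the arc `⊂`, which creates two neighbouring strands; `death`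
is the arc `⊃`, which joins two neighbouring strands; `cross s` is a crossing of two neighbouring
strands.  In `cross true` the strand that runs from the upper left to the lower right passes over;
in `cross false` it passes under. -/
inductive Piece : Type
  | birth : Piece
  | death : Piece
  | cross (s : Bool) : Piece

/-- Number of endpoints of a piece on its left side. -/
def Piece.inp : Piece → ℕ
  | .birth => 0
  | .death => 2
  | .cross _ => 2

/-- Number of endpoints of a piece on its right side. -/
def Piece.out : Piece → ℕ
  | .birth => 2
  | .death => 0
  | .cross _ => 2

/-- A slice: a piece together with the number `pos` of horizontal strands above it.  All strands
below the piece are horizontal as well. -/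
structure Slice : Type where
  piece : Piece
  pos : ℕ

abbrev birth (l : ℕ) : Slice := ⟨.birth, l⟩
abbrev death (l : ℕ) : Slice := ⟨.death, l⟩
abbrev cross (s : Bool) (l : ℕ) : Slice := ⟨.cross s, l⟩

/-- There is room for the slice `x` among `a` strands. -/
def Slice.Fits (x : Slice) (a : ℕ) : Prop := x.pos + x.piece.inp ≤ a

/-- The number of strands to the right of the slice `x` when there are `a` strands to its left. -/
def Slice.next (x : Slice) (a : ℕ) : ℕ := a - x.piece.inp + x.piece.out

/-- The slice with `c` additional horizontal strands above it. -/
def Slice.shift (c : ℕ) (x : Slice) : Slice := ⟨x.piece, c + x.pos⟩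

/-- A list of slices, from left to right, is a diagram with `a` endpoints on the left and `b`
endpoints on the right. -/
def IsDiagram : ℕ → List Slice → ℕ → Prop
  | a, [], b => a = b
  | a, x :: w, b => x.Fits a ∧ IsDiagram (x.next a) w b

/-- Tangle diagrams with `a` endpoints on the left and `b` endpoints on the right. -/
structure Diagram (a b : ℕ) : Type where
  word : List Slice
  isDiagram : IsDiagram a word b

theorem IsDiagram.append {a b c : ℕ} {u v : List Slice} (hu : IsDiagram a u b)
    (hv : IsDiagram b v c) : IsDiagram a (u ++ v) c := by
  induction u generalizing a with
  | nil => cases hu; exact hv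
  | cons x u ih => exact ⟨hu.1, ih hu.2⟩

theorem IsDiagram.addBelow {a b : ℕ} {w : List Slice} (c : ℕ) (h : IsDiagram a w b) :
    IsDiagram (a + c) w (b + c) := by
  induction w generalizing a with
  | nil => cases h; exact rfl
  | cons x w ih =>
    obtain ⟨h1, h2⟩ := h
    have h3 := ih h2
    have e : x.next a + c = x.next (a + c) := by
      simp only [Slice.Fits, Slice.next] at *; omega
    rw [e] at h3
    exact ⟨by simp only [Slice.Fits] at *; omega, h3⟩

theorem IsDiagram.addAbove {a b : ℕ} {w : List Slice} (c : ℕ) (h : IsDiagram a w b) :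
    IsDiagram (c + a) (w.map (Slice.shift c)) (c + b) := by
  induction w generalizing a with
  | nil => cases h; exact rfl
  | cons x w ih =>
    obtain ⟨h1, h2⟩ := h
    have h3 := ih h2
    have e : c + x.next a = (x.shift c).next (c + a) := by
      simp only [Slice.Fits, Slice.next, Slice.shift] at *; omega
    rw [e] at h3
    exact ⟨by simp only [Slice.Fits, Slice.shift] at *; omega, h3⟩

/-- Horizontal juxtaposition: `D` on the left of `E`. -/
def Diagram.comp {a b c : ℕ} (D : Diagram a b) (E : Diagram b c) : Diagram a c :=
  ⟨D.word ++ E.word, D.isDiagram.append E.isDiagram⟩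

/-- Add `c` horizontal strands below a diagram. -/
def Diagram.addBelow (c : ℕ) {a b : ℕ} (D : Diagram a b) : Diagram (a + c) (b + c) :=
  ⟨D.word, D.isDiagram.addBelow c⟩

/-- Add `c` horizontal strands above a diagram. -/
def Diagram.addAbove (c : ℕ) {a b : ℕ} (D : Diagram a b) : Diagram (c + a) (c + b) :=
  ⟨D.word.map (Slice.shift c), D.isDiagram.addAbove c⟩

/-- A 2-tangle diagram: the four endpoints are NW, SW (on the left, from top to bottom) and
NE, SE (on the right, from top to bottom). -/
abbrev TwoTangle : Type := Diagram 2 2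

/-! ## Isotopy -/

/-- The local moves of regular isotopy: the planar isotopies of sliced diagrams and the Reidemeister
moves II and III. -/
inductive RegularMove : List Slice → List Slice → Prop
  /-- Cancellation of two vertical tangents on a zigzag. -/
  | zigzag (l : ℕ) : RegularMove [birth l, death (l + 1)] []
  | zigzag' (l : ℕ) : RegularMove [birth (l + 1), death l] []
  /-- Two pieces with `m` strands between them may be drawn in either order. -/
  | far (p q : Piece) (l m : ℕ) :
      RegularMove [⟨p, l⟩, ⟨q, l + p.out + m⟩] [⟨q, l + p.inp + m⟩, ⟨p, l⟩]
  /-- A crossing slides past a vertical tangent. -/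
  | slideBirth (s : Bool) (l : ℕ) :
      RegularMove [birth l, cross s (l + 1)] [birth (l + 1), cross (!s) l]
  | slideDeath (s : Bool) (l : ℕ) :
      RegularMove [cross s l, death (l + 1)] [cross (!s) (l + 1), death l]
  /-- Reidemeister move II. -/
  | reidemeisterII (s : Bool) (l : ℕ) : RegularMove [cross s l, cross (!s) l] []
  /-- Reidemeister move III.  The condition says that one of the three strands lies over the two
  others, one lies under the two others, and one lies between. -/
  | reidemeisterIII (s t u : Bool) (h : t = s ∨ t = u) (l : ℕ) :
      RegularMove [cross s l, cross t (l + 1), cross u l]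
        [cross u (l + 1), cross t l, cross s (l + 1)]

/-- The local moves of ambient isotopy: those of regular isotopy and Reidemeister move I. -/
inductive AmbientMove : List Slice → List Slice → Prop
  | regular {X Y : List Slice} (h : RegularMove X Y) : AmbientMove X Y
  | reidemeisterI (s : Bool) (l : ℕ) : AmbientMove [birth l, cross s l] [birth l]
  | reidemeisterI' (s : Bool) (l : ℕ) : AmbientMove [cross s l, death l] [death l]

/-- `D'` arises from `D` by performing one local move somewhere in the diagram. -/
def Step (R : List Slice → List Slice → Prop) {a b : ℕ} (D D' : Diagram a b) : Prop :=
  ∃ U V X Y : List Slice, R X Y ∧ D.word = U ++ X ++ V ∧ D'.word = U ++ Y ++ V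

/-- Ambient isotopy of tangle diagrams (with fixed endpoints): the equivalence relation generated
by planar isotopy and the Reidemeister moves I, II, III. -/
def AmbientIsotopic {a b : ℕ} : Diagram a b → Diagram a b → Prop :=
  Relation.EqvGen (Step AmbientMove)

/-! ## The relative Kauffman bracket skein module of the disc -/

section Skein

variable {K : Type*} [Field K] (A : K)

/-- The defining relators of the skein module.  A framed tangle is represented by a diagram with the
blackboard framing.  (Cancellation of opposite kinks, which is a framed isotopy but not a regular
one, follows from the two Kauffman relations.) -/
inductive IsRelator {a b : ℕ} : (Diagram a b →₀ K) → Prop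
  /-- Isotopic diagrams are equal. -/
  | isotopy {D D' : Diagram a b} (h : Step RegularMove D D') :
      IsRelator (Finsupp.single D 1 - Finsupp.single D' 1)
  /-- A crossing is `A` times its `A`-smoothing plus `A⁻¹` times its `B`-smoothing. -/
  | crossTrue (U V : List Slice) (l : ℕ) {D D₀ D₁ : Diagram a b}
      (h : D.word = U ++ [cross true l] ++ V) (h₀ : D₀.word = U ++ V)
      (h₁ : D₁.word = U ++ [death l, birth l] ++ V) :
      IsRelator (Finsupp.single D 1 - Finsupp.single D₀ A - Finsupp.single D₁ A⁻¹)
  | crossFalse (U V : List Slice) (l : ℕ) {D D₀ D₁ : Diagram a b}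
      (h : D.word = U ++ [cross false l] ++ V) (h₀ : D₀.word = U ++ V)
      (h₁ : D₁.word = U ++ [death l, birth l] ++ V) :
      IsRelator (Finsupp.single D 1 - Finsupp.single D₀ A⁻¹ - Finsupp.single D₁ A)
  /-- A trivial circle contributes the factor `-A² - A⁻²`. -/
  | circle (U V : List Slice) (l : ℕ) {D D₀ : Diagram a b}
      (h : D.word = U ++ [birth l, death l] ++ V) (h₀ : D₀.word = U ++ V) :
      IsRelator (Finsupp.single D 1 + Finsupp.single D₀ (A ^ 2 + A⁻¹ ^ 2))

abbrev relations (a b : ℕ) : Submodule K (Diagram a b →₀ K) :=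
  Submodule.span K {x | IsRelator A x}

/-- The Kauffman bracket skein module of the disc with `a` marked points on the left and `b` marked
points on the right.  For `a = b = m` it is the Temperley-Lieb algebra on `m` strands. -/
abbrev Skein (a b : ℕ) : Type _ := (Diagram a b →₀ K) ⧸ relations A a b

/-- The class of a diagram in the skein module. -/
def Skein.of {a b : ℕ} (D : Diagram a b) : Skein A a b :=
  (relations A a b).mkQ (Finsupp.single D 1)

variable {A}

/-- An operation on diagrams that acts on words in such a way that contexts go to contexts and local
moves go to local moves respects the relators. -/
theorem IsRelator.map {a b a' b' c : ℕ} (P Q : List Slice) (φ : Diagram a b → Diagram a' b')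
    (hφ : ∀ D, (φ D).word = P ++ D.word.map (Slice.shift c) ++ Q) {x : Diagram a b →₀ K}
    (hx : IsRelator A x) : IsRelator A (Finsupp.lmapDomain K K φ x) := by
  cases hx with
  | isotopy h =>
    rename_i D D'
    obtain ⟨U, V, X, Y, h, hD, hD'⟩ := h
    have hXY : RegularMove (X.map (Slice.shift c)) (Y.map (Slice.shift c)) := by
      cases h with
      | zigzag l => exact .zigzag (c + l)
      | zigzag' l => exact .zigzag' (c + l)
      | far p q l m =>
        have := RegularMove.far p q (c + l) m
        simpa [Slice.shift, Nat.add_assoc] using this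
      | slideBirth s l => exact .slideBirth s (c + l)
      | slideDeath s l => exact .slideDeath s (c + l)
      | reidemeisterII s l => exact .reidemeisterII s (c + l)
      | reidemeisterIII s t u h l => exact .reidemeisterIII s t u h (c + l)
    simp only [map_sub, Finsupp.lmapDomain_apply, Finsupp.mapDomain_single]
    exact .isotopy ⟨P ++ U.map (Slice.shift c), V.map (Slice.shift c) ++ Q, _, _, hXY,
      by simp [hφ, hD], by simp [hφ, hD']⟩
  | crossTrue U V l h h₀ h₁ =>
    simp only [map_sub, Finsupp.lmapDomain_apply, Finsupp.mapDomain_single]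
    exact .crossTrue (P ++ U.map (Slice.shift c)) (V.map (Slice.shift c) ++ Q) (c + l)
      (by simp [hφ, h, Slice.shift]) (by simp [hφ, h₀]) (by simp [hφ, h₁, Slice.shift])
  | crossFalse U V l h h₀ h₁ =>
    simp only [map_sub, Finsupp.lmapDomain_apply, Finsupp.mapDomain_single]
    exact .crossFalse (P ++ U.map (Slice.shift c)) (V.map (Slice.shift c) ++ Q) (c + l)
      (by simp [hφ, h, Slice.shift]) (by simp [hφ, h₀]) (by simp [hφ, h₁, Slice.shift])
  | circle U V l h h₀ =>
    simp only [map_add, Finsupp.lmapDomain_apply, Finsupp.mapDomain_single]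
    exact .circle (P ++ U.map (Slice.shift c)) (V.map (Slice.shift c) ++ Q) (c + l)
      (by simp [hφ, h, Slice.shift]) (by simp [hφ, h₀])

/-- The linear map of skein modules induced by an operation on diagrams. -/
def Skein.map {a b a' b' : ℕ} (φ : Diagram a b → Diagram a' b')
    (h : ∀ x : Diagram a b →₀ K, IsRelator A x → IsRelator A (Finsupp.lmapDomain K K φ x)) :
    Skein A a b →ₗ[K] Skein A a' b' :=
  Submodule.mapQ _ _ (Finsupp.lmapDomain K K φ)
    (Submodule.span_le.2 fun x hx => Submodule.subset_span (h x hx))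

theorem Skein.map_mkQ {a b a' b' : ℕ} (φ : Diagram a b → Diagram a' b')
    (h : ∀ x : Diagram a b →₀ K, IsRelator A x → IsRelator A (Finsupp.lmapDomain K K φ x))
    (D : Diagram a b) :
    Skein.map φ h ((relations A a b).mkQ (Finsupp.single D 1)) =
      (relations A a' b').mkQ (Finsupp.single (φ D) 1) := by
  have e : Finsupp.lmapDomain K K φ (Finsupp.single D 1) = Finsupp.single (φ D) 1 := by
    rw [Finsupp.lmapDomain_apply, Finsupp.mapDomain_single]
  exact congrArg (relations A a' b').mkQ e

theorem shift_zero_map (w : List Slice) : w.map (Slice.shift 0) = w := by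
  have : Slice.shift 0 = id := by
    funext x; cases x; simp [Slice.shift]
  rw [this, List.map_id]

/-- Juxtaposition with a fixed diagram on the right. -/
def Skein.compDiagram {a b c : ℕ} (E : Diagram b c) : Skein A a b →ₗ[K] Skein A a c :=
  Skein.map (fun D => D.comp E) fun _ hx =>
    hx.map (c := 0) [] E.word _ fun D => by simp [Diagram.comp, shift_zero_map]

/-- Bilinear extension of juxtaposition (`x` on the left of `y`). -/
def Skein.compₗ {a b c : ℕ} : Skein A b c →ₗ[K] Skein A a b →ₗ[K] Skein A a c :=
  (relations A b c).liftQ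
    (Finsupp.lsum K fun E : Diagram b c => LinearMap.toSpanSingleton K _ (Skein.compDiagram E))
    (Submodule.span_le.2 fun x hx => by
      rw [SetLike.mem_coe, LinearMap.mem_ker]
      refine Submodule.linearMap_qext _ (Finsupp.lhom_ext' fun D => LinearMap.ext_ring ?_)
      have key : ∀ y : Diagram b c →₀ K,
          (Finsupp.lsum K fun E : Diagram b c =>
            LinearMap.toSpanSingleton K _ (Skein.compDiagram E)) y
            ((relations A a b).mkQ (Finsupp.single D 1)) =
          (relations A a c).mkQ (Finsupp.lmapDomain K K (fun E => D.comp E) y) := by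
        intro y
        induction y using Finsupp.induction_linear with
        | zero => simp
        | add f g hf hg => simp only [map_add, LinearMap.add_apply, hf, hg]
        | single E k =>
          have e : Finsupp.single (D.comp E) k = k • Finsupp.single (D.comp E) (1 : K) := by simp
          rw [Finsupp.lmapDomain_apply, Finsupp.mapDomain_single, e, map_smul, Finsupp.lsum_single,
            LinearMap.toSpanSingleton_apply, LinearMap.smul_apply, Skein.compDiagram, Skein.map_mkQ]
      have hx' : IsRelator A (Finsupp.lmapDomain K K (fun E => D.comp E) x) :=
        IsRelator.map (c := 0) D.word [] _ (fun E => by simp [Diagram.comp, shift_zero_map]) hx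
      simp only [LinearMap.comp_apply, Finsupp.lsingle_apply, LinearMap.zero_apply]
      rw [key, Submodule.mkQ_apply, Submodule.Quotient.mk_eq_zero]
      exact Submodule.subset_span hx')

/-- Juxtaposition of skein elements, `x` on the left of `y`.  For `a = b = c` this is the
multiplication of the Temperley-Lieb algebra. -/
def Skein.comp {a b c : ℕ} (x : Skein A a b) (y : Skein A b c) : Skein A a c := Skein.compₗ y x

/-- Add `c` horizontal strands below. -/
def Skein.addBelow (c : ℕ) {a b : ℕ} : Skein A a b →ₗ[K] Skein A (a + c) (b + c) :=
  Skein.map (Diagram.addBelow c) fun _ hx =>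
    hx.map (c := 0) [] [] _ fun D => by simp [Diagram.addBelow, shift_zero_map]

/-- Add `c` horizontal strands above. -/
def Skein.addAbove (c : ℕ) {a b : ℕ} : Skein A a b →ₗ[K] Skein A (c + a) (c + b) :=
  Skein.map (Diagram.addAbove c) fun _ hx =>
    hx.map (c := c) [] [] _ fun D => by simp [Diagram.addAbove]

/-- `x` drawn above `y`. -/
def Skein.tensor {a b c d : ℕ} (x : Skein A a b) (y : Skein A c d) : Skein A (a + c) (b + d) :=
  Skein.comp (Skein.addBelow c x) (Skein.addAbove b y)

/-! ## Jones-Wenzl projectors -/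

/-- `f` is the `m`-th Jones-Wenzl projector: the nonzero idempotent of the Temperley-Lieb algebra on
`m` strands that is annihilated by all hooks, on either side. -/
structure IsJonesWenzl (m : ℕ) (f : Skein A m m) : Prop where
  ne_zero : f ≠ 0
  idempotent : Skein.comp f f = f
  birth_comp : ∀ (p i : ℕ) (D : Diagram p m), D.word = [birth i] →
    Skein.comp (Skein.of A D) f = 0
  comp_death : ∀ (p i : ℕ) (D : Diagram m p), D.word = [death i] →
    Skein.comp f (Skein.of A D) = 0

variable (A)

open Classical in
/-- The `m`-th Jones-Wenzl projector (by convention `0` if there is none). -/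
def jonesWenzl (m : ℕ) : Skein A m m :=
  if h : ∃ f : Skein A m m, IsJonesWenzl m f then h.choose else 0

/-- `m` copies of the `n`-th Jones-Wenzl projector, one below the other. -/
def projectors (n : ℕ) : (m : ℕ) → Skein A (n * m) (n * m)
  | 0 => Skein.of A ⟨[], rfl⟩
  | m + 1 => Skein.tensor (projectors n m) (jonesWenzl A n)

/-- The quantum integer `[k] = A^(2k-2) + A^(2k-6) + ⋯ + A^(2-2k)`. -/
def quantumInt (k : ℕ) : K := ∑ j ∈ Finset.range k, A ^ (2 * (k : ℤ) - 2 - 4 * (j : ℤ))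

end Skein

/-! ## Colored tangles -/

/-- `k` nested arcs `⊂`, with `l` strands above them. -/
def nestedBirths (k l : ℕ) : List Slice := (List.range k).map fun j => birth (l + j)

/-- `k` nested arcs `⊃`, with `l` strands above them. -/
def nestedDeaths (k l : ℕ) : List Slice := ((List.range k).map fun j => death (l + j)).reverse

/-- The strand number `l + n` crosses the `n` strands directly above it. -/
def crossRow (s : Bool) (n l : ℕ) : List Slice := ((List.range n).map fun j => cross s (l + j)).reverse

/-- The `m` strands with numbers `l + n, …, l + n + m - 1` cross the `n` strands directly above
them. -/
def crossGrid (s : Bool) (n m l : ℕ) : List Slice :=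
  (List.range m).flatMap fun j => crossRow s n (l + j)

/-- Replace every strand of a slice by `n` parallel strands. -/
def Slice.cable (n : ℕ) : Slice → List Slice
  | ⟨.birth, l⟩ => nestedBirths n (n * l)
  | ⟨.death, l⟩ => nestedDeaths n (n * l)
  | ⟨.cross s, l⟩ => crossGrid s n n (n * l)

theorem isDiagram_nestedBirths (k l a : ℕ) (h : l ≤ a) :
    IsDiagram a (nestedBirths k l) (a + 2 * k) := by
  induction k with
  | zero => exact rfl
  | succ k ih =>
    rw [nestedBirths, List.range_succ, List.map_append]
    refine ih.append ⟨?_, ?_⟩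
    · simp only [Slice.Fits, Piece.inp]; omega
    · show Slice.next _ _ = _
      simp only [Slice.next, Piece.inp, Piece.out]; omega

theorem isDiagram_nestedDeaths (k l a : ℕ) (h : l ≤ a) :
    IsDiagram (a + 2 * k) (nestedDeaths k l) a := by
  induction k with
  | zero => exact rfl
  | succ k ih =>
    rw [nestedDeaths, List.range_succ, List.map_append, List.reverse_append]
    refine ⟨?_, ?_⟩
    · simp only [Slice.Fits, Piece.inp]; omega
    · exact ih

theorem isDiagram_of_cross (a : ℕ) (w : List Slice)
    (h : ∀ x ∈ w, ∃ s l, x = cross s l ∧ l + 2 ≤ a) : IsDiagram a w a := by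
  induction w with
  | nil => exact rfl
  | cons x w ih =>
    obtain ⟨s, l, rfl, hl⟩ := h x (by simp)
    refine ⟨hl, ?_⟩
    have e : (cross s l).next a = a := by simp only [Slice.next, Piece.inp, Piece.out]; omega
    rw [e]
    exact ih fun y hy => h y (by simp [hy])

theorem isDiagram_crossGrid (s : Bool) (n m l a : ℕ) (h : l + n + m ≤ a) :
    IsDiagram a (crossGrid s n m l) a := by
  apply isDiagram_of_cross
  intro x hx
  simp only [crossGrid, crossRow, List.mem_flatMap, List.mem_range, List.mem_reverse,
    List.mem_map] at hx
  obtain ⟨j, hj, i, hi, rfl⟩ := hx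
  exact ⟨s, _, rfl, by omega⟩

theorem Slice.isDiagram_cable (n : ℕ) (x : Slice) (a : ℕ) (h : x.Fits a) :
    IsDiagram (n * a) (x.cable n) (n * x.next a) := by
  obtain ⟨p, l⟩ := x
  cases p with
  | birth =>
    have h' : l ≤ a := h
    have := isDiagram_nestedBirths n (n * l) (n * a) (Nat.mul_le_mul_left n h')
    have e : n * a + 2 * n = n * (a + 2) := by ring
    rw [e] at this
    exact this
  | death =>
    obtain ⟨c, rfl⟩ := Nat.exists_eq_add_of_le (show l + 2 ≤ a from h)
    have := isDiagram_nestedDeaths n (n * l) (n * (l + c)) (Nat.mul_le_mul_left n (by omega))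
    have e : n * (l + c) + 2 * n = n * (l + 2 + c) := by ring
    have e' : (⟨.death, l⟩ : Slice).next (l + 2 + c) = l + c := by
      simp only [Slice.next, Piece.inp, Piece.out]; omega
    rw [e] at this
    rw [e']
    exact this
  | cross s =>
    obtain ⟨c, rfl⟩ := Nat.exists_eq_add_of_le (show l + 2 ≤ a from h)
    have e' : (⟨.cross s, l⟩ : Slice).next (l + 2 + c) = l + 2 + c := by
      simp only [Slice.next, Piece.inp, Piece.out]; omega
    rw [e']
    refine isDiagram_crossGrid s n n (n * l) _ ?_
    have : n * (l + 2 + c) = n * l + n + n + n * c := by ring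
    omega

section Coloring

variable {K : Type*} [Field K] (A : K)

/-- Every strand of the diagram is replaced by `n` parallel strands, and the `n`-th Jones-Wenzl
projector is inserted into every such bundle between any two slices and at the endpoints.  (As the
projector is idempotent and slides along the bundles, past crossings and vertical tangents, this is
the same as one projector on every component.) -/
def colorWord (n : ℕ) : (w : List Slice) → (a b : ℕ) → IsDiagram a w b → Skein A (n * a) (n * b)
  | [], a, b, h =>
    Skein.comp (projectors A n a)
      (Skein.of A ⟨[], show n * a = n * b from congrArg (n * ·) (show a = b from h)⟩)
  | x :: w, a, b, h =>
    Skein.comp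
      (Skein.comp (projectors A n a) (Skein.of A ⟨x.cable n, x.isDiagram_cable n a h.1⟩))
      (colorWord n w (x.next a) b h.2)

/-- The `n`-th colored tangle `Tⁿ` of `T`. -/
def colored (n : ℕ) {a b : ℕ} (T : Diagram a b) : Skein A (n * a) (n * b) :=
  colorWord A n T.word a b T.isDiagram

/-- The module `TL₄ⁿ`: the skein elements of the disc with four clusters of `n` points, two on the
left and two on the right, surrounded by an `n`-th Jones-Wenzl projector at every cluster. -/
def coloredTL (n : ℕ) : Submodule K (Skein A (n * 2) (n * 2)) :=
  Submodule.span K {y | ∃ x : Skein A (n * 2) (n * 2),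
    y = Skein.comp (Skein.comp (projectors A n 2) x) (projectors A n 2)}

/-- The left trivalent vertex without its projectors: from each of the two clusters of `n` points,
`i` strands leave to the right, and the other `n - i` strands join the two clusters. -/
def mergeDiagram (n : ℕ) (i : Fin (n + 1)) : Diagram (n * 2) (2 * (i : ℕ)) where
  word := nestedDeaths (n - i) i
  isDiagram := by
    have e : n * 2 = 2 * (i : ℕ) + 2 * (n - i) := by omega
    rw [e]
    exact isDiagram_nestedDeaths _ _ _ (by omega)

/-- The mirror image of `mergeDiagram`: the right trivalent vertex without its projectors. -/
def splitDiagram (n : ℕ) (i : Fin (n + 1)) : Diagram (2 * (i : ℕ)) (n * 2) where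
  word := nestedBirths (n - i) i
  isDiagram := by
    have e : n * 2 = 2 * (i : ℕ) + 2 * (n - i) := by omega
    rw [e]
    exact isDiagram_nestedBirths _ _ _ (by omega)

/-- The element `B_{n,i}`: two trivalent vertices joined by a horizontal edge of color `2i`, all four
outer edges having color `n`. -/
def basisElement (n : ℕ) (i : Fin (n + 1)) : Skein A (n * 2) (n * 2) :=
  Skein.comp (Skein.comp (Skein.comp (Skein.comp
    (projectors A n 2)
    (Skein.of A (mergeDiagram n i)))
    (jonesWenzl A (2 * (i : ℕ))))
    (Skein.of A (splitDiagram n i)))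
    (projectors A n 2)

end Coloring

end ColoredTangle

end

noncomputable section

namespace ColoredTangle

/-! ## Words -/

/-! Invariance. Every skein element, in particular a projector, slides through a bundle of
crossings, and a projector can be moved along a bundle of arcs because a hook at one end of the arcs
is a hook at the other end. Hence the projectors between the slices can be absorbed at will, and the
cabled moves of regular isotopy become equalities (`colorOp_regularMove`). Only Reidemeister I
remains. A system of arcs with all its ends on two clusters is, between projectors, a multiple of
the nested one, so a bundle kink acts by a scalar. The kink can be undone, since the grid of
crossings is invertible and commutes with the pair of projectors; so the scalar may be taken nonzero
(`IsJonesWenzl.kink_birth`, `IsJonesWenzl.kink_death`). Thus an ambient isotopy multiplies the whole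
coloring by one nonzero constant (`AmbientIsotopic.colored`), which cancels in the ratios of
coefficients.

Basis. Resolving crossings and removing circles and zigzags puts every diagram into a form where all
arcs `⊃` precede all arcs `⊂`. Between the four outer projectors only the nested systems of arcs
survive, one for each possible number of horizontal strands. A projector is the identity plus
diagrams with hooks (`IsJonesWenzl.sub_one_mem`), so inserting one on the middle edge changes such a
system only by systems with fewer horizontal strands. The change from arc systems to the
`basisElement`s is unitriangular, which gives `span_basisElement`.

Independence needs a lower bound on the skein module. It comes from a representation on functions of
two-valued states of the strands (`stateRep`), given by an explicit pairing and copairing.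
Functionals and vectors killed by all hooks do not see the outer projectors, and a constant state
does not see the middle one; the matrix of the functionals `detect` on the `basisElement`s is
therefore triangular with nonzero diagonal (`linearIndependent_basisElement`).

Existence of the projectors is Wenzl's recursion. It divides by partial traces, which are quotients
of the quantum integers assumed to be nonzero (`isJonesWenzl_jonesWenzl`). -/

theorem isDiagram_nil (a : ℕ) : IsDiagram a [] a := rfl

theorem isDiagram_birth {a b l : ℕ} (h : l ≤ a) (hb : b = a + 2) : IsDiagram a [birth l] b := by
  subst hb
  exact ⟨by simpa [Slice.Fits, Piece.inp] using h, by simp [IsDiagram, Slice.next, Piece.inp, Piece.out]⟩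

theorem isDiagram_death {a b l : ℕ} (h : l ≤ b) (hb : a = b + 2) : IsDiagram a [death l] b := by
  subst hb
  exact ⟨by simpa [Slice.Fits, Piece.inp] using h, by simp [IsDiagram, Slice.next, Piece.inp, Piece.out]⟩

theorem isDiagram_cross {a l : ℕ} (s : Bool) (h : l + 2 ≤ a) : IsDiagram a [cross s l] a :=
  isDiagram_of_cross a _ fun x hx => ⟨s, l, by simpa using hx, h⟩

theorem isDiagram_birth_iff {a b l : ℕ} : IsDiagram a [birth l] b ↔ l ≤ a ∧ b = a + 2 := by
  simp only [IsDiagram, Slice.Fits, Slice.next, Piece.inp, Piece.out]; omega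

theorem isDiagram_death_iff {a b l : ℕ} : IsDiagram a [death l] b ↔ l ≤ b ∧ a = b + 2 := by
  simp only [IsDiagram, Slice.Fits, Slice.next, Piece.inp, Piece.out]; omega

theorem isDiagram_cross_iff {a b l : ℕ} {s : Bool} :
    IsDiagram a [cross s l] b ↔ l + 2 ≤ a ∧ b = a := by
  simp only [IsDiagram, Slice.Fits, Slice.next, Piece.inp, Piece.out]; omega

theorem isDiagram_slice_iff {a b l : ℕ} {p : Piece} :
    IsDiagram a [⟨p, l⟩] b ↔ l + p.inp ≤ a ∧ b + p.inp = a + p.out := by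
  simp only [IsDiagram, Slice.Fits, Slice.next]; omega

theorem isDiagram_append_iff {a c : ℕ} {u v : List Slice} :
    IsDiagram a (u ++ v) c ↔ ∃ b, IsDiagram a u b ∧ IsDiagram b v c := by
  refine ⟨fun h => ?_, fun ⟨b, hu, hv⟩ => hu.append hv⟩
  induction u generalizing a with
  | nil => exact ⟨a, rfl, h⟩
  | cons x u ih =>
    obtain ⟨b, h1, h2⟩ := ih h.2
    exact ⟨b, ⟨h.1, h1⟩, h2⟩

theorem isDiagram_cons_iff {a c : ℕ} {x : Slice} {v : List Slice} :
    IsDiagram a (x :: v) c ↔ ∃ b, IsDiagram a [x] b ∧ IsDiagram b v c :=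
  isDiagram_append_iff (u := [x])

theorem IsDiagram.unique {a b c : ℕ} {u : List Slice} (h : IsDiagram a u b)
    (h' : IsDiagram a u c) : b = c := by
  induction u generalizing a with
  | nil => exact h.symm.trans h'
  | cons x u ih => exact ih h.2 h'.2

/-! ## The algebra of operators -/

variable {K : Type*} [Field K] {A : K}

/-! ### The skein modules as a linear category: composition, units, added strands -/

namespace Skein

theorem span_range_of (a b : ℕ) :
    Submodule.span K (Set.range (of A : Diagram a b → Skein A a b)) = ⊤ := by
  rw [eq_top_iff]
  rintro x -
  obtain ⟨y, rfl⟩ := Submodule.mkQ_surjective _ x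
  induction y using Finsupp.induction_linear with
  | zero => simp
  | add f g hf hg => rw [map_add]; exact add_mem hf hg
  | single D k =>
    have : Finsupp.single D k = k • Finsupp.single D (1 : K) := by simp
    rw [this, map_smul]
    exact Submodule.smul_mem _ _ (Submodule.subset_span ⟨D, rfl⟩)

theorem mkQ_single {a b : ℕ} (D : Diagram a b) (k : K) :
    (relations A a b).mkQ (Finsupp.single D k) = k • of A D := by
  rw [of, ← map_smul, Finsupp.smul_single, smul_eq_mul, mul_one]

theorem mkQ_eq_zero {a b : ℕ} {x : Diagram a b →₀ K} (h : IsRelator A x) :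
    (relations A a b).mkQ x = 0 := by
  rw [Submodule.mkQ_apply, Submodule.Quotient.mk_eq_zero]
  exact Submodule.subset_span h

theorem of_comp {a b c : ℕ} (D : Diagram a b) (E : Diagram b c) :
    comp (of A D) (of A E) = of A (D.comp E) := by
  have : compₗ (of A E) = compDiagram (A := A) (a := a) E := by
    rw [of, compₗ, Submodule.mkQ_apply, Submodule.liftQ_apply, Finsupp.lsum_single]
    simp
  rw [comp, this]
  exact Skein.map_mkQ _ _ D

theorem addBelow_of {a b : ℕ} (c : ℕ) (D : Diagram a b) :
    addBelow c (of A D) = of A (D.addBelow c) := Skein.map_mkQ _ _ D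

theorem addAbove_of {a b : ℕ} (c : ℕ) (D : Diagram a b) :
    addAbove c (of A D) = of A (D.addAbove c) := Skein.map_mkQ _ _ D

/-- Juxtaposition as a linear map in the right argument. -/
def compRight {a b : ℕ} (c : ℕ) : Skein A a b →ₗ[K] Skein A b c →ₗ[K] Skein A a c :=
  compₗ.flip

theorem of_congr {a b : ℕ} {D E : Diagram a b} (h : D.word = E.word) : of A D = of A E := by
  cases D; cases E; cases h; rfl

@[elab_as_elim]
theorem induction_on {a b : ℕ} {p : Skein A a b → Prop} (x : Skein A a b) (zero : p 0)
    (of : ∀ D, p (of A D)) (add : ∀ x y, p x → p y → p (x + y))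
    (smul : ∀ (k : K) x, p x → p (k • x)) : p x := by
  have hx : x ∈ Submodule.span K (Set.range (Skein.of A : Diagram a b → Skein A a b)) := by
    rw [span_range_of]; trivial
  induction hx using Submodule.span_induction with
  | mem x h => obtain ⟨D, rfl⟩ := h; exact of D
  | zero => exact zero
  | add x y _ _ hx hy => exact add x y hx hy
  | smul k x _ hx => exact smul k x hx

theorem comp_add {a b c : ℕ} (x : Skein A a b) (y z : Skein A b c) :
    comp x (y + z) = comp x y + comp x z := map_add (compRight c x) y z

theorem add_comp {a b c : ℕ} (x y : Skein A a b) (z : Skein A b c) :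
    comp (x + y) z = comp x z + comp y z := map_add (compₗ z) x y

theorem comp_smul {a b c : ℕ} (k : K) (x : Skein A a b) (y : Skein A b c) :
    comp x (k • y) = k • comp x y := map_smul (compRight c x) k y

theorem smul_comp {a b c : ℕ} (k : K) (x : Skein A a b) (y : Skein A b c) :
    comp (k • x) y = k • comp x y := map_smul (compₗ y) k x

theorem comp_zero {a b c : ℕ} (x : Skein A a b) : comp x (0 : Skein A b c) = 0 :=
  map_zero (compRight c x)

theorem zero_comp {a b c : ℕ} (y : Skein A b c) : comp (0 : Skein A a b) y = 0 :=
  map_zero (compₗ y)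

theorem comp_assoc {a b c d : ℕ} (x : Skein A a b) (y : Skein A b c) (z : Skein A c d) :
    comp (comp x y) z = comp x (comp y z) := by
  induction x using induction_on with
  | zero => simp only [zero_comp]
  | add x x' h h' => simp only [add_comp, h, h']
  | smul k x h => simp only [smul_comp, h]
  | of D =>
    induction y using induction_on with
    | zero => simp only [zero_comp, comp_zero]
    | add x x' h h' => simp only [add_comp, comp_add, h, h']
    | smul k x h => simp only [smul_comp, comp_smul, h]
    | of E =>
      induction z using induction_on with
      | zero => simp only [comp_zero]
      | add x x' h h' => simp only [comp_add, h, h']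
      | smul k x h => simp only [comp_smul, h]
      | of F =>
        simp only [of_comp]
        exact of_congr (List.append_assoc _ _ _)

/-- The identity diagram. -/
def one (A : K) (a : ℕ) : Skein A a a := of A ⟨[], rfl⟩

theorem one_comp {a b : ℕ} (x : Skein A a b) : comp (one A a) x = x := by
  induction x using induction_on with
  | zero => simp only [comp_zero]
  | add x x' h h' => simp only [comp_add, h, h']
  | smul k x h => simp only [comp_smul, h]
  | of D => rw [one, of_comp]; exact of_congr rfl

theorem comp_one {a b : ℕ} (x : Skein A a b) : comp x (one A b) = x := by
  induction x using induction_on with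
  | zero => simp only [zero_comp]
  | add x x' h h' => simp only [add_comp, h, h']
  | smul k x h => simp only [smul_comp, h]
  | of D => rw [one, of_comp]; exact of_congr (List.append_nil _)

theorem addBelow_comp {a b c : ℕ} (m : ℕ) (x : Skein A a b) (y : Skein A b c) :
    addBelow m (comp x y) = comp (addBelow m x) (addBelow m y) := by
  induction x using induction_on with
  | zero => simp only [zero_comp, map_zero]
  | add x x' h h' => simp only [add_comp, map_add, h, h']
  | smul k x h => simp only [smul_comp, map_smul, h]
  | of D =>
    induction y using induction_on with
    | zero => simp only [comp_zero, map_zero]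
    | add x x' h h' => simp only [comp_add, map_add, h, h']
    | smul k x h => simp only [comp_smul, map_smul, h]
    | of E => simp only [of_comp, addBelow_of]; exact of_congr rfl

theorem addAbove_comp {a b c : ℕ} (m : ℕ) (x : Skein A a b) (y : Skein A b c) :
    addAbove m (comp x y) = comp (addAbove m x) (addAbove m y) := by
  induction x using induction_on with
  | zero => simp only [zero_comp, map_zero]
  | add x x' h h' => simp only [add_comp, map_add, h, h']
  | smul k x h => simp only [smul_comp, map_smul, h]
  | of D =>
    induction y using induction_on with
    | zero => simp only [comp_zero, map_zero]
    | add x x' h h' => simp only [comp_add, map_add, h, h']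
    | smul k x h => simp only [comp_smul, map_smul, h]
    | of E =>
      simp only [of_comp, addAbove_of]
      exact of_congr (List.map_append)

end Skein

/-- All skein modules at once. -/
def SkeinFamily (A : K) : Type _ := ∀ a b : ℕ, Skein A a b

instance : AddCommGroup (SkeinFamily A) := inferInstanceAs (AddCommGroup (∀ a b : ℕ, Skein A a b))

instance : Module K (SkeinFamily A) := inferInstanceAs (Module K (∀ a b : ℕ, Skein A a b))

/-- The algebra of operators on all skein modules at once.  It contains every skein module, so that
skein elements with propositionally equal numbers of endpoints can be compared and multiplied. -/
def Op (A : K) : Type _ := Module.End K (SkeinFamily A)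

instance : Ring (Op A) := inferInstanceAs (Ring (Module.End K (SkeinFamily A)))

instance : Algebra K (Op A) := inferInstanceAs (Algebra K (Module.End K (SkeinFamily A)))

/-- A skein element, acting by juxtaposition on the left. -/
def leftMul {a b : ℕ} (x : Skein A a b) : Module.End K (SkeinFamily A) where
  toFun m := Pi.single (M := fun a => ∀ c, Skein A a c) a fun c => Skein.comp x (m b c)
  map_add' m m' := by
    refine Eq.trans ?_ (Pi.single_add (f := fun a => ∀ c, Skein A a c) a _ _)
    congr 1
    funext c
    exact Skein.comp_add x _ _
  map_smul' k m := by
    refine Eq.trans ?_ (Pi.single_smul (α := K) (f := fun a => ∀ c, Skein A a c) a k _)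
    congr 1
    funext c
    exact Skein.comp_smul k x _

/-- A skein element as an operator. -/
def emb {a b : ℕ} : Skein A a b →ₗ[K] Op A where
  toFun x := leftMul x
  map_add' x y := by
    refine LinearMap.ext fun m => ?_
    refine Eq.trans ?_ (Pi.single_add (f := fun a => ∀ c, Skein A a c) a _ _)
    refine congrArg (Pi.single (M := fun a => ∀ c, Skein A a c) a) ?_
    funext c
    exact Skein.add_comp x y _
  map_smul' k x := by
    refine LinearMap.ext fun m => ?_
    refine Eq.trans ?_ (Pi.single_smul (α := K) (f := fun a => ∀ c, Skein A a c) a k _)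
    refine congrArg (Pi.single (M := fun a => ∀ c, Skein A a c) a) ?_
    funext c
    exact Skein.smul_comp k x _

theorem emb_comp {a b c : ℕ} (x : Skein A a b) (y : Skein A b c) :
    emb (Skein.comp x y) = emb x * emb y := by
  refine LinearMap.ext fun m => ?_
  refine congrArg (Pi.single (M := fun a => ∀ c, Skein A a c) a) ?_
  funext d
  refine (Skein.comp_assoc x y (m c d)).trans (congrArg (Skein.comp x) ?_)
  exact (congrFun (Pi.single_eq_same (M := fun a => ∀ c, Skein A a c) b
    fun e => Skein.comp y (m c e)) d).symm

/-- A skein element is recovered from its operator by applying it to the family whose only nonzero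
entry is the identity diagram on `b` strands. -/
theorem emb_injective {a b : ℕ} : Function.Injective (emb : Skein A a b → Op A) := by
  intro x y h
  have key : ∀ z : Skein A a b, leftMul z (Pi.single (M := fun a => ∀ c, Skein A a c) b
      (Pi.single b (Skein.one A b))) a b = z := by
    intro z
    refine (congrFun (Pi.single_eq_same (M := fun a => ∀ c, Skein A a c) a _) b).trans ?_
    simp [Skein.comp_one]
  have h' : leftMul x = leftMul y := h
  rw [← key x, h', key y]

theorem emb_inj {a b : ℕ} {x y : Skein A a b} : emb x = emb y ↔ x = y := emb_injective.eq_iff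

open Classical in
/-- The operator of a word, considered as a diagram with `a` endpoints on the left and `b` on the
right (zero if it is not such a diagram). -/
def wd (A : K) (a b : ℕ) (w : List Slice) : Op A :=
  if h : IsDiagram a w b then emb (Skein.of A ⟨w, h⟩) else 0

theorem wd_eq {a b : ℕ} {w : List Slice} (h : IsDiagram a w b) :
    wd A a b w = emb (Skein.of A ⟨w, h⟩) := dif_pos h

theorem wd_word {a b : ℕ} (D : Diagram a b) : wd A a b D.word = emb (Skein.of A D) :=
  wd_eq D.isDiagram

theorem wd_of_not {a b : ℕ} {w : List Slice} (h : ¬ IsDiagram a w b) : wd A a b w = 0 := dif_neg h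

theorem wd_mul {a b c : ℕ} {u v : List Slice} (hu : IsDiagram a u b) (hv : IsDiagram b v c) :
    wd A a b u * wd A b c v = wd A a c (u ++ v) := by
  rw [wd_eq hu, wd_eq hv, wd_eq (hu.append hv), ← emb_comp, Skein.of_comp]; rfl

/-- Only the left factor has to be a diagram. It determines the number of strands after it, so if
`v` does not continue from `b`, both sides are zero. -/
theorem wd_append {a b c : ℕ} {u : List Slice} (hu : IsDiagram a u b) (v : List Slice) :
    wd A a c (u ++ v) = wd A a b u * wd A b c v := by
  by_cases hv : IsDiagram b v c
  · exact (wd_mul hu hv).symm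
  · rw [wd_of_not hv, mul_zero, wd_of_not]
    intro h
    obtain ⟨b', h1, h2⟩ := isDiagram_append_iff.1 h
    cases hu.unique h1
    exact hv h2

theorem emb_one (a : ℕ) : emb (Skein.one A a) = wd A a a [] := (wd_eq _).symm

theorem wd_nil_mul_emb {a b : ℕ} (x : Skein A a b) : wd A a a [] * emb x = emb x := by
  rw [← emb_one, ← emb_comp, Skein.one_comp]

theorem emb_mul_wd_nil {a b : ℕ} (x : Skein A a b) : emb x * wd A b b [] = emb x := by
  rw [← emb_one, ← emb_comp, Skein.comp_one]

theorem wd_nil_mul_wd (a b : ℕ) (w : List Slice) : wd A a a [] * wd A a b w = wd A a b w := by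
  by_cases h : IsDiagram a w b
  · rw [wd_eq h, wd_nil_mul_emb]
  · rw [wd_of_not h, mul_zero]

theorem wd_mul_wd_nil (a b : ℕ) (w : List Slice) : wd A a b w * wd A b b [] = wd A a b w := by
  by_cases h : IsDiagram a w b
  · rw [wd_eq h, emb_mul_wd_nil]
  · rw [wd_of_not h, zero_mul]

/-- A skein element with `l` additional strands above it and `c` below. -/
def pl (l c : ℕ) {p q : ℕ} : Skein A p q →ₗ[K] Op A :=
  emb ∘ₗ Skein.addAbove l ∘ₗ Skein.addBelow c

theorem pl_apply (l c : ℕ) {p q : ℕ} (x : Skein A p q) :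
    pl l c x = emb (Skein.addAbove l (Skein.addBelow c x)) := rfl

theorem pl_comp (l c : ℕ) {p q r : ℕ} (x : Skein A p q) (y : Skein A q r) :
    pl l c (Skein.comp x y) = pl l c x * pl l c y := by
  simp only [pl_apply, Skein.addBelow_comp, Skein.addAbove_comp, emb_comp]

theorem pl_of (l c : ℕ) {p q : ℕ} (D : Diagram p q) :
    pl l c (Skein.of A D) = wd A (l + (p + c)) (l + (q + c)) (D.word.map (Slice.shift l)) := by
  rw [pl_apply, Skein.addBelow_of, Skein.addAbove_of, ← wd_word]; rfl

theorem pl_one (l c p : ℕ) : pl l c (Skein.one A p) = wd A (l + (p + c)) (l + (p + c)) [] := by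
  rw [Skein.one, pl_of]; rfl

theorem wd_nil_mul_pl (l c : ℕ) {p q : ℕ} (x : Skein A p q) :
    wd A (l + (p + c)) (l + (p + c)) [] * pl l c x = pl l c x := wd_nil_mul_emb _

theorem pl_mul_wd_nil (l c : ℕ) {p q : ℕ} (x : Skein A p q) :
    pl l c x * wd A (l + (q + c)) (l + (q + c)) [] = pl l c x := emb_mul_wd_nil _

/-- The two skein elements live in different types, with `0 + _` endpoints on one side; the
comparison is possible only between operators, and there it reduces to diagrams by linearity. -/
theorem pl_zero_left (c : ℕ) {p q : ℕ} (x : Skein A p q) : pl 0 c x = emb (Skein.addBelow c x) := by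
  induction x using Skein.induction_on with
  | zero => simp
  | add x x' h h' => simp only [map_add, h, h']
  | smul k x h => simp only [map_smul, h]
  | of D =>
    rw [pl_of, shift_zero_map, Skein.addBelow_of, ← wd_word, Nat.zero_add, Nat.zero_add]; rfl

theorem pl_zero_right (l : ℕ) {p q : ℕ} (x : Skein A p q) : pl l 0 x = emb (Skein.addAbove l x) := by
  induction x using Skein.induction_on with
  | zero => simp
  | add x x' h h' => simp only [map_add, h, h']
  | smul k x h => simp only [map_smul, h]
  | of D => rw [pl_of, Skein.addAbove_of, ← wd_word]; rfl

theorem pl_zero_zero {p q : ℕ} (x : Skein A p q) : pl 0 0 x = emb x := by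
  induction x using Skein.induction_on with
  | zero => simp
  | add x x' h h' => simp only [map_add, h, h']
  | smul k x h => simp only [map_smul, h]
  | of D => rw [pl_of, shift_zero_map, ← wd_word, Nat.zero_add, Nat.zero_add]; rfl

theorem shift_shift (k l : ℕ) (w : List Slice) :
    (w.map (Slice.shift k)).map (Slice.shift l) = w.map (Slice.shift (l + k)) := by
  rw [List.map_map]
  congr 1
  funext x
  simp [Slice.shift, Nat.add_assoc]

theorem emb_tensor {a b c d : ℕ} (x : Skein A a b) (y : Skein A c d) :
    emb (Skein.tensor x y) = pl 0 c x * pl b 0 y := by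
  rw [Skein.tensor, emb_comp, pl_zero_left, pl_zero_right]

theorem pl_pl_addAbove (l c m : ℕ) {p q : ℕ} (x : Skein A p q) :
    pl l c (Skein.addAbove m x) = pl (l + m) c x := by
  induction x using Skein.induction_on with
  | zero => simp
  | add x x' h h' => simp only [map_add, h, h']
  | smul k x h => simp only [map_smul, h]
  | of D =>
    rw [Skein.addAbove_of, pl_of, pl_of, Diagram.addAbove, shift_shift]
    congr 1 <;> ring

theorem pl_pl_addBelow (l c m : ℕ) {p q : ℕ} (x : Skein A p q) :
    pl l c (Skein.addBelow m x) = pl l (m + c) x := by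
  induction x using Skein.induction_on with
  | zero => simp
  | add x x' h h' => simp only [map_add, h, h']
  | smul k x h => simp only [map_smul, h]
  | of D =>
    rw [Skein.addBelow_of, pl_of, pl_of, Diagram.addBelow]
    congr 1 <;> ring

theorem pl_tensor (l e : ℕ) {a b c d : ℕ} (x : Skein A a b) (y : Skein A c d) :
    pl l e (Skein.tensor x y) = pl l (c + e) x * pl (l + b) e y := by
  rw [Skein.tensor, pl_comp, pl_pl_addBelow, pl_pl_addAbove]

/-! ## Isotopy of words -/

theorem IsDiagram.place {a b N N' : ℕ} {w : List Slice} (h : IsDiagram a w b) (l c : ℕ)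
    (hN : N = l + (a + c)) (hN' : N' = l + (b + c)) : IsDiagram N (w.map (Slice.shift l)) N' := by
  subst hN hN'
  exact (h.addBelow c).addAbove l

/-- Two words that are diagrams with `a` and `b` endpoints and represent the same skein element. -/
structure Iso (A : K) (a b : ℕ) (X Y : List Slice) : Prop where
  left : IsDiagram a X b
  right : IsDiagram a Y b
  eq : wd A a b X = wd A a b Y

namespace Iso

theorem refl {a b : ℕ} {X : List Slice} (h : IsDiagram a X b) : Iso A a b X X := ⟨h, h, rfl⟩

theorem symm {a b : ℕ} {X Y : List Slice} (h : Iso A a b X Y) : Iso A a b Y X :=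
  ⟨h.right, h.left, h.eq.symm⟩

theorem trans {a b : ℕ} {X Y Z : List Slice} (h : Iso A a b X Y) (h' : Iso A a b Y Z) :
    Iso A a b X Z := ⟨h.left, h'.right, h.eq.trans h'.eq⟩

theorem append {a b c : ℕ} {X Y X' Y' : List Slice} (h : Iso A a b X Y) (h' : Iso A b c X' Y') :
    Iso A a c (X ++ X') (Y ++ Y') :=
  ⟨h.left.append h'.left, h.right.append h'.right, by
    rw [← wd_mul h.left h'.left, ← wd_mul h.right h'.right, h.eq, h'.eq]⟩

theorem append_left {a b c : ℕ} {U X Y : List Slice} (hU : IsDiagram a U b) (h : Iso A b c X Y) :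
    Iso A a c (U ++ X) (U ++ Y) := (refl hU).append h

theorem append_right {a b c : ℕ} {V X Y : List Slice} (h : Iso A a b X Y) (hV : IsDiagram b V c) :
    Iso A a c (X ++ V) (Y ++ V) := h.append (refl hV)

theorem cast {a b a' b' : ℕ} {X Y X' Y' : List Slice} (h : Iso A a b X Y) (ha : a = a')
    (hb : b = b') (hX : X = X') (hY : Y = Y') : Iso A a' b' X' Y' := by
  subst ha hb hX hY; exact h

theorem of_move {a b : ℕ} {X Y : List Slice} (h : RegularMove X Y) (hX : IsDiagram a X b)
    (hY : IsDiagram a Y b) : Iso A a b X Y := by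
  refine ⟨hX, hY, ?_⟩
  rw [wd_eq hX, wd_eq hY]
  congr 1
  rw [Skein.of, Skein.of, ← sub_eq_zero, ← map_sub, Submodule.mkQ_apply,
    Submodule.Quotient.mk_eq_zero]
  exact Submodule.subset_span (.isotopy ⟨[], [], X, Y, h, by simp, by simp⟩)

/-- Equality of operators is equality in the skein module (`emb_inj`), and this can be transported
along the linear map `pl`. -/
theorem place {a b : ℕ} {X Y : List Slice} (h : Iso A a b X Y) (l c : ℕ) {N N' : ℕ}
    (hN : N = l + (a + c)) (hN' : N' = l + (b + c)) :
    Iso A N N' (X.map (Slice.shift l)) (Y.map (Slice.shift l)) := by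
  subst hN hN'
  refine ⟨(h.left.addBelow c).addAbove l, (h.right.addBelow c).addAbove l, ?_⟩
  have := h.eq
  rw [wd_eq h.left, wd_eq h.right, emb_inj] at this
  have := congrArg (pl l c) this
  rwa [pl_of, pl_of] at this

theorem addBelow {a b : ℕ} {X Y : List Slice} (h : Iso A a b X Y) (c : ℕ) :
    Iso A (a + c) (b + c) X Y := by
  simpa [shift_zero_map] using h.place 0 c (by simp) (by simp)

/-- Slices at different heights commute. -/
theorem far_slice {p r q q' : ℕ} {x y : Slice} (hx : IsDiagram p [x] r) (hy : IsDiagram q [y] q') :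
    Iso A (p + q) (r + q') ([x] ++ [y].map (Slice.shift r)) ([y].map (Slice.shift p) ++ [x]) := by
  obtain ⟨P, l⟩ := x
  obtain ⟨Q, k⟩ := y
  have h1 : IsDiagram (p + q) ([⟨P, l⟩] ++ [⟨Q, k⟩].map (Slice.shift r)) (r + q') :=
    (hx.addBelow q).append (hy.addAbove r)
  have h2 : IsDiagram (p + q) ([⟨Q, k⟩].map (Slice.shift p) ++ [⟨P, l⟩]) (r + q') :=
    (hy.addAbove p).append (hx.addBelow q')
  rw [isDiagram_slice_iff] at hx hy
  -- The parameter of `RegularMove.far` is the number of strands between the pieces: those below `P`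
  -- in its own block, then the `k` strands above `Q` in the other.
  have e1 : r + k = l + P.out + (p - P.inp - l + k) := by omega
  have e2 : p + k = l + P.inp + (p - P.inp - l + k) := by omega
  simp only [List.map_cons, List.map_nil, Slice.shift, e1, e2] at h1 h2 ⊢
  exact of_move (.far P Q l _) h1 h2

/-- Words at different heights commute. -/
theorem far {p p' q q' : ℕ} {u v : List Slice} (hu : IsDiagram p u p') (hv : IsDiagram q v q') :
    Iso A (p + q) (p' + q') (u ++ v.map (Slice.shift p')) (v.map (Slice.shift p) ++ u) := by
  -- A single slice passes the whole right word; the slices of the left word then pass one at a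
  -- time.
  have key : ∀ {p r q q' : ℕ} {x : Slice} {v : List Slice}, IsDiagram p [x] r → IsDiagram q v q' →
      Iso A (p + q) (r + q') ([x] ++ v.map (Slice.shift r)) (v.map (Slice.shift p) ++ [x]) := by
    intro p r q q' x v hx hv
    induction v generalizing q with
    | nil => obtain rfl : q = q' := hv; exact refl (hx.addBelow q)
    | cons y v ih =>
      obtain ⟨t, hy, hv⟩ := isDiagram_cons_iff.1 hv
      have h1 := (far_slice (A := A) hx hy).append_right (hv.addAbove r)
      have h2 := append_left (hy.addAbove p) (ih hv)
      simpa using h1.trans (by simpa using h2)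
  induction u generalizing p with
  | nil => obtain rfl : p = p' := hu; simpa using refl (hv.addAbove p)
  | cons x u ih =>
    obtain ⟨t, hx, hu⟩ := isDiagram_cons_iff.1 hu
    have h1 := append_left (hx.addBelow q) (ih hu)
    have h2 := (key hx hv).append_right (hu.addBelow q')
    simpa using h1.trans (by simpa using h2)

theorem zigzag (a l : ℕ) (h : l + 1 ≤ a) : Iso A a a [birth l, death (l + 1)] [] :=
  of_move (.zigzag l)
    ((isDiagram_birth (by omega) rfl).append (isDiagram_death (l := l + 1) (by omega) rfl)) rfl

theorem zigzag' (a l : ℕ) (h : l + 1 ≤ a) : Iso A a a [birth (l + 1), death l] [] :=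
  of_move (.zigzag' l)
    ((isDiagram_birth (by omega) rfl).append (isDiagram_death (l := l) (by omega) rfl)) rfl

theorem reidemeisterII (s : Bool) (a l : ℕ) (h : l + 2 ≤ a) :
    Iso A a a [cross s l, cross (!s) l] [] :=
  of_move (.reidemeisterII s l) ((isDiagram_cross s h).append (isDiagram_cross (!s) h)) rfl

theorem slideBirth (s : Bool) (a l : ℕ) (h : l + 1 ≤ a) :
    Iso A a (a + 2) [birth l, cross s (l + 1)] [birth (l + 1), cross (!s) l] :=
  of_move (.slideBirth s l)
    ((isDiagram_birth (by omega) rfl).append (isDiagram_cross s (by omega)))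
    ((isDiagram_birth (by omega) rfl).append (isDiagram_cross (!s) (by omega)))

theorem slideDeath (s : Bool) (a l : ℕ) (h : l + 1 ≤ a) :
    Iso A (a + 2) a [cross s l, death (l + 1)] [cross (!s) (l + 1), death l] :=
  of_move (.slideDeath s l)
    ((isDiagram_cross s (by omega)).append (isDiagram_death (by omega) rfl))
    ((isDiagram_cross (!s) (by omega)).append (isDiagram_death (by omega) rfl))

theorem reidemeisterIII (s t u : Bool) (h : t = s ∨ t = u) (a l : ℕ) (ha : l + 3 ≤ a) :
    Iso A a a [cross s l, cross t (l + 1), cross u l] [cross u (l + 1), cross t l, cross s (l + 1)] :=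
  of_move (.reidemeisterIII s t u h l)
    ((isDiagram_cross s (by omega)).append
      ((isDiagram_cross t (by omega)).append (isDiagram_cross u (by omega))))
    ((isDiagram_cross u (by omega)).append
      ((isDiagram_cross t (by omega)).append (isDiagram_cross s (by omega))))

end Iso

/-! ## Bundles of crossings -/

theorem crossRow_zero (s : Bool) (l : ℕ) : crossRow s 0 l = [] := rfl

theorem crossRow_succ (s : Bool) (n l : ℕ) : crossRow s (n + 1) l = cross s (l + n) :: crossRow s n l := by
  simp [crossRow, List.range_succ]

theorem crossRow_add (s : Bool) (n m l : ℕ) :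
    crossRow s (n + m) l = crossRow s m (l + n) ++ crossRow s n l := by
  induction m with
  | zero => simp [crossRow_zero]
  | succ m ih => rw [← Nat.add_assoc, crossRow_succ, ih, crossRow_succ]; simp [Nat.add_assoc]

theorem crossRow_shift (s : Bool) (n l c : ℕ) :
    (crossRow s n l).map (Slice.shift c) = crossRow s n (c + l) := by
  simp [crossRow, Slice.shift, Nat.add_assoc]

theorem isDiagram_crossRow (s : Bool) (n l a : ℕ) (h : l + n + 1 ≤ a) :
    IsDiagram a (crossRow s n l) a := by
  refine isDiagram_of_cross _ _ fun x hx => ?_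
  simp only [crossRow, List.mem_reverse, List.mem_map, List.mem_range] at hx
  obtain ⟨j, hj, rfl⟩ := hx
  exact ⟨s, _, rfl, by omega⟩

theorem crossGrid_zero_right (s : Bool) (n l : ℕ) : crossGrid s n 0 l = [] := rfl

theorem crossGrid_zero_left (s : Bool) (m l : ℕ) : crossGrid s 0 m l = [] := by
  simp [crossGrid, crossRow_zero]

theorem crossGrid_succ (s : Bool) (n m l : ℕ) :
    crossGrid s n (m + 1) l = crossGrid s n m l ++ crossRow s n (l + m) := by
  simp [crossGrid, List.range_succ]

theorem crossGrid_add (s : Bool) (n m m' l : ℕ) :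
    crossGrid s n (m + m') l = crossGrid s n m l ++ crossGrid s n m' (l + m) := by
  induction m' with
  | zero => simp [crossGrid_zero_right]
  | succ m' ih => rw [← Nat.add_assoc, crossGrid_succ, ih, crossGrid_succ]; simp [Nat.add_assoc]

theorem crossGrid_shift (s : Bool) (n m l c : ℕ) :
    (crossGrid s n m l).map (Slice.shift c) = crossGrid s n m (c + l) := by
  induction m with
  | zero => rfl
  | succ m ih => rw [crossGrid_succ, List.map_append, ih, crossRow_shift, crossGrid_succ, Nat.add_assoc]

namespace Iso

/-- The elementary case of sliding a strand across a diagram. For arcs it is a slide move combined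
with Reidemeister II; for a crossing it is Reidemeister III, whose condition holds because the
sliding strand lies over both others or under both. -/
theorem slice_crossRow (s : Bool) (P : Piece) (l : ℕ) :
    Iso A (l + P.inp + 1) (l + P.out + 1) ([⟨P, l⟩] ++ crossRow s P.out l)
      (crossRow s P.inp l ++ [⟨P, l + 1⟩]) := by
  cases P with
  | birth =>
    have h1 := (slideBirth (A := A) s (l + 1) l le_rfl).append_right
      (isDiagram_cross (a := l + 3) (l := l) s (by omega))
    have h2 := append_left (isDiagram_birth (a := l + 1) (l := l + 1) le_rfl rfl)
      (reidemeisterII (A := A) (!s) (l + 1 + 2) l (by omega))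
    simpa [crossRow, Piece.inp, Piece.out, List.range_succ] using h1.trans (by simpa using h2)
  | death =>
    have h1 := append_left (isDiagram_cross (a := l + 3) (l := l + 1) s (by omega))
      (slideDeath (A := A) s (l + 1) l le_rfl)
    have h2 := (reidemeisterII (A := A) s (l + 3) (l + 1) (by omega)).append_right
      (isDiagram_death (b := l + 1) (l := l) (by omega) rfl)
    simpa [crossRow, Piece.inp, Piece.out, List.range_succ] using
      (Iso.trans (by simpa using h1) h2).symm
  | cross t =>
    simpa [crossRow, Piece.inp, Piece.out, List.range_succ] using
      reidemeisterIII (A := A) t s s (.inr rfl) (l + 3) l le_rfl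

/-- A strand slides across a diagram. -/
theorem crossRow_natural (s : Bool) {a b : ℕ} {w : List Slice} (h : IsDiagram a w b) :
    Iso A (a + 1) (b + 1) (w ++ crossRow s b 0) (crossRow s a 0 ++ w.map (Slice.shift 1)) := by
  induction w generalizing a with
  | nil => obtain rfl : a = b := h; simpa using refl (isDiagram_crossRow s a 0 (a + 1) (by omega))
  | cons x w ih =>
    obtain ⟨r, hx, hw⟩ := isDiagram_cons_iff.1 h
    obtain ⟨P, l⟩ := x
    have hx' := hx
    rw [isDiagram_slice_iff] at hx'
    obtain ⟨c, rfl⟩ := Nat.exists_eq_add_of_le hx'.1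
    obtain rfl : r = l + P.out + c := by omega
    have hP : IsDiagram (l + P.inp) [⟨P, l⟩] (l + P.out) :=
      isDiagram_slice_iff.2 ⟨by omega, by omega⟩
    have hP0 : IsDiagram P.inp [⟨P, 0⟩] P.out := isDiagram_slice_iff.2 ⟨by omega, by omega⟩
    -- The row splits at the piece into a lower, a middle and an upper part. The lower part commutes
    -- with the piece (`h2`), the middle part slides across it (`h3`), the upper part commutes again
    -- (`h4`).
    have h1 := append_left (hx.addBelow 1) (ih hw)
    have h2 := (far (A := A) hP (isDiagram_crossRow s c 0 (c + 1) (by omega))).append_right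
      (isDiagram_crossRow s (l + P.out) 0 (l + P.out + (c + 1)) (by omega))
    have h3 := append_left (isDiagram_crossRow s c (l + P.inp) (l + P.inp + 1 + c) (by omega))
      (((slice_crossRow (A := A) s P l).append_right
        (isDiagram_crossRow s l 0 _ (by omega))).addBelow c)
    have h4 := append_left (isDiagram_crossRow s (P.inp + c) l (l + 1 + (P.inp + c)) (by omega))
      (far (A := A) (isDiagram_crossRow s l 0 (l + 1) (by omega)) (hP0.addBelow c)).symm
    rw [crossRow_shift, crossRow_shift] at h2
    have e1 : crossRow s (l + P.out + c) 0 = crossRow s c (l + P.out) ++ crossRow s (l + P.out) 0 := by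
      rw [crossRow_add s (l + P.out) c]; simp
    have e2 : crossRow s (l + P.out) 0 = crossRow s P.out l ++ crossRow s l 0 := by
      rw [crossRow_add s l P.out]; simp
    have e3 : crossRow s (l + P.inp + c) 0 = crossRow s (P.inp + c) l ++ crossRow s l 0 := by
      rw [Nat.add_assoc, crossRow_add s l (P.inp + c)]; simp
    have e4 : crossRow s (P.inp + c) l = crossRow s c (l + P.inp) ++ crossRow s P.inp l :=
      crossRow_add ..
    have h2' := h2.cast (a' := l + P.inp + c + 1) (b' := l + P.out + c + 1)
      (X' := [⟨P, l⟩] ++ crossRow s (l + P.out + c) 0)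
      (Y' := crossRow s c (l + P.inp) ++ (([⟨P, l⟩] ++ crossRow s P.out l) ++ crossRow s l 0))
      (by ring) (by ring) (by simp [e1]) (by simp [e2])
    have h3' := h3.cast (a' := l + P.inp + c + 1) (b' := l + P.out + c + 1)
      (Y' := crossRow s (P.inp + c) l ++ ([⟨P, l + 1⟩] ++ crossRow s l 0))
      (by ring) (by ring) rfl (by simp [e4])
    have h4' := h4.cast (a' := l + P.inp + c + 1) (b' := l + P.out + c + 1)
      (X' := crossRow s (P.inp + c) l ++ ([⟨P, l + 1⟩] ++ crossRow s l 0))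
      (Y' := crossRow s (l + P.inp + c) 0 ++ [⟨P, l + 1⟩])
      (by ring) (by ring) rfl (by simp [e3, Slice.shift])
    have h5 := ((h2'.trans h3').trans h4').append_right
      (hw.place 1 0 (by ring) (Nat.add_comm b 1))
    refine h1.trans (h5.cast rfl rfl (by simp) ?_)
    simp [Slice.shift, Nat.add_comm l 1]

/-- A bundle of strands slides across a diagram above it. -/
theorem crossGrid_natural (s : Bool) (m : ℕ) {a b : ℕ} {w : List Slice} (h : IsDiagram a w b) :
    Iso A (a + m) (b + m) (w ++ crossGrid s b m 0)
      (crossGrid s a m 0 ++ w.map (Slice.shift m)) := by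
  induction m with
  | zero => simpa [crossGrid_zero_right, shift_zero_map] using refl h
  | succ m ih =>
    have h1 := (ih.addBelow 1).append_right
      (isDiagram_crossRow s b m (b + m + 1) (by omega))
    have h2 := append_left (isDiagram_crossGrid s a m 0 (a + m + 1) (by omega))
      ((crossRow_natural (A := A) s h).place m 0 (by ring) (N' := b + m + 1) (by ring))
    refine (h1.cast rfl rfl ?_ rfl).trans (h2.cast rfl rfl ?_ ?_)
    · simp [crossGrid_succ]
    · simp [crossRow_shift]
    · rw [List.map_append, shift_shift, crossRow_shift, crossGrid_succ]
      simp

theorem crossRow_one (s : Bool) (l : ℕ) : crossRow s 1 l = [cross s l] := by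
  simp [crossRow]

/-- The lowest strand of the upper bundle crosses first. -/
theorem crossGrid_succ_left (s : Bool) (n m : ℕ) :
    Iso A (n + 1 + m) (n + 1 + m) (crossGrid s (n + 1) m 0)
      (crossGrid s 1 m n ++ crossGrid s n m 0) := by
  induction m with
  | zero => exact refl rfl
  | succ m ih =>
    have h1 := (ih.addBelow 1).append_right
      (isDiagram_crossRow s (n + 1) m (n + 1 + m + 1) (by omega))
    have h2 := append_left (isDiagram_crossGrid s 1 m n (n + m + 2) (by omega))
      ((far (A := A) (isDiagram_crossGrid s n m 0 (n + m) (by omega))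
        (isDiagram_cross (a := 2) (l := 0) s le_rfl)).append_right
        (isDiagram_crossRow s n m (n + m + 2) (by omega)))
    refine (h1.cast (by ring) (by ring) ?_ rfl).trans (h2.cast (by ring) (by ring) ?_ ?_)
    · simp [crossGrid_succ]
    · simp [crossRow_succ, Slice.shift, Nat.add_comm n m]
    · simp [crossGrid_succ, Slice.shift, crossRow_one]

/-- Splitting the lower bundle is an equality of words (`crossGrid_add`); splitting the upper bundle
reorders the crossings and is only an isotopy. -/
theorem crossGrid_add_left (s : Bool) (n n' m : ℕ) :
    Iso A (n + n' + m) (n + n' + m) (crossGrid s (n + n') m 0)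
      (crossGrid s n' m n ++ crossGrid s n m 0) := by
  induction n' with
  | zero => simpa [crossGrid_zero_left] using refl (isDiagram_crossGrid s n m 0 (n + m) (by omega))
  | succ k ih =>
    have h1 := crossGrid_succ_left (A := A) s (n + k) m
    have h2 := append_left (isDiagram_crossGrid s 1 m (n + k) (n + k + m + 1) (by omega))
      (ih.addBelow 1)
    have h3 := ((crossGrid_succ_left (A := A) s k m).place n 0 rfl rfl).append_right
      (isDiagram_crossGrid s n m 0 (n + (k + 1 + m)) (by omega))
    refine (h1.cast (by ring) (by ring) rfl rfl).trans ((h2.cast (by ring) (by ring) rfl rfl).trans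
      (h3.symm.cast (by ring) (by ring) ?_ ?_))
    · simp [crossGrid_shift]
    · simp [crossGrid_shift]

/-- The strand crosses back over the same strands in reverse order, so the crossings cancel in pairs
by Reidemeister II, from the inside outwards. -/
theorem crossRow_crossGrid (s : Bool) (n l : ℕ) :
    Iso A (l + n + 1) (l + n + 1) (crossRow s n l ++ crossGrid (!s) 1 n l) [] := by
  induction n with
  | zero => exact refl rfl
  | succ n ih =>
    have h1 := (append_left (isDiagram_cross (a := l + n + 2) (l := l + n) s (by omega))
      (ih.addBelow 1)).append_right
      (isDiagram_cross (a := l + n + 2) (l := l + n) (!s) (by omega))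
    refine (h1.cast (by ring) (by ring) ?_ rfl).trans
      ((reidemeisterII s (l + n + 2) (l + n) le_rfl).cast (by ring) (by ring) (by simp) rfl)
    simp [crossRow_succ, crossGrid_succ, crossRow_zero]

/-- Reidemeister II for bundles. In the second grid `n` and `m` are interchanged because the bundles
have changed places. -/
theorem crossGrid_inverse (s : Bool) (n m : ℕ) :
    Iso A (n + m) (n + m) (crossGrid s n m 0 ++ crossGrid (!s) m n 0) [] := by
  induction m with
  | zero =>
    simpa [crossGrid_zero_left, crossGrid_zero_right] using
      refl (A := A) (show IsDiagram n [] n from rfl)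
  | succ m ih =>
    have h1 := append_left (isDiagram_crossGrid s n (m + 1) 0 (n + m + 1) (by omega))
      ((crossGrid_succ_left (A := A) (!s) m n).cast (a' := n + m + 1) (b' := n + m + 1)
        (by ring) (by ring) rfl rfl)
    have h2 := (append_left (isDiagram_crossGrid s n m 0 (n + m + 1) (by omega))
      ((crossRow_crossGrid (A := A) s n m).cast (by ring) (by ring) rfl rfl)).append_right
      (isDiagram_crossGrid (!s) m n 0 (n + m + 1) (by omega))
    refine h1.trans ((h2.cast rfl rfl ?_ ?_).trans (ih.addBelow 1))
    · simp [crossGrid_succ]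
    · simp

/-- A bundle of strands slides across a diagram below it. -/
theorem crossGrid_natural_below (s : Bool) (n : ℕ) {a b : ℕ} {w : List Slice}
    (h : IsDiagram a w b) :
    Iso A (n + a) (n + b) (w.map (Slice.shift n) ++ crossGrid s n b 0)
      (crossGrid s n a 0 ++ w) := by
  -- No new induction: `crossGrid_natural` for the opposite sign is multiplied on both sides by
  -- grids that are inverse to those occurring in it.
  have h1 := append_left (h.place n 0 rfl rfl) (crossGrid_inverse (A := A) s n b)
  have h2 := (append_left (isDiagram_crossGrid s n a 0 (n + a) (by omega))
    ((crossGrid_natural (A := A) (!s) n h).cast (by ring) (by ring) rfl rfl)).append_right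
    (isDiagram_crossGrid s n b 0 (n + b) (by omega))
  have h3 := (crossGrid_inverse (A := A) s n a).append_right ((h.place n 0 rfl rfl).append
    (isDiagram_crossGrid s n b 0 (n + b) (by omega)))
  have h4 := append_left (isDiagram_crossGrid s n a 0 (n + a) (by omega))
    (append_left (b := n + b) (h.place 0 n (by ring) (by ring))
      ((crossGrid_inverse (A := A) (!s) b n).cast (a' := n + b) (b' := n + b)
        (by ring) (by ring) rfl rfl))
  have h5 : Iso A (n + a) (n + b)
    (crossGrid s n a 0 ++ (w ++ crossGrid (!s) b n 0) ++ crossGrid s n b 0)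
    (crossGrid s n a 0 ++ w) := h4.cast rfl rfl (by simp [shift_zero_map]) (by simp [shift_zero_map])
  refine Iso.trans ?_ h5
  refine Iso.trans ?_ h2.symm
  refine h3.symm.cast (by ring) rfl (by simp) (by simp)

end Iso

/-! ## Bundles of arcs -/

theorem nestedBirths_succ (k l : ℕ) :
    nestedBirths (k + 1) l = nestedBirths k l ++ [birth (l + k)] := by
  simp [nestedBirths, List.range_succ]

theorem nestedBirths_succ' (k l : ℕ) :
    nestedBirths (k + 1) l = birth l :: nestedBirths k (l + 1) := by
  simp [nestedBirths, List.range_succ_eq_map, Nat.add_assoc, Nat.add_comm 1]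

theorem nestedBirths_add (k k' l : ℕ) :
    nestedBirths (k + k') l = nestedBirths k l ++ nestedBirths k' (l + k) := by
  induction k' with
  | zero => simp [nestedBirths]
  | succ m ih => rw [← Nat.add_assoc, nestedBirths_succ, ih, nestedBirths_succ]; simp [Nat.add_assoc]

theorem nestedBirths_shift (k l c : ℕ) :
    (nestedBirths k l).map (Slice.shift c) = nestedBirths k (c + l) := by
  simp [nestedBirths, Slice.shift, Nat.add_assoc]

theorem nestedDeaths_succ (k l : ℕ) :
    nestedDeaths (k + 1) l = death (l + k) :: nestedDeaths k l := by
  simp [nestedDeaths, List.range_succ]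

theorem nestedDeaths_succ' (k l : ℕ) :
    nestedDeaths (k + 1) l = nestedDeaths k (l + 1) ++ [death l] := by
  simp [nestedDeaths, List.range_succ_eq_map, Nat.add_assoc, Nat.add_comm 1]

theorem nestedDeaths_add (k k' l : ℕ) :
    nestedDeaths (k + k') l = nestedDeaths k' (l + k) ++ nestedDeaths k l := by
  induction k' with
  | zero => simp [nestedDeaths]
  | succ m ih => rw [← Nat.add_assoc, nestedDeaths_succ, ih, nestedDeaths_succ]; simp [Nat.add_assoc]

theorem nestedDeaths_shift (k l c : ℕ) :
    (nestedDeaths k l).map (Slice.shift c) = nestedDeaths k (c + l) := by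
  simp [nestedDeaths, Slice.shift, Nat.add_assoc]

theorem isDiagram_nestedBirths' {k l a b : ℕ} (h : l ≤ a) (hb : b = a + 2 * k) :
    IsDiagram a (nestedBirths k l) b := hb ▸ isDiagram_nestedBirths k l a h

theorem isDiagram_nestedDeaths' {k l a b : ℕ} (h : l ≤ b) (ha : a = b + 2 * k) :
    IsDiagram a (nestedDeaths k l) b := ha ▸ isDiagram_nestedDeaths k l b h

namespace Iso

/-- The outermost arc `⊂` and the innermost arc `⊃` lie on the same zigzag. Once the other births
are commuted away they are adjacent and cancel. -/
theorem nested_zigzag (n : ℕ) : Iso A n n (nestedBirths n 0 ++ nestedDeaths n n) [] := by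
  induction n with
  | zero => exact refl rfl
  | succ n ih =>
    have h1 := (append_left (isDiagram_birth (a := n + 1) (l := 0) (by omega) rfl)
      ((far (A := A) (isDiagram_nestedBirths' (k := n) (l := 1) (a := 1) le_rfl rfl)
        (isDiagram_death (a := n + 2) (b := n) (l := 0) (by omega) rfl)).cast
          (by ring) rfl rfl rfl)).append_right
      (isDiagram_nestedDeaths' (k := n) (l := n + 1) (b := n + 1) le_rfl (by ring))
    have h2 := (zigzag (A := A) (n + 1) 0 (by omega)).append_right
      ((isDiagram_nestedBirths' (k := n) (l := 1) (by omega) rfl).append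
      (isDiagram_nestedDeaths' (k := n) (l := n + 1) (b := n + 1) le_rfl (by ring)))
    have h3 := ih.place 1 0 rfl rfl
    refine Iso.trans (h1.cast rfl rfl ?_ rfl) (Iso.trans (h2.cast rfl rfl ?_ rfl)
      (h3.cast (by ring) (by ring) ?_ rfl))
    · rw [nestedBirths_succ', nestedDeaths_succ]
      simp [Slice.shift]; ring
    · simp [Slice.shift]
    · simp [nestedBirths_shift, nestedDeaths_shift, Nat.add_comm]

theorem nested_zigzag' (n : ℕ) : Iso A n n (nestedBirths n n ++ nestedDeaths n 0) [] := by
  induction n with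
  | zero => exact refl rfl
  | succ n ih =>
    have h1 := (append_left (isDiagram_birth (a := n + 1) (l := n + 1) (by omega) rfl)
      ((far (A := A) (isDiagram_death (a := n + 2) (b := n) (l := n) (by omega) rfl)
      (isDiagram_nestedBirths' (k := n) (l := 0) (a := 1) (by omega) rfl)).symm.cast
          (by ring) rfl rfl rfl)).append_right
      (isDiagram_nestedDeaths' (k := n) (l := 0) (b := n + 1) (by omega) (by ring))
    have h2 := (zigzag' (A := A) (n + 1) n (by omega)).append_right
      ((isDiagram_nestedBirths' (k := n) (l := n) (by omega) rfl).append
      (isDiagram_nestedDeaths' (k := n) (l := 0) (b := n + 1) (by omega) (by ring)))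
    have h3 := ih.addBelow 1
    refine Iso.trans (h1.cast rfl rfl ?_ rfl) (Iso.trans (h2.cast rfl rfl ?_ rfl)
      (h3.cast (by ring) (by ring) ?_ rfl))
    · rw [nestedBirths_succ', nestedDeaths_succ]
      simp [nestedBirths_shift]
    · simp [nestedBirths_shift]
    · simp

/-- A hook on the lower ends of the arcs is pulled along the two arcs it meets and becomes a hook on
their upper ends. For this reason one projector per bundle of arcs is enough. -/
theorem nestedBirths_death (q j : ℕ) :
    Iso A 0 (2 * (q + j + 1)) (nestedBirths (q + j + 2) 0 ++ [death (q + 2 * j + 2)])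
      (nestedBirths (q + j) 0 ++ [birth q]) := by
  have h1 := append_left (isDiagram_nestedBirths' (k := q + 2) (l := 0) (a := 0) le_rfl rfl)
    ((far (A := A) (isDiagram_nestedBirths' (k := j) (l := q + 2) (a := q + 2) le_rfl rfl)
      (isDiagram_death (a := q + 2) (b := q) (l := 0) (by omega) rfl)).cast (by ring) rfl rfl rfl)
  have h2 := (append_left (isDiagram_nestedBirths' (k := q + 1) (l := 0) (a := 0) le_rfl rfl)
    (zigzag (A := A) (0 + 2 * (q + 1)) (q + 1) (by omega))).append_right
    (isDiagram_nestedBirths' (k := j) (l := q + 2) (by omega) rfl)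
  have h3 := append_left (isDiagram_nestedBirths' (k := q) (l := 0) (a := 0) le_rfl rfl)
    ((far (A := A) (isDiagram_birth (a := q) (l := q) le_rfl rfl)
    (isDiagram_nestedBirths' (k := j) (l := 0) (a := q) (by omega) rfl)).cast (by ring) rfl rfl rfl)
  refine Iso.trans (h1.cast rfl (by ring) ?_ rfl) (Iso.trans (h2.cast rfl (by ring) ?_ rfl)
    (h3.cast rfl (by ring) ?_ ?_))
  · rw [show q + j + 2 = q + 2 + j by ring, nestedBirths_add (q + 2) j]
    simp [Slice.shift]; ring
  · rw [nestedBirths_succ (q + 1)]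
    simp [Slice.shift]
  · rw [nestedBirths_succ q]
    simp [nestedBirths_shift]
  · rw [nestedBirths_add]
    simp [nestedBirths_shift]

theorem birth_nestedDeaths (q j : ℕ) :
    Iso A (2 * (q + j + 1)) 0 ([birth (q + 2 * j + 2)] ++ nestedDeaths (q + j + 2) 0)
      ([death q] ++ nestedDeaths (q + j) 0) := by
  have h1 := ((far (A := A) (isDiagram_nestedDeaths' (k := j) (l := q + 2) (b := q + 2) le_rfl rfl)
      (isDiagram_birth (a := q) (l := 0) (by omega) rfl)).symm.cast rfl
        (show q + 2 + (q + 2) = 0 + 2 * (q + 2) by ring) rfl rfl).append_right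
    (isDiagram_nestedDeaths' (k := q + 2) (l := 0) (b := 0) le_rfl rfl)
  have h2 := append_left (isDiagram_nestedDeaths' (k := j) (l := q + 2) (by omega) rfl)
    ((zigzag' (A := A) (0 + 2 * (q + 1)) (q + 1) (by omega)).append_right
    (isDiagram_nestedDeaths' (k := q + 1) (l := 0) (b := 0) le_rfl rfl))
  have h3 := ((far (A := A) (isDiagram_death (b := q) (l := q) le_rfl rfl)
    (isDiagram_nestedDeaths' (k := j) (l := 0) (b := q) (by omega) rfl)).symm.cast rfl
    (show q + q = 0 + 2 * q by ring) rfl rfl).append_right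
    (isDiagram_nestedDeaths' (k := q) (l := 0) (b := 0) le_rfl rfl)
  refine Iso.trans (h1.cast (by ring) rfl ?_ rfl) (Iso.trans (h2.cast (by ring) rfl ?_ rfl)
    (h3.cast (by ring) rfl ?_ ?_))
  · rw [show q + j + 2 = q + 2 + j by ring, nestedDeaths_add (q + 2) j]
    simp [Slice.shift]; ring
  · rw [nestedDeaths_succ (q + 1)]
    simp [Slice.shift]
  · rw [nestedDeaths_succ q]
    simp [nestedDeaths_shift]
  · rw [nestedDeaths_add]
    simp [nestedDeaths_shift]

/-! ## Isotopies of cables -/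

/-- A bundle crossing both legs of the nested arcs slides off them by naturality. The grid crossing
both legs is a product of two grids, one of which is carried to the other side by its inverse. -/
theorem cable_slideBirth (s : Bool) (n : ℕ) :
    Iso A n (3 * n) (nestedBirths n 0 ++ crossGrid s n n n)
      (nestedBirths n n ++ crossGrid (!s) n n 0) := by
  have hb : IsDiagram 0 (nestedBirths n 0) (n + n) := isDiagram_nestedBirths' le_rfl (by ring)
  have h1 := append_left (hb.addBelow n) (append_left
    (isDiagram_crossGrid s n n n (n + n + n) (by omega))
    ((crossGrid_inverse (A := A) s n n).addBelow n))
  have h2 := (append_left (hb.addBelow n) (crossGrid_add_left (A := A) s n n n)).append_right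
    (isDiagram_crossGrid (!s) n n 0 _ (by omega))
  have h3 := (crossGrid_natural (A := A) s n hb).append_right
    (isDiagram_crossGrid (!s) n n 0 _ (by omega))
  refine Iso.trans (h1.symm.cast (by ring) (by ring) (by simp) rfl) (Iso.trans
    (h2.symm.cast (by ring) (by ring) (by simp) rfl) (h3.cast (by ring) (by ring) rfl ?_))
  rw [crossGrid_zero_left, nestedBirths_shift]; simp

theorem cable_slideDeath (s : Bool) (n : ℕ) :
    Iso A (3 * n) n (crossGrid s n n 0 ++ nestedDeaths n n)
      (crossGrid (!s) n n n ++ nestedDeaths n 0) := by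
  have hb : IsDiagram (n + n) (nestedDeaths n 0) 0 := isDiagram_nestedDeaths' le_rfl (by ring)
  have h0 : Iso A (n + n + n) (n + n + n) (crossGrid (!s) n n n ++ crossGrid s n n n) [] := by
    refine ((crossGrid_inverse (A := A) (!s) n n).place n 0 (N := n + n + n) (by ring)
      (N' := n + n + n) (by ring)).cast rfl rfl ?_ rfl
    simp [crossGrid_shift]
  have h1 := h0.append_right ((isDiagram_crossGrid s n n 0 (n + n + n) (by omega)).append
    (isDiagram_nestedDeaths' (k := n) (l := n) (b := n) (by omega) (by ring)))
  have h2 := append_left (isDiagram_crossGrid (!s) n n n (n + n + n) (by omega))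
    ((crossGrid_add_left (A := A) s n n n).append_right
      (isDiagram_nestedDeaths' (k := n) (l := n) (b := n) (by omega) (by ring)))
  have h3 := append_left (isDiagram_crossGrid (!s) n n n (n + n + n) (by omega))
    (crossGrid_natural (A := A) s n hb)
  refine Iso.trans (h1.symm.cast (by ring) (by ring) (by simp) rfl) (Iso.trans
    (h2.symm.cast (by ring) (by ring) (by simp) rfl) (h3.symm.cast (by ring) (by ring) ?_ ?_))
  · rw [nestedDeaths_shift]; simp
  · rw [crossGrid_zero_left]; simp

/-- The two grids of sign `t` on one side combine to a single grid in which one bundle crosses the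
two others, and the remaining grid slides through it. Whether the crossing bundle is the upper or
the lower one depends on which of `s` and `u` equals `t`. -/
theorem cable_reidemeisterIII (s t u : Bool) (h : t = s ∨ t = u) (n : ℕ) :
    Iso A (3 * n) (3 * n) (crossGrid s n n 0 ++ crossGrid t n n n ++ crossGrid u n n 0)
      (crossGrid u n n n ++ crossGrid t n n 0 ++ crossGrid s n n n) := by
  have hd : ∀ s, IsDiagram (n + n) (crossGrid s n n 0) (n + n) :=
    fun s => isDiagram_crossGrid s n n 0 _ (by omega)
  rcases h with rfl | rfl
  · have h1 := crossGrid_natural_below (A := A) t n (hd u)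
    rw [crossGrid_add] at h1
    refine (h1.symm.cast (by ring) (by ring) ?_ ?_)
    · simp
    · simp [crossGrid_shift]
  · have h1 := append_left ((hd s).addBelow n) (crossGrid_add_left (A := A) t n n n)
    have h2 := crossGrid_natural (A := A) t n (hd s)
    have h3 := (crossGrid_add_left (A := A) t n n n).append_right
      (isDiagram_crossGrid s n n n _ (by omega))
    refine Iso.trans (h1.symm.cast (by ring) (by ring) (by simp) rfl) (Iso.trans
      (h2.cast (by ring) (by ring) rfl rfl) (h3.cast (by ring) (by ring) ?_ rfl))
    simp [crossGrid_shift]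

end Iso

/-! ## Elementary operators -/

theorem wd_crossTrue {a l : ℕ} (h : l + 2 ≤ a) :
    wd A a a [cross true l] = A • wd A a a [] + A⁻¹ • wd A a a [death l, birth l] := by
  have h1 : IsDiagram a [cross true l] a := isDiagram_cross true h
  obtain ⟨c, rfl⟩ := Nat.exists_eq_add_of_le' (show 2 ≤ a by omega)
  have h2 : IsDiagram (c + 2) [death l, birth l] (c + 2) :=
    (isDiagram_death (b := c) (by omega) rfl).append (isDiagram_birth (l := l) (by omega) rfl)
  have := Skein.mkQ_eq_zero (A := A)
    (.crossTrue [] [] l (D := ⟨_, h1⟩) (D₀ := ⟨[], isDiagram_nil _⟩) (D₁ := ⟨_, h2⟩) rfl rfl rfl)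
  rw [map_sub, map_sub, Skein.mkQ_single, Skein.mkQ_single, Skein.mkQ_single, one_smul, sub_sub,
    sub_eq_zero] at this
  rw [wd_eq h1, wd_eq (isDiagram_nil _), wd_eq h2, this, map_add, map_smul, map_smul]

theorem wd_crossFalse {a l : ℕ} (h : l + 2 ≤ a) :
    wd A a a [cross false l] = A⁻¹ • wd A a a [] + A • wd A a a [death l, birth l] := by
  have h1 : IsDiagram a [cross false l] a := isDiagram_cross false h
  obtain ⟨c, rfl⟩ := Nat.exists_eq_add_of_le' (show 2 ≤ a by omega)
  have h2 : IsDiagram (c + 2) [death l, birth l] (c + 2) :=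
    (isDiagram_death (b := c) (by omega) rfl).append (isDiagram_birth (l := l) (by omega) rfl)
  have := Skein.mkQ_eq_zero (A := A)
    (.crossFalse [] [] l (D := ⟨_, h1⟩) (D₀ := ⟨[], isDiagram_nil _⟩) (D₁ := ⟨_, h2⟩) rfl rfl rfl)
  rw [map_sub, map_sub, Skein.mkQ_single, Skein.mkQ_single, Skein.mkQ_single, one_smul, sub_sub,
    sub_eq_zero] at this
  rw [wd_eq h1, wd_eq (isDiagram_nil _), wd_eq h2, this, map_add, map_smul, map_smul]

theorem wd_circle {a l : ℕ} (h : l ≤ a) :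
    wd A a a [birth l, death l] = (-(A ^ 2 + A⁻¹ ^ 2)) • wd A a a [] := by
  have h1 : IsDiagram a [birth l, death l] a :=
    (isDiagram_birth h rfl).append (isDiagram_death (l := l) h rfl)
  have := Skein.mkQ_eq_zero (A := A)
    (.circle [] [] l (D := ⟨_, h1⟩) (D₀ := ⟨[], isDiagram_nil _⟩) rfl rfl)
  rw [map_add, Skein.mkQ_single, Skein.mkQ_single, one_smul] at this
  rw [wd_eq h1, wd_eq (isDiagram_nil _), eq_neg_of_add_eq_zero_left this, map_neg, map_smul,
    neg_smul]

/-! ## Normal form -/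

theorem IsDiagram.length_deaths {a b : ℕ} {L : List ℕ} (h : IsDiagram a (L.map death) b) :
    a = b + 2 * L.length := by
  induction L generalizing a with
  | nil => simpa [IsDiagram] using h
  | cons i L ih =>
    obtain ⟨c, h1, h2⟩ := isDiagram_cons_iff.1 h
    rw [isDiagram_death_iff] at h1
    have := ih h2
    simp only [List.length_cons]; omega

theorem IsDiagram.length_births {a b : ℕ} {L : List ℕ} (h : IsDiagram a (L.map birth) b) :
    b = a + 2 * L.length := by
  induction L generalizing a with
  | nil => exact h.symm
  | cons i L ih =>
    obtain ⟨c, h1, h2⟩ := isDiagram_cons_iff.1 h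
    rw [isDiagram_birth_iff] at h1
    have := ih h2
    simp only [List.length_cons]; omega

/-- The span of the operators of words in which all arcs `⊃` precede all arcs `⊂`. -/
def normalSpan (A : K) (a b : ℕ) : Submodule K (Op A) :=
  Submodule.span K {x | ∃ L M : List ℕ, x = wd A a b (L.map death ++ M.map birth)}

theorem wd_mem_normalSpan (a b : ℕ) (L M : List ℕ) :
    wd A a b (L.map death ++ M.map birth) ∈ normalSpan A a b :=
  Submodule.subset_span ⟨L, M, rfl⟩

theorem mul_birth_mem_normalSpan {a b c l : ℕ} {x : Op A} (hx : x ∈ normalSpan A a b) :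
    x * wd A b c [birth l] ∈ normalSpan A a c := by
  induction hx using Submodule.span_induction with
  | zero => rw [zero_mul]; exact zero_mem _
  | add x y _ _ hx hy => rw [add_mul]; exact add_mem hx hy
  | smul k x _ hx => rw [smul_mul_assoc]; exact Submodule.smul_mem _ _ hx
  | mem x hx =>
    obtain ⟨L, M, rfl⟩ := hx
    by_cases h : IsDiagram a (L.map death ++ M.map birth) b
    · rw [← wd_append h]
      simpa using wd_mem_normalSpan a c L (M ++ [l])
    · rw [wd_of_not h, zero_mul]; exact zero_mem _

/-- The new arc `⊃` is pushed to the left through the arcs `⊂`. When it meets one, it closes a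
circle or straightens a zigzag and disappears; otherwise it passes with its position shifted. -/
theorem word_mul_death_mem_normalSpan {a b c k : ℕ} (L M : List ℕ) :
    wd A a b (L.map death ++ M.map birth) * wd A b c [death k] ∈ normalSpan A a c := by
  induction M using List.reverseRecOn generalizing b c k with
  | nil =>
    by_cases h : IsDiagram a (L.map death ++ ([] : List ℕ).map birth) b
    · rw [← wd_append h]
      simpa using wd_mem_normalSpan a c (L ++ [k]) []
    · rw [wd_of_not h, zero_mul]; exact zero_mem _
  | append_singleton M l ih =>
    by_cases hk : IsDiagram b [death k] c
    swap
    · rw [wd_of_not hk, mul_zero]; exact zero_mem _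
    by_cases h : IsDiagram a (L.map death ++ (M ++ [l]).map birth) b
    swap
    · rw [wd_of_not h, zero_mul]; exact zero_mem _
    have e : L.map death ++ (M ++ [l]).map birth = (L.map death ++ M.map birth) ++ [birth l] := by simp
    rw [e] at h ⊢
    obtain ⟨d, h1, h2⟩ := isDiagram_append_iff.1 h
    rw [← wd_mul h1 h2, mul_assoc, wd_mul h2 hk]
    rw [isDiagram_death_iff] at hk
    rw [isDiagram_birth_iff] at h2
    obtain rfl : d = c := by omega
    rcases lt_trichotomy k l with hlt | rfl | hlt
    · rcases eq_or_lt_of_le (Nat.succ_le_of_lt hlt) with rfl | hlt'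
      · have := Iso.zigzag' (A := A) d k (by omega)
        rw [show [birth (k + 1)] ++ [death k] = [birth (k + 1), death k] from rfl, this.eq,
          wd_mul_wd_nil]
        exact wd_mem_normalSpan _ _ _ _
      · have hd : IsDiagram d [death k] (d - 2) := isDiagram_death (by omega) (by omega)
        have := (Iso.far (A := A) (isDiagram_death (a := k + 2) (b := k) (l := k) le_rfl rfl)
          (isDiagram_birth (a := d - 2 - k) (l := l - 2 - k) (by omega) rfl)).cast
          (a' := d) (b' := d) (X' := [death k] ++ [birth (l - 2)]) (Y' := [birth l] ++ [death k])
          (by omega) (by omega) (by simp [Slice.shift]; omega) (by simp [Slice.shift]; omega)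
        rw [← this.eq, wd_append hd, ← mul_assoc]
        exact mul_birth_mem_normalSpan ih
    · rw [show [birth k] ++ [death k] = [birth k, death k] from rfl, wd_circle (by omega),
        mul_smul_comm, wd_mul_wd_nil]
      exact Submodule.smul_mem _ _ (wd_mem_normalSpan _ _ _ _)
    · rcases eq_or_lt_of_le (Nat.succ_le_of_lt hlt) with rfl | hlt'
      · have := Iso.zigzag (A := A) d l (by omega)
        rw [show [birth l] ++ [death (l + 1)] = [birth l, death (l + 1)] from rfl, this.eq,
          wd_mul_wd_nil]
        exact wd_mem_normalSpan _ _ _ _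
      · have hd : IsDiagram d [death (k - 2)] (d - 2) := isDiagram_death (by omega) (by omega)
        have := (Iso.far (A := A) (isDiagram_birth (a := l) (l := l) le_rfl rfl)
          (isDiagram_death (a := d - l) (b := d - l - 2) (l := k - 2 - l) (by omega) (by omega))).cast
          (a' := d) (b' := d) (X' := [birth l] ++ [death k]) (Y' := [death (k - 2)] ++ [birth l])
          (by omega) (by omega) (by simp [Slice.shift]; omega) (by simp [Slice.shift]; omega)
        rw [this.eq, wd_append hd, ← mul_assoc]
        exact mul_birth_mem_normalSpan ih

theorem mul_death_mem_normalSpan {a b c k : ℕ} {x : Op A} (hx : x ∈ normalSpan A a b) :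
    x * wd A b c [death k] ∈ normalSpan A a c := by
  induction hx using Submodule.span_induction with
  | zero => rw [zero_mul]; exact zero_mem _
  | add x y _ _ hx hy => rw [add_mul]; exact add_mem hx hy
  | smul k x _ hx => rw [smul_mul_assoc]; exact Submodule.smul_mem _ _ hx
  | mem x hx =>
    obtain ⟨L, M, rfl⟩ := hx
    exact word_mul_death_mem_normalSpan L M

/-- The word is built up slice by slice from the left; a crossing is first resolved into its two
smoothings. -/
theorem wd_mem_normalSpan' (a b : ℕ) (w : List Slice) : wd A a b w ∈ normalSpan A a b := by
  by_cases h : IsDiagram a w b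
  swap
  · rw [wd_of_not h]; exact zero_mem _
  induction w using List.reverseRecOn generalizing b with
  | nil => exact wd_mem_normalSpan a b [] []
  | append_singleton w x ih =>
    obtain ⟨d, h1, h2⟩ := isDiagram_append_iff.1 h
    rw [← wd_mul h1 h2]
    obtain ⟨p, l⟩ := x
    cases p with
    | birth => exact mul_birth_mem_normalSpan (ih d h1)
    | death => exact mul_death_mem_normalSpan (ih d h1)
    | cross s =>
      obtain ⟨h3, rfl⟩ := isDiagram_cross_iff.1 h2
      have key : wd A a b w * wd A b b [death l, birth l] ∈ normalSpan A a b := by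
        rw [show [death l, birth l] = [death l] ++ [birth l] from rfl,
          wd_append (b := b - 2) (isDiagram_death (by omega) (by omega)), ← mul_assoc]
        exact mul_birth_mem_normalSpan (mul_death_mem_normalSpan (ih b h1))
      cases s
      · rw [wd_crossFalse h3, mul_add, mul_smul_comm, mul_smul_comm, wd_mul_wd_nil]
        exact add_mem (Submodule.smul_mem _ _ (ih b h1)) (Submodule.smul_mem _ _ key)
      · rw [wd_crossTrue h3, mul_add, mul_smul_comm, mul_smul_comm, wd_mul_wd_nil]
        exact add_mem (Submodule.smul_mem _ _ (ih b h1)) (Submodule.smul_mem _ _ key)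

/-- Every skein element is a combination of diagrams in which all arcs `⊃` precede all arcs `⊂`. -/
theorem Skein.mem_span_normal {a b : ℕ} (x : Skein A a b) :
    x ∈ Submodule.span K {x : Skein A a b | ∃ (D : Diagram a b) (L M : List ℕ),
      D.word = L.map death ++ M.map birth ∧ x = Skein.of A D} := by
  induction x using Skein.induction_on with
  | zero => exact zero_mem _
  | add x y hx hy => exact add_mem hx hy
  | smul k x hx => exact Submodule.smul_mem _ _ hx
  | of D =>
    refine (Function.Injective.mem_set_image (emb_injective (A := A))).1 ?_
    rw [← wd_word, ← Submodule.map_coe]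
    refine Submodule.span_le.2 ?_ (wd_mem_normalSpan' (A := A) a b D.word)
    rintro _ ⟨L, M, rfl⟩
    by_cases h : IsDiagram a (L.map death ++ M.map birth) b
    · rw [wd_eq h]
      exact Submodule.mem_map_of_mem (Submodule.subset_span ⟨_, L, M, rfl, rfl⟩)
    · rw [wd_of_not h]; exact zero_mem _

/-! ## Jones-Wenzl projectors -/

/-- The span of the diagrams which begin with an arc `⊃` and end with an arc `⊂`. -/
def hookSpan (A : K) (m : ℕ) : Submodule K (Skein A m m) :=
  Submodule.span K {x | ∃ (D : Diagram m m) (i j : ℕ) (L M : List ℕ),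
    D.word = (death i :: L.map death) ++ (M.map birth ++ [birth j]) ∧ x = Skein.of A D}

/-- With equally many endpoints on both sides, a normal form has as many arcs `⊃` as arcs `⊂`:
either none, and it is the identity, or a hook at each end. -/
theorem Skein.exists_sub_mem_hookSpan {m : ℕ} (x : Skein A m m) :
    ∃ c : K, x - c • Skein.one A m ∈ hookSpan A m := by
  have hx := x.mem_span_normal
  induction hx using Submodule.span_induction with
  | zero => exact ⟨0, by simp⟩
  | add x y _ _ hx hy =>
    obtain ⟨c, hc⟩ := hx
    obtain ⟨d, hd⟩ := hy
    exact ⟨c + d, by rw [add_smul, add_sub_add_comm]; exact add_mem hc hd⟩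
  | smul k x _ hx =>
    obtain ⟨c, hc⟩ := hx
    exact ⟨k * c, by rw [mul_smul, ← smul_sub]; exact Submodule.smul_mem _ _ hc⟩
  | mem x hx =>
    obtain ⟨D, L, M, h, rfl⟩ := hx
    obtain ⟨d, h1, h2⟩ := isDiagram_append_iff.1 (h ▸ D.isDiagram)
    have e1 := h1.length_deaths
    have e2 := h2.length_births
    cases L with
    | nil =>
      simp only [List.length_nil] at e1
      have : M = [] := List.length_eq_zero_iff.1 (by omega)
      subst this
      refine ⟨1, ?_⟩
      rw [one_smul, Skein.one, Skein.of_congr (D := D) (E := ⟨[], rfl⟩) h, sub_self]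
      exact zero_mem _
    | cons i L =>
      rcases List.eq_nil_or_concat M with rfl | ⟨M, j, rfl⟩
      · simp only [List.length_nil, List.length_cons] at e1 e2; omega
      · exact ⟨0, by
          rw [zero_smul, sub_zero]
          exact Submodule.subset_span ⟨D, i, j, L, M, by simp [h], rfl⟩⟩

namespace IsJonesWenzl

variable {n : ℕ} {f : Skein A n n}

theorem emb_mul_death (hf : IsJonesWenzl n f) (p i : ℕ) : emb f * wd A n p [death i] = 0 := by
  by_cases h : IsDiagram n [death i] p
  · rw [wd_eq h, ← emb_comp, hf.comp_death p i _ rfl, map_zero]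
  · rw [wd_of_not h, mul_zero]

/-- Write `f` as `c` times the identity plus hooks and multiply by `f` on the left: the hooks die,
so `f = c f` and `c = 1`. The absorption properties of the projector below all rest on this. -/
theorem sub_one_mem (hf : IsJonesWenzl n f) : f - Skein.one A n ∈ hookSpan A n := by
  obtain ⟨c, hc⟩ := f.exists_sub_mem_hookSpan
  have key : ∀ x ∈ hookSpan A n, emb f * emb x = 0 := by
    intro x hx
    induction hx using Submodule.span_induction with
    | zero => simp
    | add x y _ _ hx hy => rw [map_add, mul_add, hx, hy, add_zero]
    | smul k x _ hx => rw [map_smul, mul_smul_comm, hx, smul_zero]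
    | mem x hx =>
      obtain ⟨D, i, j, L, M, h, rfl⟩ := hx
      obtain ⟨d, h1, h2⟩ := isDiagram_cons_iff.1 ((h.trans (List.cons_append ..)) ▸ D.isDiagram)
      rw [← wd_word, h, List.cons_append, ← List.singleton_append, wd_append h1, ← mul_assoc,
        hf.emb_mul_death, zero_mul]
  have h1 : f - c • f = 0 := by
    apply emb_injective
    have := key _ hc
    rwa [map_sub, mul_sub, ← emb_comp, hf.idempotent, map_smul, mul_smul_comm, ← emb_comp,
      Skein.comp_one, ← map_smul, ← map_sub, ← map_zero emb] at this
  have h2 : c = 1 := by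
    by_contra hne
    have h3 : (1 - c) • f = 0 := by rw [sub_smul, one_smul, h1]
    rcases smul_eq_zero.1 h3 with h4 | h4
    · exact hne (sub_eq_zero.1 h4).symm
    · exact hf.ne_zero h4
  rwa [h2, one_smul] at hc

/-- The number `M` is left arbitrary to avoid conversions at the places of use; if it does not fit,
the operator of the word is zero. -/
theorem pl_mul_death (hf : IsJonesWenzl n f) {l c N M i : ℕ} (hN : N = l + (n + c)) (h1 : l ≤ i)
    (h2 : i + 2 ≤ l + n) : pl l c f * wd A N M [death i] = 0 := by
  by_cases h : IsDiagram N [death i] M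
  swap
  · rw [wd_of_not h, mul_zero]
  obtain ⟨i, rfl⟩ := Nat.exists_eq_add_of_le h1
  obtain ⟨q, rfl⟩ : ∃ q, n = q + 2 := ⟨n - 2, by omega⟩
  have h' := isDiagram_death_iff.1 h
  obtain rfl : M = l + (q + c) := by omega
  subst hN
  have hd : IsDiagram (q + 2) [death i] q := isDiagram_death (by omega) rfl
  have := pl_of (A := A) l c (⟨_, hd⟩ : Diagram (q + 2) q)
  rw [show [death (l + i)] = [death i].map (Slice.shift l) from rfl, ← this, ← pl_comp,
    hf.comp_death _ _ _ rfl, map_zero]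

theorem birth_mul_pl (hf : IsJonesWenzl n f) {l c N M i : ℕ} (hN : N = l + (n + c)) (h1 : l ≤ i)
    (h2 : i + 2 ≤ l + n) : wd A M N [birth i] * pl l c f = 0 := by
  by_cases h : IsDiagram M [birth i] N
  swap
  · rw [wd_of_not h, zero_mul]
  obtain ⟨i, rfl⟩ := Nat.exists_eq_add_of_le h1
  obtain ⟨q, rfl⟩ : ∃ q, n = q + 2 := ⟨n - 2, by omega⟩
  have h' := isDiagram_birth_iff.1 h
  obtain rfl : M = l + (q + c) := by omega
  subst hN
  have hd : IsDiagram q [birth i] (q + 2) := isDiagram_birth (by omega) rfl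
  have := pl_of (A := A) l c (⟨_, hd⟩ : Diagram q (q + 2))
  rw [show [birth (l + i)] = [birth i].map (Slice.shift l) from rfl, ← this, ← pl_comp,
    hf.birth_comp _ _ _ rfl, map_zero]

theorem pl_idem (hf : IsJonesWenzl n f) (l c : ℕ) : pl l c f * pl l c f = pl l c f := by
  rw [← pl_comp, hf.idempotent]

/-- An element which kills all hooks in a bundle absorbs the projector on this bundle. -/
theorem absorb_right (hf : IsJonesWenzl n f) {l c N : ℕ} (hN : N = l + (n + c)) {Y : Op A}
    (hY : Y * wd A N N [] = Y)
    (h : ∀ i M, l ≤ i → i + 2 ≤ l + n → Y * wd A N M [death i] = 0) : Y * pl l c f = Y := by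
  subst hN
  have key : ∀ x ∈ hookSpan A n, Y * pl l c x = 0 := by
    intro x hx
    induction hx using Submodule.span_induction with
    | zero => simp
    | add x y _ _ hx hy => rw [map_add, mul_add, hx, hy, add_zero]
    | smul k x _ hx => rw [map_smul, mul_smul_comm, hx, smul_zero]
    | mem x hx =>
      obtain ⟨D, i, j, L, M, hD, rfl⟩ := hx
      rw [List.cons_append] at hD
      obtain ⟨d, h1, h2⟩ := isDiagram_cons_iff.1 (hD ▸ D.isDiagram)
      have h1' := isDiagram_death_iff.1 h1
      have h3 : IsDiagram (l + (n + c)) [death (l + i)] (l + (d + c)) :=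
        (h1.addBelow c).addAbove l
      rw [pl_of, hD, List.map_cons, ← List.singleton_append]
      refine (congrArg (Y * ·) (wd_append h3 _)).trans ?_
      rw [← mul_assoc, h _ _ (by omega) (by omega), zero_mul]
  have := key _ hf.sub_one_mem
  rwa [map_sub, mul_sub, pl_one, hY, sub_eq_zero] at this

theorem absorb_left (hf : IsJonesWenzl n f) {l c N : ℕ} (hN : N = l + (n + c)) {Y : Op A}
    (hY : wd A N N [] * Y = Y)
    (h : ∀ i M, l ≤ i → i + 2 ≤ l + n → wd A M N [birth i] * Y = 0) : pl l c f * Y = Y := by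
  subst hN
  have key : ∀ x ∈ hookSpan A n, pl l c x * Y = 0 := by
    intro x hx
    induction hx using Submodule.span_induction with
    | zero => simp
    | add x y _ _ hx hy => rw [map_add, add_mul, hx, hy, add_zero]
    | smul k x _ hx => rw [map_smul, smul_mul_assoc, hx, smul_zero]
    | mem x hx =>
      obtain ⟨D, i, j, L, M, hD, rfl⟩ := hx
      rw [← List.append_assoc] at hD
      obtain ⟨d, h1, h2⟩ := isDiagram_append_iff.1 (hD ▸ D.isDiagram)
      have h2' := isDiagram_birth_iff.1 h2
      have h3 := (h1.addBelow c).addAbove l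
      rw [pl_of, hD, List.map_append]
      refine (congrArg (· * Y) (wd_append h3 _)).trans ?_
      rw [mul_assoc, show [birth j].map (Slice.shift l) = [birth (l + j)] from rfl,
        h _ _ (by omega) (by omega), mul_zero]
  have := key _ hf.sub_one_mem
  rwa [map_sub, sub_mul, pl_one, hY, sub_eq_zero] at this

end IsJonesWenzl

/-! ## Pieces at different heights commute -/

theorem pl_mul_wd_below {p q c c' : ℕ} (l : ℕ) (x : Skein A p q) {v : List Slice}
    (hv : IsDiagram c v c') :
    pl l c x * wd A (l + (q + c)) (l + (q + c')) (v.map (Slice.shift (l + q))) =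
      wd A (l + (p + c)) (l + (p + c')) (v.map (Slice.shift (l + p))) * pl l c' x := by
  induction x using Skein.induction_on with
  | zero => simp
  | add x y hx hy => rw [map_add, map_add, add_mul, mul_add, hx, hy]
  | smul k x hx => rw [map_smul, map_smul, smul_mul_assoc, mul_smul_comm, hx]
  | of D =>
    rw [pl_of, pl_of, wd_mul ((D.isDiagram.addBelow c).addAbove l) (hv.place _ 0 (by ring) (by ring)),
      wd_mul (hv.place _ 0 (by ring) (by ring)) ((D.isDiagram.addBelow c').addAbove l)]
    have := (Iso.far (A := A) (D.isDiagram.addAbove l) hv).eq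
    rwa [Nat.add_assoc, Nat.add_assoc] at this

theorem wd_mul_pl_above {p q l l' : ℕ} (c : ℕ) (x : Skein A p q) {v : List Slice}
    (hv : IsDiagram l v l') :
    wd A (l + (p + c)) (l' + (p + c)) v * pl l' c x =
      pl l c x * wd A (l + (q + c)) (l' + (q + c)) v := by
  induction x using Skein.induction_on with
  | zero => simp
  | add x y hx hy => rw [map_add, map_add, add_mul, mul_add, hx, hy]
  | smul k x hx => rw [map_smul, map_smul, smul_mul_assoc, mul_smul_comm, hx]
  | of D =>
    rw [pl_of, pl_of, wd_mul (hv.addBelow _) ((D.isDiagram.addBelow c).addAbove _),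
      wd_mul ((D.isDiagram.addBelow c).addAbove _) (hv.addBelow _)]
    exact (Iso.far (A := A) hv (D.isDiagram.addBelow c)).eq

/-! ## A representation of the skein modules

Strands carry one of two states; there are infinitely many strands, numbered from top to bottom. -/

/-- Linear operators on the functions of states. -/
abbrev StateOp (K : Type*) [Field K] : Type _ := Module.End K ((ℕ → Bool) → K)

/-- Add a strand with state `b` on top. -/
def consState (b : Bool) (s : ℕ → Bool) : ℕ → Bool
  | 0 => b
  | k + 1 => s k

/-- Remove the top strand. -/
def tailState (s : ℕ → Bool) : ℕ → Bool := fun k => s (k + 1)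

@[simp] theorem tailState_consState (b : Bool) (s : ℕ → Bool) : tailState (consState b s) = s := rfl

@[simp] theorem consState_zero (b : Bool) (s : ℕ → Bool) : consState b s 0 = b := rfl

@[simp] theorem consState_succ (b : Bool) (s : ℕ → Bool) (k : ℕ) : consState b s (k + 1) = s k := rfl

@[simp] theorem consState_tailState (s : ℕ → Bool) : consState (s 0) (tailState s) = s := by
  funext k
  cases k <;> rfl

/-- Restrict a function to the states whose top strand has state `b`. -/
def restrictTop (b : Bool) : ((ℕ → Bool) → K) →ₗ[K] ((ℕ → Bool) → K) :=
  LinearMap.funLeft K K (consState b)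

@[simp] theorem restrictTop_apply (b : Bool) (g : (ℕ → Bool) → K) (s : ℕ → Bool) :
    restrictTop b g s = g (consState b s) := rfl

/-- Let an operator act below the top strand. -/
def liftOp : StateOp K →ₐ[K] StateOp K where
  toFun T :=
    { toFun := fun g s => T (restrictTop (s 0) g) (tailState s)
      map_add' := fun g h => by funext s; simp
      map_smul' := fun k g => by funext s; simp }
  map_one' := by
    ext1 g; funext s; simp
  map_mul' T S := by
    ext1 g; funext s
    simp only [LinearMap.coe_mk, AddHom.coe_mk, Module.End.mul_apply]
    congr 2
  map_zero' := by ext1 g; funext s; simp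
  map_add' T S := by ext1 g; funext s; simp
  commutes' k := by
    ext1 g; funext s
    simp [Module.algebraMap_end_apply]

theorem liftOp_apply (T : StateOp K) (g : (ℕ → Bool) → K) (s : ℕ → Bool) :
    liftOp T g s = T (restrictTop (s 0) g) (tailState s) := rfl

@[simp] theorem restrictTop_liftOp (T : StateOp K) (g : (ℕ → Bool) → K) (b : Bool) :
    restrictTop b (liftOp T g) = T (restrictTop b g) := rfl

/-- The pairing of the states of two neighbouring strands at an arc `⊃`. -/
def capWeight (A : K) : Bool → Bool → K
  | true, false => -A⁻¹ ^ 2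
  | false, true => 1
  | _, _ => 0

/-- The operator of an arc `⊃` at the top. -/
def deathOp (A : K) : StateOp K where
  toFun g s := capWeight A (s 0) (s 1) * g (tailState (tailState s))
  map_add' g h := by funext s; simp [mul_add]
  map_smul' k g := by funext s; simp [mul_left_comm]

/-- The operator of an arc `⊂` at the top. -/
def birthOp (A : K) : StateOp K where
  toFun g s := g (consState true (consState false s)) - A ^ 2 * g (consState false (consState true s))
  map_add' g h := by funext s; simp; ring
  map_smul' k g := by funext s; simp; ring

theorem deathOp_apply (g : (ℕ → Bool) → K) (s : ℕ → Bool) :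
    deathOp A g s = capWeight A (s 0) (s 1) * g (tailState (tailState s)) := rfl

theorem birthOp_apply (g : (ℕ → Bool) → K) (s : ℕ → Bool) :
    birthOp A g s = g (consState true (consState false s)) -
      A ^ 2 * g (consState false (consState true s)) := rfl

/-- The coefficient of the trivial smoothing of a crossing. -/
def smoothWeight (A : K) : Bool → K
  | true => A
  | false => A⁻¹

theorem smoothWeight_mul_not (hA : A ≠ 0) (s : Bool) :
    smoothWeight A s * smoothWeight A (!s) = 1 := by
  cases s <;> simp [smoothWeight, hA]

theorem smoothWeight_sq_add (s : Bool) :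
    smoothWeight A s ^ 2 + smoothWeight A (!s) ^ 2 = A ^ 2 + A⁻¹ ^ 2 := by
  cases s <;> simp [smoothWeight, add_comm]

/-- The operator of a piece at the top. -/
def pieceOp (A : K) : Piece → StateOp K
  | .birth => birthOp A
  | .death => deathOp A
  | .cross s => smoothWeight A s • 1 + smoothWeight A (!s) • (deathOp A * birthOp A)

/-- Let an operator act below `l` strands. -/
def liftOps : ℕ → StateOp K →ₐ[K] StateOp K
  | 0 => AlgHom.id K _
  | l + 1 => liftOp.comp (liftOps l)

theorem liftOps_zero (T : StateOp K) : liftOps 0 T = T := rfl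

theorem liftOps_succ (l : ℕ) (T : StateOp K) : liftOps (l + 1) T = liftOp (liftOps l T) := rfl

theorem liftOps_add (l m : ℕ) (T : StateOp K) : liftOps (l + m) T = liftOps l (liftOps m T) := by
  induction l with
  | zero => rw [Nat.zero_add]; rfl
  | succ l ih => rw [Nat.add_right_comm, liftOps_succ, ih]; rfl

/-- The operator of a slice. -/
def sliceOp (A : K) (x : Slice) : StateOp K := liftOps x.pos (pieceOp A x.piece)

/-- The operator of a word. -/
def wordOp (A : K) (w : List Slice) : StateOp K := (w.map (sliceOp A)).prod

theorem wordOp_cons (x : Slice) (w : List Slice) : wordOp A (x :: w) = sliceOp A x * wordOp A w := by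
  simp [wordOp]

theorem wordOp_append (u v : List Slice) : wordOp A (u ++ v) = wordOp A u * wordOp A v := by
  simp [wordOp]

theorem wordOp_shift (c : ℕ) (w : List Slice) :
    wordOp A (w.map (Slice.shift c)) = liftOps c (wordOp A w) := by
  induction w with
  | nil => exact (map_one _).symm
  | cons x w ih =>
    rw [List.map_cons, wordOp_cons, wordOp_cons, ih, map_mul, sliceOp, sliceOp, ← liftOps_add]
    rfl

/-- A word acts from right to left, taking functions of the states on its right to functions of the
states on its left. The weights `1`, `-A²` at `⊂` and `-A⁻²`, `1` at `⊃` are chosen to be mutually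
inverse on the two mixed pairs of states, so both zigzags act as the identity, and so that a circle
gives `-A² - A⁻²`. -/
theorem birthOp_mul_liftOp_deathOp (hA : A ≠ 0) : birthOp A * liftOp (deathOp A) = 1 := by
  ext1 g; funext s
  have : s = consState (s 0) (tailState s) := by simp
  simp only [Module.End.mul_apply, birthOp_apply, liftOp_apply, deathOp_apply, restrictTop_apply,
    Module.End.one_apply, consState_zero, tailState_consState, consState_succ]
  rcases h : s 0 with _ | _ <;> rw [h] at this <;> simp [capWeight, hA, ← this]

theorem liftOp_birthOp_mul_deathOp (hA : A ≠ 0) : liftOp (birthOp A) * deathOp A = 1 := by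
  ext1 g; funext s
  have : s = consState (s 0) (tailState s) := by simp
  simp only [Module.End.mul_apply, birthOp_apply, liftOp_apply, deathOp_apply, restrictTop_apply,
    Module.End.one_apply, consState_zero, tailState_consState]
  rw [show (1 : ℕ) = 0 + 1 from rfl, consState_succ, consState_succ, consState_zero, consState_zero]
  have e : ∀ b, tailState (consState b (tailState s)) = tailState s := fun b => rfl
  rcases h : s 0 with _ | _ <;> rw [h] at this <;> simp [capWeight, hA, ← this]

theorem birthOp_mul_deathOp :
    birthOp A * deathOp A = (-(A ^ 2 + A⁻¹ ^ 2)) • (1 : StateOp K) := by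
  ext1 g; funext s
  simp only [Module.End.mul_apply, birthOp_apply, deathOp_apply, consState_zero, tailState_consState]
  rw [show (1 : ℕ) = 0 + 1 from rfl, consState_succ, consState_succ, consState_zero, consState_zero]
  simp [capWeight]; ring

theorem birthOp_mul_liftOps (m : ℕ) (T : StateOp K) :
    birthOp A * liftOps (2 + m) T = liftOps m T * birthOp A := by
  rw [liftOps_add]
  ext1 g; funext s
  simp only [Module.End.mul_apply, liftOps_succ, liftOps_zero]
  generalize liftOps m T = S
  have : birthOp A g = restrictTop false (restrictTop true g) -
      A ^ 2 • restrictTop true (restrictTop false g) := by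
    funext s; simp [birthOp_apply]
  rw [this, birthOp_apply]
  simp [liftOp_apply]

theorem deathOp_mul_liftOps (m : ℕ) (T : StateOp K) :
    deathOp A * liftOps m T = liftOps (2 + m) T * deathOp A := by
  rw [liftOps_add]
  ext1 g; funext s
  simp only [Module.End.mul_apply, liftOps_succ, liftOps_zero]
  generalize liftOps m T = S
  have : restrictTop (tailState s 0) (restrictTop (s 0) (deathOp A g)) =
      capWeight A (s 0) (s 1) • g := by
    funext t; simp [deathOp_apply, tailState]
  simp only [liftOp_apply]
  rw [this, map_smul, deathOp_apply]
  rfl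

theorem pieceOp_mul_liftOps (P : Piece) (m : ℕ) (T : StateOp K) :
    pieceOp A P * liftOps (P.out + m) T = liftOps (P.inp + m) T * pieceOp A P := by
  cases P with
  | birth => simpa [pieceOp, Piece.inp, Piece.out] using birthOp_mul_liftOps (A := A) m T
  | death => simpa [pieceOp, Piece.inp, Piece.out] using deathOp_mul_liftOps (A := A) m T
  | cross s =>
    simp only [pieceOp, Piece.inp, Piece.out, add_mul, mul_add, smul_mul_assoc, mul_smul_comm,
      one_mul, mul_one]
    rw [mul_assoc, birthOp_mul_liftOps, ← mul_assoc, ← mul_assoc, deathOp_mul_liftOps]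

/-- The Temperley-Lieb form of the Reidemeister move II. -/
theorem smoothing_reidemeisterII {R : Type*} [Ring R] [Algebra K R] {a a' : K} {e : R}
    (h : a * a' = 1) (he : e * e = (-(a ^ 2 + a' ^ 2)) • e) :
    (a • 1 + a' • e) * (a' • 1 + a • e) = 1 := by
  simp only [add_mul, mul_add, smul_mul_assoc, mul_smul_comm, one_mul, mul_one, he]
  match_scalars
  · linear_combination h
  · linear_combination (-(a ^ 2 + a' ^ 2)) * h

/-- The Temperley-Lieb form of the Reidemeister move III. -/
theorem smoothing_reidemeisterIII {R : Type*} [Ring R] [Algebra K R] {a a' b b' c c' δ : K}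
    {e₁ e₂ : R} (h₁ : e₁ * e₁ = δ • e₁) (h₂ : e₂ * e₂ = δ • e₂) (h₁₂ : e₁ * e₂ * e₁ = e₁)
    (h₂₁ : e₂ * e₁ * e₂ = e₂)
    (h : a * b * c' + a' * b * c + δ * a' * b * c' + a' * b' * c' = a * b' * c) :
    (a • 1 + a' • e₁) * (b • 1 + b' • e₂) * (c • 1 + c' • e₁) =
      (c • 1 + c' • e₂) * (b • 1 + b' • e₁) * (a • 1 + a' • e₂) := by
  simp only [add_mul, mul_add, smul_mul_assoc, mul_smul_comm, one_mul, mul_one, h₁, h₂, h₁₂, h₂₁]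
  -- Only the coefficients of `e₁` and `e₂` are not identical polynomials; both comparisons are `h`,
  -- up to sign.
  match_scalars <;> first | ring1 | linear_combination h | linear_combination -h

theorem arcOp_sq : deathOp A * birthOp A * (deathOp A * birthOp A) =
    (-(A ^ 2 + A⁻¹ ^ 2)) • (deathOp A * birthOp A) := by
  rw [mul_assoc, ← mul_assoc (birthOp A), birthOp_mul_deathOp, smul_mul_assoc, one_mul,
    mul_smul_comm]

theorem pieceOp_reidemeisterII (hA : A ≠ 0) (s : Bool) :
    pieceOp A (.cross s) * pieceOp A (.cross !s) = 1 := by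
  simp only [pieceOp, Bool.not_not]
  refine smoothing_reidemeisterII (smoothWeight_mul_not hA s) ?_
  rw [smoothWeight_sq_add, arcOp_sq]

theorem pieceOp_reidemeisterIII (hA : A ≠ 0) (s t u : Bool) (h : t = s ∨ t = u) :
    pieceOp A (.cross s) * liftOp (pieceOp A (.cross t)) * pieceOp A (.cross u) =
      liftOp (pieceOp A (.cross u)) * pieceOp A (.cross t) * liftOp (pieceOp A (.cross s)) := by
  simp only [pieceOp, map_add, map_smul, map_one, map_mul]
  refine smoothing_reidemeisterIII (arcOp_sq) ?_ ?_ ?_ ?_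
  · rw [← map_mul, ← map_mul, arcOp_sq, map_smul]
  · calc deathOp A * birthOp A * (liftOp (deathOp A) * liftOp (birthOp A)) * (deathOp A * birthOp A)
        = deathOp A * (birthOp A * liftOp (deathOp A)) * (liftOp (birthOp A) * deathOp A) *
            birthOp A := by simp only [mul_assoc]
      _ = _ := by rw [birthOp_mul_liftOp_deathOp hA, liftOp_birthOp_mul_deathOp hA]; simp
  · calc liftOp (deathOp A) * liftOp (birthOp A) * (deathOp A * birthOp A) *
          (liftOp (deathOp A) * liftOp (birthOp A))
        = liftOp (deathOp A) * (liftOp (birthOp A) * deathOp A) *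
            (birthOp A * liftOp (deathOp A)) * liftOp (birthOp A) := by simp only [mul_assoc]
      _ = _ := by rw [birthOp_mul_liftOp_deathOp hA, liftOp_birthOp_mul_deathOp hA]; simp
  · have hs := smoothWeight_mul_not hA s
    have hu := smoothWeight_mul_not hA u
    rw [← smoothWeight_sq_add s]
    -- The middle weight equals one of the outer ones. Since opposite weights have product `1`, what
    -- remains is a multiple of `a² + a'² + δ`, which is zero for the circle value `δ`.
    rcases h with rfl | rfl
    · linear_combination (-(smoothWeight A t ^ 2 + smoothWeight A (!t) ^ 2)) *
        smoothWeight A (!u) * hs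
    · have := (smoothWeight_sq_add (A := A) s).trans (smoothWeight_sq_add (A := A) t).symm
      rw [this]
      linear_combination (-(smoothWeight A t ^ 2 + smoothWeight A (!t) ^ 2)) *
        smoothWeight A (!s) * hu

theorem pieceOp_slideBirth (hA : A ≠ 0) (s : Bool) :
    birthOp A * liftOp (pieceOp A (.cross s)) =
      liftOp (birthOp A) * pieceOp A (.cross !s) := by
  simp only [pieceOp, map_add, map_smul, map_one, map_mul, mul_add, mul_smul_comm, mul_one,
    ← mul_assoc, birthOp_mul_liftOp_deathOp hA, liftOp_birthOp_mul_deathOp hA, one_mul,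
    Bool.not_not]
  rw [add_comm]

theorem pieceOp_slideDeath (hA : A ≠ 0) (s : Bool) :
    pieceOp A (.cross s) * liftOp (deathOp A) =
      liftOp (pieceOp A (.cross !s)) * deathOp A := by
  simp only [pieceOp, map_add, map_smul, map_one, map_mul, add_mul, smul_mul_assoc, one_mul,
    mul_assoc, birthOp_mul_liftOp_deathOp hA, liftOp_birthOp_mul_deathOp hA, mul_one,
    Bool.not_not]
  rw [add_comm]

theorem wordOp_eq_of_regularMove (hA : A ≠ 0) {X Y : List Slice} (h : RegularMove X Y) :
    wordOp A X = wordOp A Y := by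
  cases h with
  | zigzag l =>
    refine (wordOp_shift l [birth 0, death 1]).trans ?_
    simp only [wordOp, List.map_cons, List.map_nil, List.prod_cons, List.prod_nil, mul_one]
    refine (congrArg _ (birthOp_mul_liftOp_deathOp hA)).trans (map_one _)
  | zigzag' l =>
    refine (wordOp_shift l [birth 1, death 0]).trans ?_
    simp only [wordOp, List.map_cons, List.map_nil, List.prod_cons, List.prod_nil, mul_one]
    refine (congrArg _ (liftOp_birthOp_mul_deathOp hA)).trans (map_one _)
  | far p q l m =>
    have h1 : [⟨p, l⟩, ⟨q, l + p.out + m⟩] = [⟨p, 0⟩, ⟨q, p.out + m⟩].map (Slice.shift l) := by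
      simp [Slice.shift, Nat.add_assoc]
    have h2 : [⟨q, l + p.inp + m⟩, ⟨p, l⟩] = [⟨q, p.inp + m⟩, ⟨p, 0⟩].map (Slice.shift l) := by
      simp [Slice.shift, Nat.add_assoc]
    rw [h1, h2, wordOp_shift, wordOp_shift]
    congr 1
    simp only [wordOp, List.map_cons, List.map_nil, List.prod_cons, List.prod_nil, mul_one]
    exact pieceOp_mul_liftOps p m _
  | slideBirth s l =>
    refine (wordOp_shift l [birth 0, cross s 1]).trans
      (Eq.trans ?_ (wordOp_shift l [birth 1, cross (!s) 0]).symm)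
    simp only [wordOp, List.map_cons, List.map_nil, List.prod_cons, List.prod_nil, mul_one]
    exact congrArg _ (pieceOp_slideBirth hA s)
  | slideDeath s l =>
    refine (wordOp_shift l [cross s 0, death 1]).trans
      (Eq.trans ?_ (wordOp_shift l [cross (!s) 1, death 0]).symm)
    simp only [wordOp, List.map_cons, List.map_nil, List.prod_cons, List.prod_nil, mul_one]
    exact congrArg _ (pieceOp_slideDeath hA s)
  | reidemeisterII s l =>
    refine (wordOp_shift l [cross s 0, cross (!s) 0]).trans ?_
    simp only [wordOp, List.map_cons, List.map_nil, List.prod_cons, List.prod_nil, mul_one]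
    refine (congrArg _ (pieceOp_reidemeisterII hA s)).trans (map_one _)
  | reidemeisterIII s t u h l =>
    refine (wordOp_shift l [cross s 0, cross t 1, cross u 0]).trans
      (Eq.trans ?_ (wordOp_shift l [cross u 1, cross t 0, cross s 1]).symm)
    simp only [wordOp, List.map_cons, List.map_nil, List.prod_cons, List.prod_nil, mul_one,
      ← mul_assoc]
    exact congrArg _ (pieceOp_reidemeisterIII hA s t u h)

theorem wordOp_relator (hA : A ≠ 0) {a b : ℕ} {x : Diagram a b →₀ K} (hx : IsRelator A x) :
    Finsupp.linearCombination K (fun D : Diagram a b => wordOp A D.word) x = 0 := by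
  cases hx with
  | isotopy h =>
    obtain ⟨U, V, X, Y, h, hD, hD'⟩ := h
    simp [hD, hD', wordOp_append, wordOp_eq_of_regularMove hA h]
  | crossTrue U V l h h₀ h₁ =>
    have e : wordOp A [cross true l] = A • 1 + A⁻¹ • wordOp A [death l, birth l] := by
      simp [wordOp, sliceOp, pieceOp, smoothWeight]
    simp only [map_sub, Finsupp.linearCombination_single, h, h₀, h₁, wordOp_append, e]
    simp only [mul_add, add_mul, mul_smul_comm, smul_mul_assoc, mul_one]
    module
  | crossFalse U V l h h₀ h₁ =>
    have e : wordOp A [cross false l] = A⁻¹ • 1 + A • wordOp A [death l, birth l] := by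
      simp [wordOp, sliceOp, pieceOp, smoothWeight]
    simp only [map_sub, Finsupp.linearCombination_single, h, h₀, h₁, wordOp_append, e]
    simp only [mul_add, add_mul, mul_smul_comm, smul_mul_assoc, mul_one]
    module
  | circle U V l h h₀ =>
    have e : wordOp A [birth l, death l] = (-(A ^ 2 + A⁻¹ ^ 2)) • 1 := by
      rw [← map_one (liftOps (K := K) l), ← map_smul, ← birthOp_mul_deathOp, map_mul]
      simp [wordOp, sliceOp, pieceOp]
    simp only [map_add, Finsupp.linearCombination_single, h, h₀, wordOp_append, e]
    simp only [mul_smul_comm, smul_mul_assoc, mul_one]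
    module

/-- The representation of the skein modules by operators on functions of states. -/
def stateRep (hA : A ≠ 0) {a b : ℕ} : Skein A a b →ₗ[K] StateOp K :=
  (relations A a b).liftQ (Finsupp.linearCombination K fun D : Diagram a b => wordOp A D.word)
    (Submodule.span_le.2 fun _ hx => wordOp_relator hA hx)

theorem stateRep_of (hA : A ≠ 0) {a b : ℕ} (D : Diagram a b) :
    stateRep hA (Skein.of A D) = wordOp A D.word := by
  rw [Skein.of, stateRep, Submodule.mkQ_apply, Submodule.liftQ_apply]
  simp

theorem stateRep_comp (hA : A ≠ 0) {a b c : ℕ} (x : Skein A a b) (y : Skein A b c) :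
    stateRep hA (Skein.comp x y) = stateRep hA x * stateRep hA y := by
  induction x using Skein.induction_on with
  | zero => simp [Skein.zero_comp]
  | add x x' h h' => simp only [Skein.add_comp, map_add, add_mul, h, h']
  | smul k x h => simp only [Skein.smul_comp, map_smul, smul_mul_assoc, h]
  | of D =>
    induction y using Skein.induction_on with
    | zero => simp [Skein.comp_zero]
    | add x x' h h' => simp only [Skein.comp_add, map_add, mul_add, h, h']
    | smul k x h => simp only [Skein.comp_smul, map_smul, mul_smul_comm, h]
    | of E => simp only [Skein.of_comp, stateRep_of, ← wordOp_append]; rfl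

theorem stateRep_one (hA : A ≠ 0) (a : ℕ) : stateRep hA (Skein.one A a) = 1 := stateRep_of hA _

/-- A state already has infinitely many strands, so strands added below are invisible to the
operator. -/
theorem stateRep_addBelow (hA : A ≠ 0) {a b : ℕ} (c : ℕ) (x : Skein A a b) :
    stateRep hA (Skein.addBelow c x) = stateRep hA x := by
  induction x using Skein.induction_on with
  | zero => simp
  | add x x' h h' => simp only [map_add, h, h']
  | smul k x h => simp only [map_smul, h]
  | of D => rw [Skein.addBelow_of, stateRep_of, stateRep_of]; rfl

theorem stateRep_addAbove (hA : A ≠ 0) {a b : ℕ} (c : ℕ) (x : Skein A a b) :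
    stateRep hA (Skein.addAbove c x) = liftOps c (stateRep hA x) := by
  induction x using Skein.induction_on with
  | zero => simp
  | add x x' h h' => simp only [map_add, h, h']
  | smul k x h => simp only [map_smul, h]
  | of D => rw [Skein.addAbove_of, stateRep_of, stateRep_of]; exact wordOp_shift c D.word

theorem stateRep_tensor (hA : A ≠ 0) {a b c d : ℕ} (x : Skein A a b) (y : Skein A c d) :
    stateRep hA (Skein.tensor x y) = stateRep hA x * liftOps b (stateRep hA y) := by
  rw [Skein.tensor, stateRep_comp, stateRep_addBelow, stateRep_addAbove]

/-! ## Projectors in the representation -/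

/-- A functional which kills the hooks absorbs the projector. -/
theorem IsJonesWenzl.functional_stateRep (hA : A ≠ 0) {n : ℕ} {f : Skein A n n}
    (hf : IsJonesWenzl n f) (φ : ((ℕ → Bool) → K) →ₗ[K] K)
    (h : ∀ i, i + 2 ≤ n → ∀ g, φ (liftOps i (deathOp A) g) = 0) (g : (ℕ → Bool) → K) :
    φ (stateRep hA f g) = φ g := by
  have key : ∀ x ∈ hookSpan A n, φ (stateRep hA x g) = 0 := by
    intro x hx
    induction hx using Submodule.span_induction with
    | zero => simp
    | add x y _ _ hx hy => rw [map_add, LinearMap.add_apply, map_add, hx, hy, add_zero]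
    | smul k x _ hx => rw [map_smul, LinearMap.smul_apply, map_smul, hx, smul_zero]
    | mem x hx =>
      obtain ⟨D, i, j, L, M, hD, rfl⟩ := hx
      rw [List.cons_append] at hD
      obtain ⟨d, h1, h2⟩ := isDiagram_cons_iff.1 (hD ▸ D.isDiagram)
      have h1' := isDiagram_death_iff.1 h1
      rw [stateRep_of, hD, wordOp_cons, Module.End.mul_apply]
      exact h i (by omega) _
  have := key _ hf.sub_one_mem
  rwa [map_sub, stateRep_one, LinearMap.sub_apply, map_sub, sub_eq_zero] at this

/-- A function which is killed by the hooks is fixed by the projector. -/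
theorem IsJonesWenzl.stateRep_apply (hA : A ≠ 0) {n : ℕ} {f : Skein A n n}
    (hf : IsJonesWenzl n f) (g : (ℕ → Bool) → K)
    (h : ∀ i, i + 2 ≤ n → liftOps i (birthOp A) g = 0) : stateRep hA f g = g := by
  have key : ∀ x ∈ hookSpan A n, stateRep hA x g = 0 := by
    intro x hx
    induction hx using Submodule.span_induction with
    | zero => simp
    | add x y _ _ hx hy => rw [map_add, LinearMap.add_apply, hx, hy, add_zero]
    | smul k x _ hx => rw [map_smul, LinearMap.smul_apply, hx, smul_zero]
    | mem x hx =>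
      obtain ⟨D, i, j, L, M, hD, rfl⟩ := hx
      rw [← List.append_assoc] at hD
      obtain ⟨d, h1, h2⟩ := isDiagram_append_iff.1 (hD ▸ D.isDiagram)
      have h2' := isDiagram_birth_iff.1 h2
      rw [stateRep_of, hD, wordOp_append, Module.End.mul_apply]
      have e : wordOp A [birth j] = liftOps j (birthOp A) := by simp [wordOp, sliceOp, pieceOp]
      rw [e, h j (by omega), map_zero]
  have := key _ hf.sub_one_mem
  rwa [map_sub, stateRep_one, LinearMap.sub_apply, sub_eq_zero] at this

/-- An arc `⊃` pairs only opposite states. Constant states therefore see just the coefficient of the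
identity in a projector. -/
theorem liftOps_deathOp_apply (i : ℕ) (g : (ℕ → Bool) → K) (s : ℕ → Bool) (h0 : s i = true)
    (h1 : s (i + 1) = true) : liftOps i (deathOp A) g s = 0 := by
  induction i generalizing g s with
  | zero => rw [liftOps_zero, deathOp_apply, h0, h1]; simp [capWeight]
  | succ i ih => rw [liftOps_succ, liftOp_apply]; exact ih _ _ h0 h1

/-- The projector does not change the value at a state which is constant on its strands. -/
theorem IsJonesWenzl.stateRep_apply_apply (hA : A ≠ 0) {n : ℕ} {f : Skein A n n}
    (hf : IsJonesWenzl n f) (g : (ℕ → Bool) → K) (s : ℕ → Bool) (hs : ∀ k < n, s k = true) :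
    stateRep hA f g s = g s :=
  hf.functional_stateRep hA (LinearMap.proj s)
    (fun i hi g => liftOps_deathOp_apply i g s (hs i (by omega)) (hs (i + 1) (by omega))) g

/-! ## Existence of the Jones-Wenzl projectors -/

theorem quantumInt_succ (hA : A ≠ 0) (k : ℕ) :
    quantumInt A (k + 1) = A ^ 2 * quantumInt A k + A ^ (-(2 * (k : ℤ))) := by
  rw [quantumInt, Finset.sum_range_succ, quantumInt, Finset.mul_sum]
  congr 1
  · refine Finset.sum_congr rfl fun j _ => ?_
    rw [← zpow_natCast, ← zpow_add₀ hA]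
    congr 1
    push_cast; ring
  · congr 1
    push_cast; ring

/-- This is the expansion of `[2][k + 1]`, where `[2] = A² + A⁻²`. It identifies the partial traces
in Wenzl's recursion with quotients of quantum integers. -/
theorem quantumInt_add_two (hA : A ≠ 0) (k : ℕ) :
    quantumInt A (k + 2) + quantumInt A k = (A ^ 2 + A⁻¹ ^ 2) * quantumInt A (k + 1) := by
  have h1 := quantumInt_succ hA k
  have h2 := quantumInt_succ hA (k + 1)
  have h3 : A ^ (-(2 * (k : ℤ))) = A ^ 2 * A ^ (-(2 * ((k + 1 : ℕ) : ℤ))) := by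
    rw [← zpow_natCast, ← zpow_add₀ hA]
    congr 1
    push_cast; ring
  have h4 : A⁻¹ ^ 2 * A ^ 2 = 1 := by rw [← mul_pow, inv_mul_cancel₀ hA, one_pow]
  rw [h3] at h1
  linear_combination h2 - A⁻¹ ^ 2 * h1 - (quantumInt A k + A ^ (-(2 * ((k + 1 : ℕ) : ℤ)))) * h4

theorem quantumInt_one : quantumInt A 1 = 1 := by simp [quantumInt]

theorem quantumInt_zero : quantumInt A 0 = 0 := by simp [quantumInt]

/-- On fewer than two strands there are no hooks. That the identity is nonzero is read off from the
representation. -/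
theorem isJonesWenzl_one (hA : A ≠ 0) {m : ℕ} (hm : m < 2) : IsJonesWenzl m (Skein.one A m) where
  ne_zero h := by
    have := congrFun (LinearMap.congr_fun (congrArg (stateRep hA) h) fun _ => 1) fun _ => true
    rw [stateRep_one] at this
    simp at this
  idempotent := Skein.one_comp _
  birth_comp p i D hD := by
    have := isDiagram_birth_iff.1 (hD ▸ D.isDiagram)
    omega
  comp_death p i D hD := by
    have := isDiagram_death_iff.1 (hD ▸ D.isDiagram)
    omega

theorem isJonesWenzl_of_emb {m : ℕ} {f : Skein A m m} (h0 : f ≠ 0) (h1 : emb f * emb f = emb f)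
    (hb : ∀ p i, i ≤ p → m = p + 2 → wd A p m [birth i] * emb f = 0)
    (hd : ∀ p i, i ≤ p → m = p + 2 → emb f * wd A m p [death i] = 0) : IsJonesWenzl m f where
  ne_zero := h0
  idempotent := by apply emb_injective; rw [emb_comp, h1]
  birth_comp p i D hD := by
    apply emb_injective
    have := isDiagram_birth_iff.1 (hD ▸ D.isDiagram)
    rw [emb_comp, ← wd_word, hD, hb p i this.1 this.2, map_zero]
  comp_death p i D hD := by
    apply emb_injective
    have := isDiagram_death_iff.1 (hD ▸ D.isDiagram)
    rw [emb_comp, ← wd_word, hD, hd p i this.1 this.2, map_zero]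

/-- The step of Wenzl's recursion. -/
theorem IsJonesWenzl.step (hA : A ≠ 0) {m : ℕ} {f : Skein A (m + 1) (m + 1)} {f' : Skein A m m}
    (hf : IsJonesWenzl (m + 1) f) (hf' : IsJonesWenzl m f') {τ : K} (hτ : τ ≠ 0)
    (htr : wd A m (m + 2) [birth m] * pl 0 1 f * wd A (m + 2) m [death m] = τ • emb f') :
    ∃ g : Skein A (m + 2) (m + 2), IsJonesWenzl (m + 2) g ∧
      wd A (m + 1) (m + 3) [birth (m + 1)] * pl 0 1 g * wd A (m + 3) (m + 1) [death (m + 1)] =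
        (-(A ^ 2 + A⁻¹ ^ 2) - τ⁻¹) • emb f := by
  have hdia : IsDiagram (m + 2) [death m, birth m] (m + 2) :=
    (isDiagram_death (b := m) le_rfl rfl).append (isDiagram_birth (l := m) le_rfl rfl)
  let E : Skein A (m + 2) (m + 2) := Skein.of A ⟨_, hdia⟩
  let F : Skein A (m + 2) (m + 2) := Skein.addBelow 1 f
  -- Wenzl's formula. By `htr` the partial trace of `f` is `τ` times `f'`, and the coefficient `τ⁻¹`
  -- is the one for which the last hook cancels.
  let g : Skein A (m + 2) (m + 2) := F - τ⁻¹ • Skein.comp (Skein.comp F E) F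
  set b := wd A m (m + 2) [birth m] with hb
  set d := wd A (m + 2) m [death m] with hd
  set φ : Op A := pl 0 1 f with hφ
  have eF : emb F = φ := (pl_zero_left 1 f).symm
  have eE : emb E = d * b := by
    rw [hd, hb, wd_mul (isDiagram_death le_rfl rfl) (isDiagram_birth le_rfl rfl)]
    exact (wd_eq hdia).symm
  have eg : emb g = φ - τ⁻¹ • (φ * d * (b * φ)) := by
    simp only [g, map_sub, map_smul, emb_comp, eF, eE, mul_assoc]
  have hφ2 : φ * φ = φ := hf.pl_idem 0 1
  have h1 : wd A (m + 2) (m + 2) [] * φ = φ := by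
    have := wd_nil_mul_pl 0 1 f
    rwa [Nat.zero_add] at this
  have h1' : φ * wd A (m + 2) (m + 2) [] = φ := by
    have := pl_mul_wd_nil 0 1 f
    rwa [Nat.zero_add] at this
  -- the smaller projector is absorbed
  have hab : pl 0 2 f' * φ = φ := hf'.absorb_left (N := m + 2) (by ring) h1 fun i M hi hi' =>
    hf.birth_mul_pl (by ring) hi (by omega)
  have hab' : φ * pl 0 2 f' = φ := hf'.absorb_right (N := m + 2) (by ring) h1' fun i M hi hi' =>
    hf.pl_mul_death (by ring) hi (by omega)
  have hcb : emb f' * b = b * pl 0 2 f' := by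
    have := pl_mul_wd_below (A := A) 0 f' (isDiagram_birth (a := 0) (l := 0) le_rfl rfl)
    simpa [Slice.shift, pl_zero_zero] using this
  have hcd : d * emb f' = pl 0 2 f' * d := by
    have := pl_mul_wd_below (A := A) 0 f' (isDiagram_death (b := 0) (l := 0) le_rfl rfl)
    simpa [Slice.shift, pl_zero_zero] using this.symm
  have hbg : b * emb g = 0 := by
    have : b * (φ * d * (b * φ)) = τ • (b * φ) := by
      have e : b * (φ * d * (b * φ)) = b * φ * d * (b * φ) := by simp only [mul_assoc]
      rw [e, htr, smul_mul_assoc, ← mul_assoc, hcb, mul_assoc, hab]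
    rw [eg, mul_sub, mul_smul_comm, this, smul_smul, inv_mul_cancel₀ hτ, one_smul, sub_self]
  have hgd : emb g * d = 0 := by
    have : φ * d * (b * φ) * d = τ • (φ * d) := by
      rw [mul_assoc, htr, mul_smul_comm, mul_assoc, hcd, ← mul_assoc, hab']
    rw [eg, sub_mul, smul_mul_assoc, this, smul_smul, inv_mul_cancel₀ hτ, one_smul, sub_self]
  have hφg : φ * emb g = emb g := by
    rw [eg, mul_sub, mul_smul_comm, mul_assoc φ d, ← mul_assoc φ φ, hφ2]
  refine ⟨g, isJonesWenzl_of_emb ?_ ?_ ?_ ?_, ?_⟩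
  -- At the constant state the correction term vanishes, because its arc `⊃` meets equal states; so
  -- `g` takes the constant function `1` to a function with value `1` there.
  · intro h0
    have h2 := congrFun (LinearMap.congr_fun (congrArg (stateRep hA) h0) fun _ => 1) fun _ => true
    have hF : stateRep hA F = stateRep hA f := stateRep_addBelow hA 1 f
    simp only [g, map_sub, map_smul, E, stateRep_comp, hF, stateRep_of,
      LinearMap.sub_apply, LinearMap.smul_apply, Module.End.mul_apply, Pi.sub_apply, Pi.smul_apply,
      wordOp_cons, sliceOp, pieceOp] at h2
    rw [hf.stateRep_apply_apply hA _ _ fun _ _ => rfl, hf.stateRep_apply_apply hA _ _ fun _ _ => rfl,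
      liftOps_deathOp_apply _ _ _ rfl rfl] at h2
    simp at h2
  · nth_rewrite 1 [eg]
    rw [sub_mul, smul_mul_assoc, mul_assoc _ _ (emb g), mul_assoc b, hφg, hbg, mul_zero, smul_zero,
      sub_zero]
  · intro p i hi hp
    obtain rfl : p = m := by omega
    -- The last hook involves the new strand and is `hbg`; every other hook is killed by the factor
    -- `f` at the left of `g`.
    rcases eq_or_lt_of_le hi with rfl | hlt
    · exact hbg
    · rw [← hφg, ← mul_assoc, hf.birth_mul_pl (by ring) (Nat.zero_le _) (by omega), zero_mul]
  · intro p i hi hp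
    obtain rfl : p = m := by omega
    rcases eq_or_lt_of_le hi with rfl | hlt
    · exact hgd
    · have hgφ : emb g * φ = emb g := by
        rw [eg, sub_mul, smul_mul_assoc, mul_assoc, mul_assoc b, hφ2]
      rw [← hgφ, mul_assoc, hf.pl_mul_death (by ring) (Nat.zero_le _) (by omega), mul_zero]
  -- Closing the new strand yields a circle in the first term of `g` and straightens two zigzags in
  -- the second, where the two copies of `f` then merge.
  · set b' := wd A (m + 1) (m + 3) [birth (m + 1)] with hb'
    set d' := wd A (m + 3) (m + 1) [death (m + 1)] with hd'
    set b₁ := wd A (m + 1) (m + 3) [birth m] with hb₁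
    set d₁ := wd A (m + 3) (m + 1) [death m] with hd₁
    set ψ : Op A := pl 0 2 f with hψ
    have e1 : pl 0 1 F = ψ := pl_pl_addBelow 0 1 1 f
    have e2 : pl 0 1 E = d₁ * b₁ := by
      have := pl_of (A := A) 0 1 (⟨_, hdia⟩ : Diagram (m + 2) (m + 2))
      rw [Nat.zero_add, shift_zero_map] at this
      rw [hd₁, hb₁, wd_mul (isDiagram_death (by omega) rfl) (isDiagram_birth (by omega) rfl)]
      exact this
    have e3 : pl 0 1 g = ψ - τ⁻¹ • (ψ * (d₁ * b₁) * ψ) := by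
      simp only [g, map_sub, map_smul, pl_comp, e1, e2]
    have hψ2 : ψ * d' = d' * emb f := by
      have := pl_mul_wd_below (A := A) 0 f (isDiagram_death (b := 0) (l := 0) le_rfl rfl)
      simpa [Slice.shift, pl_zero_zero] using this
    have hψb : b' * ψ = emb f * b' := by
      have := pl_mul_wd_below (A := A) 0 f (isDiagram_birth (a := 0) (l := 0) le_rfl rfl)
      simpa [Slice.shift, pl_zero_zero] using this.symm
    have z0 : b' * d' = (-(A ^ 2 + A⁻¹ ^ 2)) • wd A (m + 1) (m + 1) [] := by
      rw [hb', hd', wd_mul (isDiagram_birth (by omega) rfl) (isDiagram_death (by omega) rfl)]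
      exact wd_circle (by omega)
    have z1 : b' * d₁ = wd A (m + 1) (m + 1) [] := by
      rw [hb', hd₁, wd_mul (isDiagram_birth (by omega) rfl) (isDiagram_death (by omega) rfl)]
      exact (Iso.zigzag' (m + 1) m (by omega)).eq
    have z2 : b₁ * d' = wd A (m + 1) (m + 1) [] := by
      rw [hb₁, hd', wd_mul (isDiagram_birth (by omega) rfl) (isDiagram_death (by omega) rfl)]
      exact (Iso.zigzag (m + 1) m (by omega)).eq
    have t1 : b' * ψ * d' = (-(A ^ 2 + A⁻¹ ^ 2)) • emb f := by
      rw [mul_assoc, hψ2, ← mul_assoc, z0, smul_mul_assoc, wd_nil_mul_emb]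
    have t2 : b' * (ψ * (d₁ * b₁) * ψ) * d' = emb f := by
      calc b' * (ψ * (d₁ * b₁) * ψ) * d' = (b' * ψ) * d₁ * (b₁ * (ψ * d')) := by
            simp only [mul_assoc]
        _ = emb f * (b' * d₁) * ((b₁ * d') * emb f) := by rw [hψ2, hψb]; simp only [mul_assoc]
        _ = emb f := by
          rw [z1, z2, wd_nil_mul_emb, emb_mul_wd_nil, ← emb_comp, hf.idempotent]
    rw [e3, mul_sub, sub_mul, mul_smul_comm, smul_mul_assoc, t1, t2, sub_smul]

/-- The partial trace is carried through the induction because its value is the number that the next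
step of the recursion divides by. -/
theorem exists_isJonesWenzl_trace (hA : A ≠ 0) (m : ℕ)
    (hq : ∀ k, 1 ≤ k → k ≤ m + 1 → quantumInt A k ≠ 0) :
    ∃ (f : Skein A (m + 1) (m + 1)) (f' : Skein A m m), IsJonesWenzl (m + 1) f ∧
      IsJonesWenzl m f' ∧
      wd A m (m + 2) [birth m] * pl 0 1 f * wd A (m + 2) m [death m] =
        (-(quantumInt A (m + 2) / quantumInt A (m + 1))) • emb f' := by
  induction m with
  | zero =>
    refine ⟨Skein.one A 1, Skein.one A 0, isJonesWenzl_one hA (by omega),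
      isJonesWenzl_one hA (by omega), ?_⟩
    have h1 := quantumInt_add_two hA 0
    rw [quantumInt_zero, add_zero, quantumInt_one, mul_one] at h1
    rw [pl_one, quantumInt_one, div_one, h1, emb_one, wd_mul_wd_nil,
      wd_mul (isDiagram_birth le_rfl rfl) (isDiagram_death le_rfl rfl)]
    exact wd_circle le_rfl
  | succ m ih =>
    obtain ⟨f, f', hf, hf', htr⟩ := ih fun k h1 h2 => hq k h1 (by omega)
    have q1 := hq (m + 1) (by omega) (by omega)
    have q2 := hq (m + 2) (by omega) (by omega)
    obtain ⟨g, hg, hg'⟩ := hf.step hA hf' (neg_ne_zero.2 (div_ne_zero q2 q1)) htr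
    refine ⟨g, f, hg, hf, hg'.trans ?_⟩
    congr 1
    have h1 := quantumInt_add_two hA (m + 1)
    rw [show m + 1 + 2 = m + 3 by ring, show m + 1 + 1 = m + 2 by ring] at h1 ⊢
    have h2 : quantumInt A (m + 3) =
        (A ^ 2 + A⁻¹ ^ 2) * quantumInt A (m + 2) - quantumInt A (m + 1) := by
      linear_combination h1
    rw [inv_neg, inv_div, h2]
    generalize A ^ 2 + A⁻¹ ^ 2 = e
    field_simp
    ring

/-- The definition chooses some projector; only its defining properties are used afterwards, so its
uniqueness plays no role. -/
theorem isJonesWenzl_jonesWenzl (hA : A ≠ 0) {m : ℕ}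
    (hq : ∀ k, 1 ≤ k → k ≤ m → quantumInt A k ≠ 0) : IsJonesWenzl m (jonesWenzl A m) := by
  have h : ∃ f : Skein A m m, IsJonesWenzl m f := by
    cases m with
    | zero => exact ⟨_, isJonesWenzl_one hA (by omega)⟩
    | succ m =>
      obtain ⟨f, _, hf, _⟩ := exists_isJonesWenzl_trace hA m hq
      exact ⟨f, hf⟩
  rw [jonesWenzl, dif_pos h]
  exact h.choose_spec

/-! ### Sliding skein elements past each other, through crossings and along arcs -/

theorem pl_mul_pl_below {p q r t : ℕ} (l m e : ℕ) (x : Skein A p q) (y : Skein A r t) :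
    pl l (m + (r + e)) x * pl (l + q + m) e y = pl (l + p + m) e y * pl l (m + (t + e)) x := by
  induction y using Skein.induction_on with
  | zero => simp
  | add y y' h h' => simp only [map_add, mul_add, add_mul, h, h']
  | smul k y h => simp only [map_smul, mul_smul_comm, smul_mul_assoc, h]
  | of D =>
    rw [pl_of, pl_of]
    have := pl_mul_wd_below l x ((D.isDiagram.addBelow e).addAbove m)
    simpa only [shift_shift, Nat.add_assoc] using this

/-- A skein element slides through a bundle of crossings. -/
theorem pl_mul_crossGrid (s : Bool) (l e m : ℕ) {p q : ℕ} (x : Skein A p q) :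
    pl l (m + e) x * wd A (l + (q + (m + e))) (l + (q + (m + e))) (crossGrid s q m l) =
      wd A (l + (p + (m + e))) (l + (p + (m + e))) (crossGrid s p m l) * pl (l + m) e x := by
  induction x using Skein.induction_on with
  | zero => simp
  | add y y' h h' => simp only [map_add, mul_add, add_mul, h, h']
  | smul k y h => simp only [map_smul, mul_smul_comm, smul_mul_assoc, h]
  | of D =>
    have h := ((Iso.crossGrid_natural (A := A) s m D.isDiagram).place l e
      (N := l + (p + (m + e))) (N' := l + (q + (m + e))) (by ring) (by ring))
    rw [List.map_append, List.map_append, crossGrid_shift, crossGrid_shift, shift_shift,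
      Nat.add_zero] at h
    have h1 : IsDiagram (l + (p + (m + e))) (D.word.map (Slice.shift l)) (l + (q + (m + e))) :=
      D.isDiagram.place l (m + e) rfl rfl
    have h2 : IsDiagram (l + m + (p + e)) (D.word.map (Slice.shift (l + m))) (l + m + (q + e)) :=
      D.isDiagram.place (l + m) e rfl rfl
    rw [pl_of, pl_of, ← wd_append h1, h.eq,
      wd_append (isDiagram_crossGrid s p m l (l + (p + (m + e))) (by omega))]
    congr 2 <;> ring

theorem pl_mul_crossGrid_below (s : Bool) (l e m : ℕ) {p q : ℕ} (x : Skein A p q) :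
    pl (l + m) e x * wd A (l + (q + (m + e))) (l + (q + (m + e))) (crossGrid s m q l) =
      wd A (l + (p + (m + e))) (l + (p + (m + e))) (crossGrid s m p l) * pl l (m + e) x := by
  induction x using Skein.induction_on with
  | zero => simp
  | add y y' h h' => simp only [map_add, mul_add, add_mul, h, h']
  | smul k y h => simp only [map_smul, mul_smul_comm, smul_mul_assoc, h]
  | of D =>
    have h := ((Iso.crossGrid_natural_below (A := A) s m D.isDiagram).place l e
      (N := l + (p + (m + e))) (N' := l + (q + (m + e))) (by ring) (by ring))
    rw [List.map_append, List.map_append, crossGrid_shift, crossGrid_shift, shift_shift,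
      Nat.add_zero] at h
    have h2 : IsDiagram (l + (p + (m + e))) (D.word.map (Slice.shift (l + m))) (l + (q + (m + e))) :=
      D.isDiagram.place (l + m) e (by ring) (by ring)
    rw [pl_of, pl_of, ← wd_append (isDiagram_crossGrid s m p l (l + (p + (m + e))) (by omega)),
      ← h.eq, wd_append h2]
    congr 2 <;> ring

namespace IsJonesWenzl

variable {n : ℕ} {f : Skein A n n}

/-- One projector on a bundle of arcs `⊂` suffices. -/
theorem nestedBirths_absorb (hf : IsJonesWenzl n f) (l c : ℕ) {N N' : ℕ} (hN : N = l + c)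
    (hN' : N' = l + (n + (n + c))) :
    wd A N N' (nestedBirths n l) * pl l (n + c) f * pl (l + n) c f =
      wd A N N' (nestedBirths n l) * pl l (n + c) f := by
  subst hN hN'
  refine hf.absorb_right (N := l + (n + (n + c))) (by ring) (by rw [mul_assoc, pl_mul_wd_nil]) ?_
  intro i M h1 h2
  obtain ⟨j, rfl⟩ := Nat.exists_eq_add_of_le h1
  obtain ⟨q, rfl⟩ := Nat.exists_eq_add_of_le' (show j + 2 ≤ n by omega)
  by_cases hM : IsDiagram (l + (q + (j + 2) + (q + (j + 2) + c))) [death (l + (q + (j + 2)) + j)] M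
  swap
  · rw [wd_of_not hM, mul_zero]
  have hM' := isDiagram_death_iff.1 hM
  obtain rfl : M = l + (q + (j + 2) + (q + j + c)) := by omega
  have e1 := pl_mul_wd_below l f (v := [death j]) (c := q + (j + 2) + c) (c' := q + j + c)
    (isDiagram_death (by omega) (by ring))
  rw [show [death j].map (Slice.shift (l + (q + (j + 2)))) = [death (l + (q + (j + 2)) + j)] from
    rfl] at e1
  -- The hook on the lower bundle becomes a hook on the upper one, where the projector already
  -- present kills it.
  have e2 := ((Iso.nestedBirths_death (A := A) q j).place l c (N := l + c)
    (N' := l + (q + (j + 2) + (q + j + c))) (by ring) (by ring))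
  have e3 : (nestedBirths (q + j + 2) 0 ++ [death (q + 2 * j + 2)]).map (Slice.shift l) =
      nestedBirths (q + (j + 2)) l ++ [death (l + (q + (j + 2)) + j)] := by
    rw [show q + j + 2 = q + (j + 2) by ring, show q + 2 * j + 2 = q + (j + 2) + j by ring,
      List.map_append, nestedBirths_shift, Nat.add_zero, Nat.add_assoc l]
    rfl
  rw [e3] at e2
  rw [mul_assoc, e1, ← mul_assoc,
    ← wd_append (isDiagram_nestedBirths' (by omega) (by ring)), e2.eq, List.map_append,
    wd_append (b := l + (q + j + (q + j + c))) ((isDiagram_nestedBirths' (k := q + j)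
      (l := 0) (a := 0) le_rfl rfl).place l c (by ring) (by ring)), mul_assoc]
  rw [show [birth q].map (Slice.shift l) = [birth (l + q)] from rfl,
    hf.birth_mul_pl rfl (by omega) (by omega), mul_zero]

/-- One projector on a bundle of arcs `⊃` suffices. -/
theorem nestedDeaths_absorb (hf : IsJonesWenzl n f) (l c : ℕ) {N N' : ℕ} (hN : N = l + c)
    (hN' : N' = l + (n + (n + c))) :
    pl (l + n) c f * (pl l (n + c) f * wd A N' N (nestedDeaths n l)) =
      pl l (n + c) f * wd A N' N (nestedDeaths n l) := by
  subst hN hN'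
  refine hf.absorb_left (N := l + (n + (n + c))) (by ring) (by rw [← mul_assoc, wd_nil_mul_pl]) ?_
  intro i M h1 h2
  obtain ⟨j, rfl⟩ := Nat.exists_eq_add_of_le h1
  obtain ⟨q, rfl⟩ := Nat.exists_eq_add_of_le' (show j + 2 ≤ n by omega)
  by_cases hM : IsDiagram M [birth (l + (q + (j + 2)) + j)] (l + (q + (j + 2) + (q + (j + 2) + c)))
  swap
  · rw [wd_of_not hM, zero_mul]
  have hM' := isDiagram_birth_iff.1 hM
  obtain rfl : M = l + (q + (j + 2) + (q + j + c)) := by omega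
  have e1 := pl_mul_wd_below l f (v := [birth j]) (c' := q + (j + 2) + c) (c := q + j + c)
    (isDiagram_birth (by omega) (by ring))
  rw [show [birth j].map (Slice.shift (l + (q + (j + 2)))) = [birth (l + (q + (j + 2)) + j)] from
    rfl] at e1
  have e2 := ((Iso.birth_nestedDeaths (A := A) q j).place l c (N' := l + c)
    (N := l + (q + (j + 2) + (q + j + c))) (by ring) (by ring))
  have e3 : ([birth (q + 2 * j + 2)] ++ nestedDeaths (q + j + 2) 0).map (Slice.shift l) =
      [birth (l + (q + (j + 2)) + j)] ++ nestedDeaths (q + (j + 2)) l := by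
    rw [show q + j + 2 = q + (j + 2) by ring, show q + 2 * j + 2 = q + (j + 2) + j by ring,
      List.map_append, nestedDeaths_shift, Nat.add_zero, Nat.add_assoc l]
    rfl
  rw [e3] at e2
  rw [← mul_assoc, ← e1, mul_assoc, ← wd_append hM, e2.eq, List.map_append,
    wd_append (b := l + (q + j + (q + j + c))) ((isDiagram_death (b := q + j + (q + j)) (l := q)
      (by omega) rfl).place l c (by ring) (by ring)), ← mul_assoc]
  rw [show [death q].map (Slice.shift l) = [death (l + q)] from rfl,
    hf.pl_mul_death rfl (by omega) (by omega), zero_mul]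

end IsJonesWenzl

/-! ## Bundles of strands -/

/-- The projector on the bundle number `i` of `a` bundles of `n` strands. -/
def bundle (A : K) (n a i : ℕ) : Op A := pl (n * i) (n * (a - 1 - i)) (jonesWenzl A n)

/-- The projector on `a` bundles of `n` strands, as an operator. -/
def projOp (A : K) (n a : ℕ) : Op A := emb (projectors A n a)

/-- The operator of the cable of a slice. -/
def cableOp (A : K) (n a b : ℕ) (x : Slice) : Op A := wd A (n * a) (n * b) (x.cable n)

theorem bundle_eq {n a i c : ℕ} (h : a = i + 1 + c) :
    bundle A n a i = pl (n * i) (n * c) (jonesWenzl A n) := by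
  rw [bundle, show a - 1 - i = c by omega]

theorem wd_nil_mul_bundle {n a i : ℕ} (h : i < a) :
    wd A (n * a) (n * a) [] * bundle A n a i = bundle A n a i := by
  obtain ⟨c, rfl⟩ := Nat.exists_eq_add_of_le (Nat.succ_le_of_lt h)
  rw [bundle_eq rfl, show n * (i.succ + c) = n * i + (n + n * c) by rw [Nat.succ_eq_add_one]; ring,
    wd_nil_mul_pl]

theorem bundle_mul_wd_nil {n a i : ℕ} (h : i < a) :
    bundle A n a i * wd A (n * a) (n * a) [] = bundle A n a i := by
  obtain ⟨c, rfl⟩ := Nat.exists_eq_add_of_le (Nat.succ_le_of_lt h)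
  rw [bundle_eq rfl, show n * (i.succ + c) = n * i + (n + n * c) by rw [Nat.succ_eq_add_one]; ring,
    pl_mul_wd_nil]

theorem bundle_comm {n a i j : ℕ} (hij : i < j) (hj : j < a) :
    bundle A n a i * bundle A n a j = bundle A n a j * bundle A n a i := by
  obtain ⟨m, rfl⟩ := Nat.exists_eq_add_of_le (Nat.succ_le_of_lt hij)
  obtain ⟨c, rfl⟩ := Nat.exists_eq_add_of_le (Nat.succ_le_of_lt hj)
  rw [bundle_eq (c := m + (1 + c)) (by omega), bundle_eq (i := i.succ + m) (c := c) (by omega)]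
  have := pl_mul_pl_below (n * i) (n * m) (n * c) (jonesWenzl A n) (jonesWenzl A n)
  rwa [show n * (m + (1 + c)) = n * m + (n + n * c) by ring,
    show n * (i.succ + m) = n * i + n + n * m by rw [Nat.succ_eq_add_one]; ring]

theorem cable_shift (n c : ℕ) (x : Slice) :
    (x.cable n).map (Slice.shift (n * c)) = (x.shift c).cable n := by
  obtain ⟨p, l⟩ := x
  cases p <;>
    simp [Slice.cable, Slice.shift, nestedBirths_shift, nestedDeaths_shift, crossGrid_shift, mul_add]

theorem isDiagram_cable' (n : ℕ) {x : Slice} {a b : ℕ} (h : IsDiagram a [x] b) :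
    IsDiagram (n * a) (x.cable n) (n * b) := by
  have := x.isDiagram_cable n a h.1
  rwa [show x.next a = b from h.2] at this

/-- Bundles above a slice are not affected by it. -/
theorem bundle_mul_cableOp {n a b i : ℕ} {x : Slice} (hx : IsDiagram a [x] b) (hi : i < x.pos) :
    bundle A n a i * cableOp A n a b x = cableOp A n a b x * bundle A n b i := by
  obtain ⟨p, l⟩ := x
  obtain ⟨m, rfl⟩ := Nat.exists_eq_add_of_le (Nat.succ_le_of_lt hi)
  have hx' := isDiagram_slice_iff.1 hx
  obtain ⟨c, rfl⟩ := Nat.exists_eq_add_of_le (show i + 1 ≤ a by omega)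
  obtain ⟨c', rfl⟩ := Nat.exists_eq_add_of_le (show i + 1 ≤ b by omega)
  have hy : IsDiagram c [⟨p, m⟩] c' := isDiagram_slice_iff.2 ⟨by omega, by omega⟩
  have := pl_mul_wd_below (n * i) (jonesWenzl A n) (isDiagram_cable' n hy)
  rw [show n * i + n = n * (i + 1) by ring, cable_shift] at this
  rw [bundle_eq rfl, bundle_eq rfl, cableOp, show n * (i + 1 + c) = n * i + (n + n * c) by ring,
    show n * (i + 1 + c') = n * i + (n + n * c') by ring]
  exact this

/-- Bundles below a slice are not affected by it. -/
theorem cableOp_mul_bundle {n a b i j : ℕ} {x : Slice} (hx : IsDiagram a [x] b)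
    (hi : x.pos + x.piece.inp ≤ i) (hia : i < a) (hj : j + x.piece.inp = i + x.piece.out) :
    cableOp A n a b x * bundle A n b j = bundle A n a i * cableOp A n a b x := by
  obtain ⟨p, l⟩ := x
  have hx' := isDiagram_slice_iff.1 hx
  simp only at hi hj
  obtain ⟨c, rfl⟩ := Nat.exists_eq_add_of_le (show i + 1 ≤ a by omega)
  obtain rfl : b = j + 1 + c := by omega
  have hy : IsDiagram i [⟨p, l⟩] j := isDiagram_slice_iff.2 ⟨by omega, by omega⟩
  have := wd_mul_pl_above (n * c) (jonesWenzl A n) (isDiagram_cable' n hy)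
  rw [bundle_eq rfl, bundle_eq rfl, cableOp, show n * (i + 1 + c) = n * i + (n + n * c) by ring,
    show n * (j + 1 + c) = n * j + (n + n * c) by ring]
  exact this

/-- The two bundles change places at a crossing, and each carries its projector along; hence the
change of index. -/
theorem cross_mul_bundle {n a l : ℕ} (s : Bool) (h : l + 2 ≤ a) :
    cableOp A n a a (cross s l) * bundle A n a l =
      bundle A n a (l + 1) * cableOp A n a a (cross s l) := by
  obtain ⟨c, rfl⟩ := Nat.exists_eq_add_of_le h
  have := pl_mul_crossGrid_below s (n * l) (n * c) n (jonesWenzl A n)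
  rw [bundle_eq (i := l) (c := 1 + c) (by ring), bundle_eq (i := l + 1) (c := c) (by ring), cableOp,
    show n * (l + 2 + c) = n * l + (n + (n + n * c)) by ring,
    show n * (1 + c) = n + n * c by ring, show n * (l + 1) = n * l + n by ring]
  exact this.symm

theorem cross_mul_bundle' {n a l : ℕ} (s : Bool) (h : l + 2 ≤ a) :
    cableOp A n a a (cross s l) * bundle A n a (l + 1) =
      bundle A n a l * cableOp A n a a (cross s l) := by
  obtain ⟨c, rfl⟩ := Nat.exists_eq_add_of_le h
  have := pl_mul_crossGrid s (n * l) (n * c) n (jonesWenzl A n)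
  rw [bundle_eq (i := l) (c := 1 + c) (by ring), bundle_eq (i := l + 1) (c := c) (by ring), cableOp,
    show n * (l + 2 + c) = n * l + (n + (n + n * c)) by ring,
    show n * (1 + c) = n + n * c by ring, show n * (l + 1) = n * l + n by ring]
  exact this.symm

/-- The product of the projectors on the first `m` bundles. -/
theorem pl_projectors (n m c : ℕ) :
    pl 0 (n * c) (projectors A n m) = wd A (n * (m + c)) (n * (m + c)) [] *
      ((List.range m).map (bundle A n (m + c))).prod := by
  induction m generalizing c with
  | zero =>
    rw [projectors, pl_of]
    simp
  | succ m ih =>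
    rw [projectors]
    refine (pl_tensor 0 (n * c) (projectors A n m) (jonesWenzl A n)).trans ?_
    -- For the first `m` bundles, the last one counts among the bundles below.
    have := ih (1 + c)
    rw [show n * (1 + c) = n + n * c by ring] at this
    rw [this, List.range_succ, List.map_append, List.prod_append, ← mul_assoc, Nat.add_assoc]
    congr 1
    rw [List.map_singleton, List.prod_singleton, bundle_eq (c := c) (by ring), Nat.zero_add]

theorem projOp_eq (n a : ℕ) : projOp A n a = wd A (n * a) (n * a) [] *
    ((List.range a).map (bundle A n a)).prod := by
  have := pl_projectors (A := A) n a 0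
  rwa [Nat.mul_zero, pl_zero_zero, Nat.add_zero] at this

theorem wd_nil_mul_projOp (n a : ℕ) : wd A (n * a) (n * a) [] * projOp A n a = projOp A n a :=
  wd_nil_mul_emb _

theorem projOp_mul_wd_nil (n a : ℕ) : projOp A n a * wd A (n * a) (n * a) [] = projOp A n a :=
  emb_mul_wd_nil _

/-- The projectors on different bundles commute, so each can be brought next to whichever outer
factor absorbs it. -/
theorem mul_prod_bundle_mul {n a m : ℕ} (hm : m ≤ a) {U V : Op A}
    (h : ∀ i < m, U * bundle A n a i = U ∨ bundle A n a i * V = V) :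
    U * ((List.range m).map (bundle A n a)).prod * V = U * V := by
  induction m with
  | zero => simp
  | succ m ih =>
    have ih' := ih (by omega) fun i hi => h i (by omega)
    rw [List.range_succ, List.map_append, List.prod_append, List.map_singleton,
      List.prod_singleton]
    rcases h m (by omega) with h1 | h1
    · have hc : ((List.range m).map (bundle A n a)).prod * bundle A n a m =
          bundle A n a m * ((List.range m).map (bundle A n a)).prod := by
        refine Commute.list_prod_left _ _ fun y hy => ?_
        obtain ⟨i, hi, rfl⟩ := List.mem_map.1 hy
        exact bundle_comm (List.mem_range.1 hi) (by omega)
      rw [hc, ← mul_assoc, h1, ih']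
    · rw [← mul_assoc, mul_assoc _ (bundle A n a m), h1, ih']

/-- The projectors between two elements can be left out if each of them is absorbed by one of the
two elements. -/
theorem mul_projOp_mul {n a : ℕ} {U V : Op A} (hU : U * wd A (n * a) (n * a) [] = U)
    (h : ∀ i < a, U * bundle A n a i = U ∨ bundle A n a i * V = V) :
    U * projOp A n a * V = U * V := by
  rw [projOp_eq, ← mul_assoc, hU, mul_prod_bundle_mul le_rfl h]

theorem mul_projOp {n a : ℕ} {U : Op A} (hU : U * wd A (n * a) (n * a) [] = U)
    (h : ∀ i < a, U * bundle A n a i = U) : U * projOp A n a = U := by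
  simpa using mul_projOp_mul (V := 1) hU fun i hi => .inl (h i hi)

theorem projOp_mul {n a : ℕ} {V : Op A} (hV : wd A (n * a) (n * a) [] * V = V)
    (h : ∀ i < a, bundle A n a i * V = V) : projOp A n a * V = V := by
  have := mul_projOp_mul (U := wd A (n * a) (n * a) []) (V := V) (wd_mul_wd_nil _ _ _)
    fun i hi => .inr (h i hi)
  rwa [wd_nil_mul_projOp, hV] at this

/-! ### Rows of projectors before and after the cable of a slice -/

section Projectors

variable {n : ℕ}

theorem bundle_idem (hf : IsJonesWenzl n (jonesWenzl A n)) (a i : ℕ) :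
    bundle A n a i * bundle A n a i = bundle A n a i := hf.pl_idem _ _

theorem projOp_mul_bundle (hf : IsJonesWenzl n (jonesWenzl A n)) {a i : ℕ} (hi : i < a) :
    projOp A n a * bundle A n a i = projOp A n a := by
  have key : ∀ m ≤ a, i < m → ((List.range m).map (bundle A n a)).prod * bundle A n a i =
      ((List.range m).map (bundle A n a)).prod := by
    intro m hm him
    induction m with
    | zero => omega
    | succ m ih =>
      rw [List.range_succ, List.map_append, List.prod_append, List.map_singleton,
        List.prod_singleton, mul_assoc]
      rcases Nat.lt_succ_iff_lt_or_eq.1 him with h | rfl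
      · rw [← bundle_comm h (by omega), ← mul_assoc, ih (by omega) h]
      · rw [bundle_idem hf]
  rw [projOp_eq, mul_assoc, key a le_rfl hi]

theorem bundle_mul_projOp (hf : IsJonesWenzl n (jonesWenzl A n)) {a i : ℕ} (hi : i < a) :
    bundle A n a i * projOp A n a = projOp A n a := by
  have key : ∀ m ≤ a, i < m → bundle A n a i * ((List.range m).map (bundle A n a)).prod =
      ((List.range m).map (bundle A n a)).prod := by
    intro m hm him
    induction m with
    | zero => omega
    | succ m ih =>
      rw [List.range_succ, List.map_append, List.prod_append, List.map_singleton,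
        List.prod_singleton, ← mul_assoc]
      rcases Nat.lt_succ_iff_lt_or_eq.1 him with h | rfl
      · rw [ih (by omega) h]
      · have hc : ((List.range i).map (bundle A n a)).prod * bundle A n a i =
            bundle A n a i * ((List.range i).map (bundle A n a)).prod := by
          refine Commute.list_prod_left _ _ fun y hy => ?_
          obtain ⟨k, hk, rfl⟩ := List.mem_map.1 hy
          exact bundle_comm (List.mem_range.1 hk) (by omega)
        rw [← hc, mul_assoc, bundle_idem hf]
  rw [projOp_eq, ← mul_assoc, bundle_mul_wd_nil hi, ← wd_nil_mul_bundle hi, mul_assoc,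
    key a le_rfl hi]

theorem projOp_idem (hf : IsJonesWenzl n (jonesWenzl A n)) (a : ℕ) :
    projOp A n a * projOp A n a = projOp A n a :=
  mul_projOp (projOp_mul_wd_nil n a) fun _ hi => projOp_mul_bundle hf hi

theorem cableOp_mul_wd_nil (n a b : ℕ) (x : Slice) :
    cableOp A n a b x * wd A (n * b) (n * b) [] = cableOp A n a b x := wd_mul_wd_nil _ _ _

theorem wd_nil_mul_cableOp (n a b : ℕ) (x : Slice) :
    wd A (n * a) (n * a) [] * cableOp A n a b x = cableOp A n a b x := wd_nil_mul_wd _ _ _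

/-- Bundles which leave a slice without taking part in it carry a projector. -/
theorem projOp_mul_cableOp_mul_bundle (hf : IsJonesWenzl n (jonesWenzl A n)) {a b i : ℕ} {x : Slice}
    (hx : IsDiagram a [x] b) (hi : i < b) (h : i < x.pos ∨ x.pos + x.piece.out ≤ i) :
    projOp A n a * cableOp A n a b x * bundle A n b i = projOp A n a * cableOp A n a b x := by
  obtain ⟨p, l⟩ := x
  have hx' := isDiagram_slice_iff.1 hx
  simp only at h
  rcases h with h | h
  · rw [mul_assoc, ← bundle_mul_cableOp hx h, ← mul_assoc, projOp_mul_bundle hf (by omega)]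
  · rw [mul_assoc, cableOp_mul_bundle (i := i + p.inp - p.out) hx (by simp only; omega)
      (by omega) (by dsimp only; omega), ← mul_assoc, projOp_mul_bundle hf (by omega)]

theorem bundle_mul_cableOp_mul_projOp (hf : IsJonesWenzl n (jonesWenzl A n)) {a b i : ℕ} {x : Slice}
    (hx : IsDiagram a [x] b) (hi : i < a) (h : i < x.pos ∨ x.pos + x.piece.inp ≤ i) :
    bundle A n a i * (cableOp A n a b x * projOp A n b) = cableOp A n a b x * projOp A n b := by
  obtain ⟨p, l⟩ := x
  have hx' := isDiagram_slice_iff.1 hx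
  simp only at h
  rcases h with h | h
  · rw [← mul_assoc, bundle_mul_cableOp hx h, mul_assoc, bundle_mul_projOp hf (by omega)]
  · rw [← mul_assoc, ← cableOp_mul_bundle (j := i + p.out - p.inp) hx h hi (by simp only; omega),
      mul_assoc, bundle_mul_projOp hf (by omega)]

theorem projOp_mul_cross (hf : IsJonesWenzl n (jonesWenzl A n)) {a l : ℕ} (s : Bool)
    (h : l + 2 ≤ a) : projOp A n a * cableOp A n a a (cross s l) * projOp A n a =
      projOp A n a * cableOp A n a a (cross s l) := by
  refine mul_projOp (by rw [mul_assoc, cableOp_mul_wd_nil]) fun i hi => ?_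
  by_cases h1 : i < l ∨ l + 2 ≤ i
  · exact projOp_mul_cableOp_mul_bundle hf (isDiagram_cross s h) hi h1
  · obtain rfl | rfl : i = l ∨ i = l + 1 := by omega
    · rw [mul_assoc, cross_mul_bundle s h, ← mul_assoc, projOp_mul_bundle hf (by omega)]
    · rw [mul_assoc, cross_mul_bundle' s h, ← mul_assoc, projOp_mul_bundle hf (by omega)]

theorem cross_mul_projOp (hf : IsJonesWenzl n (jonesWenzl A n)) {a l : ℕ} (s : Bool)
    (h : l + 2 ≤ a) : projOp A n a * (cableOp A n a a (cross s l) * projOp A n a) =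
      cableOp A n a a (cross s l) * projOp A n a := by
  refine projOp_mul (by rw [← mul_assoc, wd_nil_mul_cableOp]) fun i hi => ?_
  by_cases h1 : i < l ∨ l + 2 ≤ i
  · exact bundle_mul_cableOp_mul_projOp hf (isDiagram_cross s h) hi h1
  · obtain rfl | rfl : i = l ∨ i = l + 1 := by omega
    · rw [← mul_assoc, ← cross_mul_bundle' s h, mul_assoc, bundle_mul_projOp hf (by omega)]
    · rw [← mul_assoc, ← cross_mul_bundle s h, mul_assoc, bundle_mul_projOp hf (by omega)]

/-- The bundles that pass by the new arcs carried a projector before them, and the two ends of the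
arcs share one. Of the row after the arcs a single projector, on their upper ends, therefore
remains. -/
theorem projOp_mul_birth (hf : IsJonesWenzl n (jonesWenzl A n)) {a l : ℕ} (h : l ≤ a) :
    projOp A n a * cableOp A n a (a + 2) (birth l) * projOp A n (a + 2) =
      projOp A n a * cableOp A n a (a + 2) (birth l) * bundle A n (a + 2) l := by
  have e : cableOp A n a (a + 2) (birth l) * bundle A n (a + 2) l * bundle A n (a + 2) (l + 1) =
      cableOp A n a (a + 2) (birth l) * bundle A n (a + 2) l := by
    obtain ⟨c, rfl⟩ := Nat.exists_eq_add_of_le h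
    rw [bundle_eq (i := l) (c := 1 + c) (by ring), bundle_eq (i := l + 1) (c := c) (by ring), cableOp,
      show n * (1 + c) = n + n * c by ring, show n * (l + 1) = n * l + n by ring]
    exact hf.nestedBirths_absorb (N := n * (l + c)) (N' := n * (l + c + 2)) (n * l) (n * c) (by ring)
      (by ring)
  have key : projOp A n a * cableOp A n a (a + 2) (birth l) * bundle A n (a + 2) l *
      projOp A n (a + 2) =
      projOp A n a * cableOp A n a (a + 2) (birth l) * bundle A n (a + 2) l := by
    refine mul_projOp (by rw [mul_assoc, bundle_mul_wd_nil (by omega)]) fun i hi => ?_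
    rcases lt_trichotomy i l with h1 | rfl | h1
    · rw [mul_assoc, ← bundle_comm h1 (by omega), ← mul_assoc,
        projOp_mul_cableOp_mul_bundle hf (isDiagram_birth h rfl) hi (.inl h1)]
    · rw [mul_assoc, bundle_idem hf]
    · rcases eq_or_lt_of_le (Nat.succ_le_of_lt h1) with rfl | h2
      · rw [mul_assoc, mul_assoc, ← mul_assoc (cableOp A n a (a + 2) (birth l)), e, ← mul_assoc]
      · rw [mul_assoc, bundle_comm h1 (by omega), ← mul_assoc,
          projOp_mul_cableOp_mul_bundle hf (isDiagram_birth h rfl) hi (.inr h2)]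
  rw [← key, mul_assoc _ (bundle A n (a + 2) l), bundle_mul_projOp hf (by omega)]

theorem death_mul_projOp (hf : IsJonesWenzl n (jonesWenzl A n)) {a l : ℕ} (h : l ≤ a) :
    projOp A n (a + 2) * (cableOp A n (a + 2) a (death l) * projOp A n a) =
      bundle A n (a + 2) l * (cableOp A n (a + 2) a (death l) * projOp A n a) := by
  have e : bundle A n (a + 2) (l + 1) * (bundle A n (a + 2) l * cableOp A n (a + 2) a (death l)) =
      bundle A n (a + 2) l * cableOp A n (a + 2) a (death l) := by
    obtain ⟨c, rfl⟩ := Nat.exists_eq_add_of_le h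
    rw [bundle_eq (i := l) (c := 1 + c) (by ring), bundle_eq (i := l + 1) (c := c) (by ring), cableOp,
      show n * (1 + c) = n + n * c by ring, show n * (l + 1) = n * l + n by ring]
    exact hf.nestedDeaths_absorb (N := n * (l + c)) (N' := n * (l + c + 2)) (n * l) (n * c) (by ring)
      (by ring)
  have key : projOp A n (a + 2) * (bundle A n (a + 2) l *
      (cableOp A n (a + 2) a (death l) * projOp A n a)) =
      bundle A n (a + 2) l * (cableOp A n (a + 2) a (death l) * projOp A n a) := by
    refine projOp_mul (by rw [← mul_assoc, wd_nil_mul_bundle (by omega)]) fun i hi => ?_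
    rcases lt_trichotomy i l with h1 | rfl | h1
    · rw [← mul_assoc, bundle_comm h1 (by omega), mul_assoc,
        bundle_mul_cableOp_mul_projOp hf (isDiagram_death h rfl) hi (.inl h1)]
    · rw [← mul_assoc, bundle_idem hf]
    · rcases eq_or_lt_of_le (Nat.succ_le_of_lt h1) with rfl | h2
      · rw [← mul_assoc, ← mul_assoc, mul_assoc (bundle A n (a + 2) (l + 1)), e, mul_assoc]
      · rw [← mul_assoc, ← bundle_comm h1 (by omega), mul_assoc,
          bundle_mul_cableOp_mul_projOp hf (isDiagram_death h rfl) hi (.inr h2)]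
  rw [← key, ← mul_assoc (projOp A n (a + 2)) (bundle A n (a + 2) l),
    projOp_mul_bundle hf (by omega)]

end Projectors

/-! ## Two clusters -/

/-- Projectors on two bundles of `n` strands, one below the other. -/
def clusters (n : ℕ) (f : Skein A n n) : Op A := pl 0 n f * pl n 0 f

theorem emb_tensor_self (n : ℕ) (f : Skein A n n) : emb (Skein.tensor f f) = clusters n f :=
  emb_tensor f f

namespace IsJonesWenzl

variable {n : ℕ} {f : Skein A n n}

theorem clusters_comm (n : ℕ) (f : Skein A n n) : clusters n f = pl n 0 f * pl 0 n f := by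
  have := pl_mul_pl_below 0 0 0 f f
  simpa [clusters] using this

theorem wd_nil_mul_clusters (n : ℕ) (f : Skein A n n) :
    wd A (n + n) (n + n) [] * clusters n f = clusters n f := by
  rw [← emb_tensor_self, wd_nil_mul_emb]

theorem clusters_mul_wd_nil (n : ℕ) (f : Skein A n n) :
    clusters n f * wd A (n + n) (n + n) [] = clusters n f := by
  rw [← emb_tensor_self, emb_mul_wd_nil]

theorem birth_mul_clusters (hf : IsJonesWenzl n f) (a : ℕ) {i : ℕ} (h : i + 2 ≤ n ∨ n ≤ i) :
    wd A a (n + n) [birth i] * clusters n f = 0 := by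
  by_cases hi : IsDiagram a [birth i] (n + n)
  swap
  · rw [wd_of_not hi, zero_mul]
  rw [isDiagram_birth_iff] at hi
  rcases h with h | h
  · rw [clusters, ← mul_assoc, hf.birth_mul_pl (by omega) (by omega) (by omega), zero_mul]
  · rw [clusters_comm, ← mul_assoc, hf.birth_mul_pl (by omega) (by omega) (by omega), zero_mul]

theorem clusters_mul_death (hf : IsJonesWenzl n f) (b : ℕ) {i : ℕ} (h : i + 2 ≤ n ∨ n ≤ i) :
    clusters n f * wd A (n + n) b [death i] = 0 := by
  by_cases hi : IsDiagram (n + n) [death i] b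
  swap
  · rw [wd_of_not hi, mul_zero]
  rw [isDiagram_death_iff] at hi
  rcases h with h | h
  · rw [clusters_comm, mul_assoc, hf.pl_mul_death (by omega) (by omega) (by omega), mul_zero]
  · rw [clusters, mul_assoc, hf.pl_mul_death (by omega) (by omega) (by omega), mul_zero]

/-- Of all systems of arcs `⊂` with endpoints on two clusters, only the nested one survives. -/
theorem births_mul_clusters (hf : IsJonesWenzl n f) {a : ℕ} {M : List ℕ}
    (h : IsDiagram a (M.map birth) (n + n)) :
    wd A a (n + n) (M.map birth) * clusters n f = 0 ∨
      wd A a (n + n) (M.map birth) * clusters n f =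
        wd A a (n + n) (nestedBirths M.length (n - M.length)) * clusters n f := by
  induction M generalizing a with
  | nil => right; rfl
  | cons i M ih =>
    obtain ⟨b, h1, h2⟩ := isDiagram_cons_iff.1 h
    have hl := IsDiagram.length_births h2
    have hi := isDiagram_birth_iff.1 h1
    obtain ⟨k, hk⟩ : ∃ k, n = M.length + (k + 1) := ⟨n - M.length - 1, by omega⟩
    rw [List.map_cons, ← List.singleton_append, wd_append h1, mul_assoc]
    rcases ih h2 with h3 | h3
    · left; rw [h3, mul_zero]
    rw [h3, ← mul_assoc, ← wd_append h1]
    rw [show n - M.length = k + 1 by omega, List.length_cons,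
      show n - (M.length + 1) = k by omega]
    set p := M.length
    -- The nest of the remaining arcs is inserted between the strands `k` and `k + 1`. The arc at
    -- `k` encloses it and enlarges the nest; an arc higher or lower commutes past it and becomes a
    -- hook on the upper or the lower cluster.
    rcases lt_trichotomy i k with hik | rfl | hik
    · left
      obtain ⟨q, rfl⟩ := Nat.exists_eq_add_of_le' (show 1 ≤ k by omega)
      have h4 := Iso.far (A := A) (isDiagram_birth (a := q) (b := q + 2) (l := i) (by omega) rfl)
        (isDiagram_nestedBirths' (k := p) (l := 0) (a := q + 2) (b := q + 2 + 2 * p) (by omega) rfl)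
      rw [nestedBirths_shift, nestedBirths_shift] at h4
      have h5 := h4.cast (a' := a) (b' := n + n) (by omega) (by omega) rfl rfl
      rw [show q + 1 + 1 = q + 2 + 0 by ring, h5.eq,
        wd_append (b := a + 2 * p) (isDiagram_nestedBirths' (by omega) rfl), mul_assoc,
        hf.birth_mul_clusters _ (by omega), mul_zero]
    · right
      rw [nestedBirths_succ']; rfl
    · left
      obtain ⟨j, rfl⟩ := Nat.exists_eq_add_of_le (Nat.succ_le_of_lt hik)
      obtain ⟨q, rfl⟩ := Nat.exists_eq_add_of_le' (show 1 ≤ k by omega)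
      have h4 := Iso.far (A := A)
        (isDiagram_nestedBirths' (k := p) (l := q + 2) (a := q + 2) (b := q + 2 + 2 * p) (by omega)
          rfl)
        (isDiagram_birth (a := q) (b := q + 2) (l := j) (by omega) rfl)
      have h5 := h4.symm.cast (a' := a) (b' := n + n) (X' := [birth ((q + 1).succ + j)] ++
        nestedBirths p (q + 1 + 1)) (by omega) (by omega)
        (by simp [Slice.shift, Nat.succ_eq_add_one]) rfl
      rw [h5.eq,
        wd_append (b := a + 2 * p) (isDiagram_nestedBirths' (by omega) rfl), mul_assoc]
      rw [show [birth j].map (Slice.shift (q + 2 + 2 * p)) = [birth (q + 2 + 2 * p + j)] from rfl,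
        hf.birth_mul_clusters _ (by omega), mul_zero]

/-- Of all systems of arcs `⊃` with endpoints on two clusters, only the nested one survives. -/
theorem clusters_mul_deaths (hf : IsJonesWenzl n f) {b : ℕ} {L : List ℕ}
    (h : IsDiagram (n + n) (L.map death) b) :
    clusters n f * wd A (n + n) b (L.map death) = 0 ∨
      clusters n f * wd A (n + n) b (L.map death) =
        clusters n f * wd A (n + n) b (nestedDeaths L.length (n - L.length)) := by
  induction L using List.reverseRecOn generalizing b with
  | nil => right; rfl
  | append_singleton M i ih =>
    rw [List.map_append] at h ⊢
    obtain ⟨c, h2, h1⟩ := isDiagram_append_iff.1 h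
    have hl := IsDiagram.length_deaths h2
    have hi := isDiagram_death_iff.1 h1
    obtain ⟨k, hk⟩ : ∃ k, n = M.length + (k + 1) := ⟨n - M.length - 1, by omega⟩
    have h0 : IsDiagram (n + n) (nestedDeaths M.length (n - M.length)) c :=
      isDiagram_nestedDeaths' (by omega) (by omega)
    rw [wd_append h2, ← mul_assoc]
    rcases ih h2 with h3 | h3
    · left; rw [h3, zero_mul]
    rw [h3, mul_assoc, ← wd_append h0]
    rw [show n - M.length = k + 1 by omega, List.length_append, List.length_singleton,
      show n - (M.length + 1) = k by omega]
    set p := M.length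
    rcases lt_trichotomy i k with hik | rfl | hik
    · left
      obtain ⟨q, rfl⟩ := Nat.exists_eq_add_of_le' (show 1 ≤ k by omega)
      have h4 := Iso.far (A := A) (isDiagram_death (b := q) (a := q + 2) (l := i) (by omega) rfl)
        (isDiagram_nestedDeaths' (k := p) (l := 0) (b := q + 2) (a := q + 2 + 2 * p) (by omega) rfl)
      rw [nestedDeaths_shift, nestedDeaths_shift] at h4
      have h5 := h4.symm.cast (a' := n + n) (b' := b) (by omega) (by omega) rfl rfl
      rw [List.map_singleton, show q + 1 + 1 = q + 2 + 0 by ring, h5.eq,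
        wd_append (b := b + 2 * p) (isDiagram_death (by omega) (by omega)), ← mul_assoc,
        hf.clusters_mul_death _ (by omega), zero_mul]
    · right
      rw [nestedDeaths_succ']; rfl
    · left
      obtain ⟨j, rfl⟩ := Nat.exists_eq_add_of_le (Nat.succ_le_of_lt hik)
      obtain ⟨q, rfl⟩ := Nat.exists_eq_add_of_le' (show 1 ≤ k by omega)
      have h4 := Iso.far (A := A)
        (isDiagram_nestedDeaths' (k := p) (l := q + 2) (b := q + 2) (a := q + 2 + 2 * p) (by omega)
          rfl)
        (isDiagram_death (b := q) (a := q + 2) (l := j) (by omega) rfl)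
      have h5 := h4.cast (a' := n + n) (b' := b) (X' := nestedDeaths p (q + 1 + 1) ++
        [((q + 1).succ + j)].map death) (by omega) (by omega)
        (by simp [Slice.shift, Nat.succ_eq_add_one]) rfl
      rw [h5.eq, show [death j].map (Slice.shift (q + 2 + 2 * p)) = [death (q + 2 + 2 * p + j)] from
        rfl, wd_append (b := b + 2 * p) (isDiagram_death (by omega) (by omega)), ← mul_assoc,
        hf.clusters_mul_death _ (by omega), zero_mul]

/-- Without endpoints on the left a normal form has no arcs `⊃`, and of the systems of arcs `⊂` only
the full nest survives. This one-dimensionality makes a kink act by a scalar. -/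
theorem emb_mul_clusters (hf : IsJonesWenzl n f) (x : Skein A 0 (n + n)) :
    ∃ c : K, emb x * clusters n f = c • (wd A 0 (n + n) (nestedBirths n 0) * clusters n f) := by
  have hx := x.mem_span_normal
  induction hx using Submodule.span_induction with
  | mem x hx =>
    obtain ⟨D, L, M, hD, rfl⟩ := hx
    have hd := D.isDiagram
    rw [← wd_word]
    rw [hD] at hd ⊢
    obtain ⟨b, h1, h2⟩ := isDiagram_append_iff.1 hd
    have hL := IsDiagram.length_deaths h1
    obtain rfl : L = [] := List.length_eq_zero_iff.1 (by omega)
    obtain rfl : 0 = b := h1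
    have hM := IsDiagram.length_births h2
    rw [List.map_nil, List.nil_append]
    rcases hf.births_mul_clusters h2 with h3 | h3
    · exact ⟨0, by rw [h3, zero_smul]⟩
    · refine ⟨1, ?_⟩
      rw [h3, one_smul, show M.length = n by omega, Nat.sub_self]
  | zero => exact ⟨0, by simp⟩
  | add x y _ _ hx hy =>
    obtain ⟨c, hc⟩ := hx
    obtain ⟨d, hd⟩ := hy
    exact ⟨c + d, by rw [map_add, add_mul, hc, hd, add_smul]⟩
  | smul k x _ hx =>
    obtain ⟨c, hc⟩ := hx
    exact ⟨k * c, by rw [map_smul, smul_mul_assoc, hc, smul_smul]⟩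

theorem clusters_mul_emb (hf : IsJonesWenzl n f) (x : Skein A (n + n) 0) :
    ∃ c : K, clusters n f * emb x = c • (clusters n f * wd A (n + n) 0 (nestedDeaths n 0)) := by
  have hx := x.mem_span_normal
  induction hx using Submodule.span_induction with
  | mem x hx =>
    obtain ⟨D, L, M, hD, rfl⟩ := hx
    have hd := D.isDiagram
    rw [← wd_word]
    rw [hD] at hd ⊢
    obtain ⟨b, h1, h2⟩ := isDiagram_append_iff.1 hd
    have hM := IsDiagram.length_births h2
    obtain rfl : M = [] := List.length_eq_zero_iff.1 (by omega)
    obtain rfl : b = 0 := h2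
    have hL := IsDiagram.length_deaths h1
    rw [List.map_nil, List.append_nil]
    rcases hf.clusters_mul_deaths h1 with h3 | h3
    · exact ⟨0, by rw [h3, zero_smul]⟩
    · refine ⟨1, ?_⟩
      rw [h3, one_smul, show L.length = n by omega, Nat.sub_self]
  | zero => exact ⟨0, by simp⟩
  | add x y _ _ hx hy =>
    obtain ⟨c, hc⟩ := hx
    obtain ⟨d, hd⟩ := hy
    exact ⟨c + d, by rw [map_add, mul_add, hc, hd, add_smul]⟩
  | smul k x _ hx =>
    obtain ⟨c, hc⟩ := hx
    exact ⟨k * c, by rw [map_smul, mul_smul_comm, hc, smul_smul]⟩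

/-- Each projector slides through the grid to the place of the other, and the two are equal. -/
theorem crossGrid_comm_clusters (s : Bool) (n : ℕ) (f : Skein A n n) :
    clusters n f * wd A (n + n) (n + n) (crossGrid s n n 0) =
      wd A (n + n) (n + n) (crossGrid s n n 0) * clusters n f := by
  have h1 := pl_mul_crossGrid s 0 0 n f
  have h2 := pl_mul_crossGrid_below s 0 0 n f
  simp only [Nat.zero_add, Nat.add_zero] at h1 h2
  rw [clusters_comm, mul_assoc, h1, ← mul_assoc, h2, mul_assoc, ← clusters, clusters_comm]

theorem wd_crossGrid_inverse (s : Bool) (n : ℕ) :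
    wd A (n + n) (n + n) (crossGrid s n n 0) * wd A (n + n) (n + n) (crossGrid (!s) n n 0) =
      wd A (n + n) (n + n) [] := by
  rw [← (Iso.crossGrid_inverse (A := A) s n n).eq,
    wd_append (isDiagram_crossGrid s n n 0 (n + n) (by omega))]

/-- A kink in a bundle of arcs `⊂` contributes a nonzero factor. -/
theorem kink_birth (hf : IsJonesWenzl n f) (s : Bool) : ∃ c : K, c ≠ 0 ∧
    wd A 0 (n + n) (nestedBirths n 0 ++ crossGrid s n n 0) * clusters n f =
      c • (wd A 0 (n + n) (nestedBirths n 0) * clusters n f) := by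
  have hb : IsDiagram 0 (nestedBirths n 0) (n + n) := isDiagram_nestedBirths' le_rfl (by ring)
  have hg := isDiagram_crossGrid s n n 0 (n + n) (by omega)
  obtain ⟨c, hc⟩ := hf.emb_mul_clusters (Skein.of A ⟨_, hb.append hg⟩)
  rw [← wd_eq] at hc
  -- If the scalar is zero, undoing the crossings shows that the nested arcs themselves vanish
  -- between the projectors; then any scalar is correct, and `1` is taken.
  by_cases h0 : c = 0
  · refine ⟨1, one_ne_zero, ?_⟩
    have h1 : wd A 0 (n + n) (nestedBirths n 0) * clusters n f = 0 := by
      rw [wd_append hb, mul_assoc, ← crossGrid_comm_clusters, h0, zero_smul] at hc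
      have h2 := congrArg (· * wd A (n + n) (n + n) (crossGrid (!s) n n 0)) hc
      simpa only [mul_assoc, zero_mul, wd_crossGrid_inverse, clusters_mul_wd_nil] using h2
    rw [hc, h0, h1, smul_zero, smul_zero]
  · exact ⟨c, h0, hc⟩

/-- A kink in a bundle of arcs `⊃` contributes a nonzero factor. -/
theorem kink_death (hf : IsJonesWenzl n f) (s : Bool) : ∃ c : K, c ≠ 0 ∧
    clusters n f * wd A (n + n) 0 (crossGrid s n n 0 ++ nestedDeaths n 0) =
      c • (clusters n f * wd A (n + n) 0 (nestedDeaths n 0)) := by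
  have hb : IsDiagram (n + n) (nestedDeaths n 0) 0 := isDiagram_nestedDeaths' le_rfl (by ring)
  have hg := isDiagram_crossGrid s n n 0 (n + n) (by omega)
  obtain ⟨c, hc⟩ := hf.clusters_mul_emb (Skein.of A ⟨_, hg.append hb⟩)
  rw [← wd_eq] at hc
  by_cases h0 : c = 0
  · refine ⟨1, one_ne_zero, ?_⟩
    have h1 : clusters n f * wd A (n + n) 0 (nestedDeaths n 0) = 0 := by
      rw [wd_append hg, ← mul_assoc, crossGrid_comm_clusters, h0, zero_smul] at hc
      have h2 := congrArg (wd A (n + n) (n + n) (crossGrid (!s) n n 0) * ·) hc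
      have h3 := wd_crossGrid_inverse (A := A) (!s) n
      rw [Bool.not_not] at h3
      simpa only [← mul_assoc, mul_zero, h3, wd_nil_mul_clusters] using h2
    rw [hc, h0, h1, smul_zero, smul_zero]
  · exact ⟨c, h0, hc⟩

end IsJonesWenzl

/-- The operator of the coloring of a word. -/
def colorOp (A : K) (n : ℕ) : ℕ → List Slice → Op A
  | a, [] => projOp A n a
  | a, x :: w => projOp A n a * cableOp A n a (x.next a) x * colorOp A n (x.next a) w

theorem emb_colorWord (n : ℕ) (w : List Slice) (a b : ℕ) (h : IsDiagram a w b) :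
    emb (colorWord A n w a b h) = colorOp A n a w := by
  induction w generalizing a with
  | nil =>
    cases h
    show emb (Skein.comp (projectors A n _) (Skein.one A (n * _))) = projOp A n _
    rw [Skein.comp_one]; rfl
  | cons x w ih =>
    rw [colorWord, emb_comp, emb_comp, ih, ← wd_eq]; rfl

theorem colorOp_cons {n a b : ℕ} {x : Slice} (hx : IsDiagram a [x] b) (w : List Slice) :
    colorOp A n a (x :: w) = projOp A n a * cableOp A n a b x * colorOp A n b w := by
  obtain rfl : x.next a = b := hx.2
  rfl

/-! ### Effect of the local moves on the coloring -/

section Projectors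

variable {n : ℕ}

theorem projOp_mul_colorOp (hf : IsJonesWenzl n (jonesWenzl A n)) (a : ℕ) (w : List Slice) :
    projOp A n a * colorOp A n a w = colorOp A n a w := by
  cases w with
  | nil => exact projOp_idem hf a
  | cons x w => rw [colorOp, ← mul_assoc, ← mul_assoc, projOp_idem hf]

/-- At the cut the row of projectors appears twice, which changes nothing by idempotence. Local
moves can thus be examined without their context. -/
theorem colorOp_append (hf : IsJonesWenzl n (jonesWenzl A n)) {a b : ℕ} {u : List Slice}
    (hu : IsDiagram a u b) (v : List Slice) :
    colorOp A n a (u ++ v) = colorOp A n a u * colorOp A n b v := by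
  induction u generalizing a with
  | nil => cases hu; exact (projOp_mul_colorOp hf _ v).symm
  | cons x u ih =>
    rw [List.cons_append, colorOp, colorOp, ih hu.2, mul_assoc, mul_assoc, mul_assoc]

theorem colorOp_singleton {a b : ℕ} {x : Slice} (hx : IsDiagram a [x] b) :
    colorOp A n a [x] = projOp A n a * cableOp A n a b x * projOp A n b := colorOp_cons hx []

theorem colorOp_pair {a b c : ℕ} {x y : Slice}
    (hx : IsDiagram a [x] b) (hy : IsDiagram b [y] c) :
    colorOp A n a [x, y] = projOp A n a * cableOp A n a b x * projOp A n b *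
      (cableOp A n b c y * projOp A n c) := by
  rw [colorOp_cons hx, colorOp_singleton hy]
  simp only [mul_assoc]

theorem cableOp_mul_cableOp {a b c : ℕ} {x y : Slice}
    (hx : IsDiagram a [x] b) (hy : IsDiagram b [y] c) :
    cableOp A n a b x * cableOp A n b c y = wd A (n * a) (n * c) (x.cable n ++ y.cable n) :=
  wd_mul (isDiagram_cable' n hx) (isDiagram_cable' n hy)

/-- No bundle between the two slices meets both pieces. Every projector there is absorbed on the
side where its bundle passes by, and then the bare cables commute. -/
theorem colorOp_far (hf : IsJonesWenzl n (jonesWenzl A n)) (p q : Piece) (l m : ℕ) {a b : ℕ}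
    (h : IsDiagram a [⟨p, l⟩, ⟨q, l + p.out + m⟩] b)
    (h' : IsDiagram a [⟨q, l + p.inp + m⟩, ⟨p, l⟩] b) :
    colorOp A n a [⟨p, l⟩, ⟨q, l + p.out + m⟩] = colorOp A n a [⟨q, l + p.inp + m⟩, ⟨p, l⟩] := by
  obtain ⟨c, h1, h2⟩ := isDiagram_cons_iff.1 h
  obtain ⟨d, h3, h4⟩ := isDiagram_cons_iff.1 h'
  rw [colorOp_pair h1 h2, colorOp_pair h3 h4]
  have k1 := isDiagram_slice_iff.1 h1
  have k2 := isDiagram_slice_iff.1 h2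
  rw [mul_projOp_mul (by rw [mul_assoc, cableOp_mul_wd_nil]), mul_projOp_mul
    (by rw [mul_assoc, cableOp_mul_wd_nil])]
  · simp only [← mul_assoc _ _ (projOp A n b)]
    congr 1
    simp only [mul_assoc]
    congr 1
    obtain ⟨e, rfl⟩ := Nat.exists_eq_add_of_le (show l + p.inp ≤ a by omega)
    obtain ⟨e', rfl⟩ := Nat.exists_eq_add_of_le (show l + p.out ≤ b by omega)
    have hu : IsDiagram (l + p.inp) [⟨p, l⟩] (l + p.out) :=
      isDiagram_slice_iff.2 ⟨le_rfl, by omega⟩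
    have hv : IsDiagram e [⟨q, m⟩] e' := isDiagram_slice_iff.2 ⟨by omega, by omega⟩
    have := (Iso.far (A := A) (isDiagram_cable' n hu) (isDiagram_cable' n hv)).eq
    rw [cable_shift, cable_shift, ← mul_add, ← mul_add] at this
    rw [cableOp_mul_cableOp h1 h2, cableOp_mul_cableOp h3 h4]
    exact this
  · intro i hi
    by_cases hi' : i < l + p.inp + m ∨ l + p.inp + m + q.out ≤ i
    · exact .inl (projOp_mul_cableOp_mul_bundle hf h3 hi hi')
    · exact .inr (bundle_mul_cableOp_mul_projOp hf h4 hi (.inr (by dsimp only; omega)))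
  · intro i hi
    by_cases hi' : i < l ∨ l + p.out ≤ i
    · exact .inl (projOp_mul_cableOp_mul_bundle hf h1 hi hi')
    · exact .inr (bundle_mul_cableOp_mul_projOp hf h2 hi (.inl (by dsimp only; omega)))

theorem cable_zigzag (n : ℕ) {a l : ℕ} (h : l + 1 ≤ a) :
    cableOp A n a (a + 2) (birth l) * cableOp A n (a + 2) a (death (l + 1)) =
      wd A (n * a) (n * a) [] := by
  obtain ⟨c, rfl⟩ := Nat.exists_eq_add_of_le h
  rw [cableOp_mul_cableOp (isDiagram_birth (by omega) rfl) (isDiagram_death (by omega) rfl)]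
  have := ((Iso.nested_zigzag (A := A) n).place (n * l) (n * c) (N := n * (l + 1 + c))
    (N' := n * (l + 1 + c)) (by ring) (by ring)).eq
  rwa [List.map_append, nestedBirths_shift, nestedDeaths_shift] at this

theorem cable_zigzag' (n : ℕ) {a l : ℕ} (h : l + 1 ≤ a) :
    cableOp A n a (a + 2) (birth (l + 1)) * cableOp A n (a + 2) a (death l) =
      wd A (n * a) (n * a) [] := by
  obtain ⟨c, rfl⟩ := Nat.exists_eq_add_of_le h
  rw [cableOp_mul_cableOp (isDiagram_birth (by omega) rfl) (isDiagram_death (by omega) rfl)]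
  have := ((Iso.nested_zigzag' (A := A) n).place (n * l) (n * c) (N := n * (l + 1 + c))
    (N' := n * (l + 1 + c)) (by ring) (by ring)).eq
  rwa [List.map_append, nestedBirths_shift, nestedDeaths_shift] at this

/-- The row in the middle reduces to one projector on the upper ends of the new arcs. That bundle
passes by the arcs `⊃`, so its projector moves out to the right and is absorbed, and the bare zigzag
straightens. -/
theorem colorOp_zigzag (hf : IsJonesWenzl n (jonesWenzl A n)) {a l : ℕ} (h : l + 1 ≤ a) :
    colorOp A n a [birth l, death (l + 1)] = projOp A n a := by
  rw [colorOp_pair (isDiagram_birth (by omega) rfl) (isDiagram_death (by omega) rfl),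
    projOp_mul_birth hf (by omega), mul_assoc, ← mul_assoc (bundle A n (a + 2) l),
    bundle_mul_cableOp (isDiagram_death (by omega) rfl) (by dsimp only; omega),
    mul_assoc _ (bundle A n a l), bundle_mul_projOp hf (by omega), mul_assoc, ← mul_assoc _ _ (projOp A n a),
    cable_zigzag n h, wd_nil_mul_projOp, projOp_idem hf]

theorem colorOp_zigzag' (hf : IsJonesWenzl n (jonesWenzl A n)) {a l : ℕ} (h : l + 1 ≤ a) :
    colorOp A n a [birth (l + 1), death l] = projOp A n a := by
  rw [colorOp_pair (isDiagram_birth (by omega) rfl) (isDiagram_death (by omega) rfl),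
    mul_assoc _ (projOp A n (a + 2)), death_mul_projOp hf (by omega), mul_assoc,
    ← mul_assoc _ (bundle A n (a + 2) l),
    ← bundle_mul_cableOp (isDiagram_birth (by omega) rfl) (by dsimp only; omega),
    ← mul_assoc, ← mul_assoc, ← mul_assoc, projOp_mul_bundle hf (by omega),
    mul_assoc (projOp A n a) (cableOp A n a (a + 2) _), cable_zigzag' n h, projOp_mul_wd_nil,
    projOp_idem hf]

theorem colorOp_slideBirth (hf : IsJonesWenzl n (jonesWenzl A n)) (s : Bool) {a l : ℕ}
    (h : l + 1 ≤ a) :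
    colorOp A n a [birth l, cross s (l + 1)] = colorOp A n a [birth (l + 1), cross (!s) l] := by
  have h1 : IsDiagram a [birth l] (a + 2) := isDiagram_birth (by omega) rfl
  have h2 : IsDiagram a [birth (l + 1)] (a + 2) := isDiagram_birth (by omega) rfl
  have h3 : IsDiagram (a + 2) [cross s (l + 1)] (a + 2) := isDiagram_cross s (by omega)
  have h4 : IsDiagram (a + 2) [cross (!s) l] (a + 2) := isDiagram_cross (!s) (by omega)
  rw [colorOp_pair h1 h3, colorOp_pair h2 h4, mul_assoc _ (projOp A n (a + 2)),
    mul_assoc _ (projOp A n (a + 2)), cross_mul_projOp hf _ (by omega),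
    cross_mul_projOp hf _ (by omega), mul_assoc, mul_assoc, ← mul_assoc (cableOp A n _ _ (birth l)),
    ← mul_assoc (cableOp A n _ _ (birth (l + 1))), cableOp_mul_cableOp h1 h3,
    cableOp_mul_cableOp h2 h4]
  obtain ⟨c, rfl⟩ := Nat.exists_eq_add_of_le h
  have := ((Iso.cable_slideBirth (A := A) s n).place (n * l) (n * c) (N := n * (l + 1 + c))
    (N' := n * (l + 1 + c + 2)) (by ring) (by ring)).eq
  rw [List.map_append, List.map_append, nestedBirths_shift, nestedBirths_shift, crossGrid_shift,
    crossGrid_shift] at this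
  congr 2

theorem colorOp_slideDeath (hf : IsJonesWenzl n (jonesWenzl A n)) (s : Bool) {a l : ℕ}
    (h : l + 1 ≤ a) :
    colorOp A n (a + 2) [cross s l, death (l + 1)] =
      colorOp A n (a + 2) [cross (!s) (l + 1), death l] := by
  have h1 : IsDiagram (a + 2) [death l] a := isDiagram_death (by omega) rfl
  have h2 : IsDiagram (a + 2) [death (l + 1)] a := isDiagram_death (by omega) rfl
  have h3 : IsDiagram (a + 2) [cross (!s) (l + 1)] (a + 2) := isDiagram_cross (!s) (by omega)
  have h4 : IsDiagram (a + 2) [cross s l] (a + 2) := isDiagram_cross s (by omega)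
  rw [colorOp_pair h4 h2, colorOp_pair h3 h1, projOp_mul_cross hf _ (by omega),
    projOp_mul_cross hf _ (by omega), mul_assoc, mul_assoc, ← mul_assoc (cableOp A n _ _ (cross s l)),
    ← mul_assoc (cableOp A n _ _ (cross (!s) (l + 1))), cableOp_mul_cableOp h4 h2,
    cableOp_mul_cableOp h3 h1]
  obtain ⟨c, rfl⟩ := Nat.exists_eq_add_of_le h
  have := ((Iso.cable_slideDeath (A := A) s n).place (n * l) (n * c) (N' := n * (l + 1 + c))
    (N := n * (l + 1 + c + 2)) (by ring) (by ring)).eq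
  rw [List.map_append, List.map_append, nestedDeaths_shift, nestedDeaths_shift, crossGrid_shift,
    crossGrid_shift] at this
  congr 2

theorem colorOp_reidemeisterII (hf : IsJonesWenzl n (jonesWenzl A n)) (s : Bool) {a l : ℕ}
    (h : l + 2 ≤ a) : colorOp A n a [cross s l, cross (!s) l] = projOp A n a := by
  rw [colorOp_pair (isDiagram_cross s h) (isDiagram_cross (!s) h), projOp_mul_cross hf s h,
    mul_assoc, ← mul_assoc (cableOp A n a a _),
    cableOp_mul_cableOp (isDiagram_cross s h) (isDiagram_cross (!s) h)]
  obtain ⟨c, rfl⟩ := Nat.exists_eq_add_of_le h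
  have := ((Iso.crossGrid_inverse (A := A) s n n).place (n * l) (n * c) (N := n * (l + 2 + c))
    (N' := n * (l + 2 + c)) (by ring) (by ring)).eq
  rw [List.map_append, crossGrid_shift, crossGrid_shift] at this
  refine (congrArg (fun x => projOp A n _ * (x * projOp A n _)) this).trans ?_
  rw [List.map_nil, wd_nil_mul_projOp, projOp_idem hf]

theorem colorOp_crosses (hf : IsJonesWenzl n (jonesWenzl A n)) (s t u : Bool) {a i j k : ℕ}
    (hi : i + 2 ≤ a) (hj : j + 2 ≤ a) (hk : k + 2 ≤ a) :
    colorOp A n a [cross s i, cross t j, cross u k] = projOp A n a * wd A (n * a) (n * a)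
      ((cross s i).cable n ++ (cross t j).cable n ++ (cross u k).cable n) * projOp A n a := by
  rw [colorOp_cons (isDiagram_cross s hi), colorOp_pair (isDiagram_cross t hj)
    (isDiagram_cross u hk), projOp_mul_cross hf t hj,
    wd_append ((isDiagram_cable' n (isDiagram_cross s hi)).append
      (isDiagram_cable' n (isDiagram_cross t hj))),
    wd_append (isDiagram_cable' n (isDiagram_cross s hi))]
  simp only [← mul_assoc]
  rw [projOp_mul_cross hf s hi]
  rfl

theorem colorOp_reidemeisterIII (hf : IsJonesWenzl n (jonesWenzl A n)) (s t u : Bool)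
    (hs : t = s ∨ t = u) {a l : ℕ} (h : l + 3 ≤ a) :
    colorOp A n a [cross s l, cross t (l + 1), cross u l] =
      colorOp A n a [cross u (l + 1), cross t l, cross s (l + 1)] := by
  rw [colorOp_crosses hf s t u (by omega) (by omega) (by omega),
    colorOp_crosses hf u t s (by omega) (by omega) (by omega)]
  obtain ⟨c, rfl⟩ := Nat.exists_eq_add_of_le h
  have := ((Iso.cable_reidemeisterIII (A := A) s t u hs n).place (n * l) (n * c)
    (N := n * (l + 3 + c)) (N' := n * (l + 3 + c)) (by ring) (by ring)).eq
  simp only [List.map_append, crossGrid_shift] at this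
  congr 2

theorem colorOp_regularMove (hf : IsJonesWenzl n (jonesWenzl A n)) {X Y : List Slice}
    (h : RegularMove X Y) {a b : ℕ} (hX : IsDiagram a X b) (hY : IsDiagram a Y b) :
    colorOp A n a X = colorOp A n a Y := by
  cases h with
  | zigzag l =>
    obtain ⟨c, h1, h2⟩ := isDiagram_cons_iff.1 hX
    obtain rfl : a = b := hY
    rw [isDiagram_birth_iff] at h1; rw [isDiagram_death_iff] at h2
    exact colorOp_zigzag hf h2.1
  | zigzag' l =>
    obtain ⟨c, h1, h2⟩ := isDiagram_cons_iff.1 hX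
    rw [isDiagram_birth_iff] at h1
    exact colorOp_zigzag' hf h1.1
  | far p q l m => exact colorOp_far hf p q l m hX hY
  | slideBirth s l =>
    obtain ⟨c, h1, h2⟩ := isDiagram_cons_iff.1 hY
    rw [isDiagram_birth_iff] at h1
    exact colorOp_slideBirth hf s h1.1
  | slideDeath s l =>
    obtain ⟨c, h1, h2⟩ := isDiagram_cons_iff.1 hX
    rw [isDiagram_cross_iff] at h1; rw [isDiagram_death_iff] at h2
    obtain rfl : a = b + 2 := by omega
    exact colorOp_slideDeath hf s h2.1
  | reidemeisterII s l =>
    obtain ⟨c, h1, h2⟩ := isDiagram_cons_iff.1 hX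
    exact colorOp_reidemeisterII hf s (isDiagram_cross_iff.1 h1).1
  | reidemeisterIII s t u hs l =>
    obtain ⟨c, h1, h2⟩ := isDiagram_cons_iff.1 hY
    exact colorOp_reidemeisterIII hf s t u hs (isDiagram_cross_iff.1 h1).1

theorem pl_clusters (l c : ℕ) (f : Skein A n n) :
    pl l c (Skein.tensor f f) = pl l (n + c) f * pl (l + n) c f := pl_tensor l c f f

/-- Projectors for the two ends of the arc are split off from the row on the right. The scalar
relation `IsJonesWenzl.kink_birth`, placed among the other bundles, then applies. -/
theorem colorOp_reidemeisterI (hf : IsJonesWenzl n (jonesWenzl A n)) (s : Bool) (a l : ℕ)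
    (h : l ≤ a) : ∃ k : K, k ≠ 0 ∧
      colorOp A n a [birth l, cross s l] = k • colorOp A n a [birth l] := by
  obtain ⟨k, hk, e⟩ := hf.kink_birth s
  refine ⟨k, hk, ?_⟩
  have hb : IsDiagram a [birth l] (a + 2) := isDiagram_birth h rfl
  have hx : IsDiagram (a + 2) [cross s l] (a + 2) := isDiagram_cross s (by omega)
  have hb' : IsDiagram 0 (nestedBirths n 0) (n + n) := isDiagram_nestedBirths' le_rfl (by ring)
  have hg := isDiagram_crossGrid s n n 0 (n + n) (by omega)
  rw [colorOp_pair hb hx, colorOp_singleton hb, mul_assoc _ (projOp A n (a + 2)),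
    cross_mul_projOp hf s (by omega), mul_assoc, mul_assoc, ← mul_assoc (cableOp A n _ _ (birth l)),
    cableOp_mul_cableOp hb hx, ← bundle_mul_projOp hf (show l < a + 2 by omega),
    ← bundle_mul_projOp hf (show l + 1 < a + 2 by omega)]
  simp only [← mul_assoc]
  rw [← smul_mul_assoc]
  congr 1
  simp only [mul_assoc]
  rw [← mul_smul_comm]
  congr 1
  rw [wd_eq (hb'.append hg), wd_eq hb', ← emb_tensor_self, ← emb_comp, ← emb_comp, ← map_smul,
    emb_inj] at e
  obtain ⟨c, rfl⟩ := Nat.exists_eq_add_of_le h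
  have := congrArg (pl (n * l) (n * c)) e
  rw [map_smul, pl_comp, pl_comp, pl_of, pl_of, pl_clusters] at this
  rw [bundle_eq (i := l) (c := 1 + c) (by ring), bundle_eq (i := l + 1) (c := c) (by ring)]
  rw [List.map_append, nestedBirths_shift, crossGrid_shift] at this
  rw [cableOp, show n * (l + c) = n * l + (0 + n * c) by ring,
    show n * (l + c + 2) = n * l + (n + n + n * c) by ring,
    show n * (1 + c) = n + n * c by ring, show n * (l + 1) = n * l + n by ring]
  exact this

theorem colorOp_reidemeisterI' (hf : IsJonesWenzl n (jonesWenzl A n)) (s : Bool) (a l : ℕ)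
    (h : l ≤ a) : ∃ k : K, k ≠ 0 ∧
      colorOp A n (a + 2) [cross s l, death l] = k • colorOp A n (a + 2) [death l] := by
  obtain ⟨k, hk, e⟩ := hf.kink_death s
  refine ⟨k, hk, ?_⟩
  have hb : IsDiagram (a + 2) [death l] a := isDiagram_death h rfl
  have hx : IsDiagram (a + 2) [cross s l] (a + 2) := isDiagram_cross s (by omega)
  have hb' : IsDiagram (n + n) (nestedDeaths n 0) 0 := isDiagram_nestedDeaths' le_rfl (by ring)
  have hg := isDiagram_crossGrid s n n 0 (n + n) (by omega)
  rw [colorOp_pair hx hb, colorOp_singleton hb, projOp_mul_cross hf s (by omega),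
    mul_assoc, ← mul_assoc (cableOp A n _ _ (cross s l)),
    cableOp_mul_cableOp hx hb, ← projOp_mul_bundle hf (show l + 1 < a + 2 by omega),
    ← projOp_mul_bundle hf (show l < a + 2 by omega)]
  simp only [← mul_assoc]
  rw [← smul_mul_assoc]
  congr 1
  simp only [mul_assoc]
  rw [← mul_smul_comm]
  congr 1
  rw [wd_eq (hg.append hb'), wd_eq hb', ← emb_tensor_self, ← emb_comp, ← emb_comp, ← map_smul,
    emb_inj] at e
  obtain ⟨c, rfl⟩ := Nat.exists_eq_add_of_le h
  have := congrArg (pl (n * l) (n * c)) e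
  rw [map_smul, pl_comp, pl_comp, pl_of, pl_of, pl_clusters] at this
  rw [bundle_eq (i := l) (c := 1 + c) (by ring), bundle_eq (i := l + 1) (c := c) (by ring)]
  rw [List.map_append, nestedDeaths_shift, crossGrid_shift] at this
  rw [cableOp, show n * (l + c) = n * l + (0 + n * c) by ring,
    show n * (l + c + 2) = n * l + (n + n + n * c) by ring,
    show n * (1 + c) = n + n * c by ring, show n * (l + 1) = n * l + n by ring]
  rw [mul_assoc, mul_assoc] at this
  exact this

theorem colorOp_ambientMove (hf : IsJonesWenzl n (jonesWenzl A n)) {X Y : List Slice}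
    (h : AmbientMove X Y) {a b : ℕ} (hX : IsDiagram a X b) (hY : IsDiagram a Y b) :
    ∃ k : K, k ≠ 0 ∧ colorOp A n a X = k • colorOp A n a Y := by
  cases h with
  | regular h => exact ⟨1, one_ne_zero, by rw [one_smul, colorOp_regularMove hf h hX hY]⟩
  | reidemeisterI s l => exact colorOp_reidemeisterI hf s a l (isDiagram_birth_iff.1 hY).1
  | reidemeisterI' s l =>
    obtain ⟨h1, rfl⟩ := isDiagram_death_iff.1 hY
    exact colorOp_reidemeisterI' hf s b l h1

/-- Ambient isotopic tangles have proportional colorings. -/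
theorem AmbientIsotopic.colored (hf : IsJonesWenzl n (jonesWenzl A n)) {a b : ℕ}
    {T T' : Diagram a b} (h : AmbientIsotopic T T') :
    ∃ k : K, k ≠ 0 ∧ colored A n T = k • colored A n T' := by
  induction h with
  | rel T T' h =>
    obtain ⟨U, V, X, Y, h, hT, hT'⟩ := h
    have h1 := T.isDiagram
    have h2 := T'.isDiagram
    rw [hT, List.append_assoc] at h1
    rw [hT', List.append_assoc] at h2
    obtain ⟨p, hU, h3⟩ := isDiagram_append_iff.1 h1
    obtain ⟨p', hU', h4⟩ := isDiagram_append_iff.1 h2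
    obtain rfl := hU.unique hU'
    obtain ⟨q, hX, hV⟩ := isDiagram_append_iff.1 h3
    obtain ⟨q', hY, hV'⟩ := isDiagram_append_iff.1 h4
    obtain rfl : q = q' := by
      -- A fitting slice changes the number of strands by a fixed amount, so a word and the number
      -- of strands on its right determine the number on its left.
      have key : ∀ {V : List Slice} {q q' b : ℕ}, IsDiagram q V b → IsDiagram q' V b → q = q' := by
        intro V
        induction V with
        | nil => intro q q' b h h'; exact Eq.trans (b := b) h h'.symm
        | cons x V ih =>
          intro q q' b h h'
          have := ih h.2 h'.2
          have k1 := h.1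
          have k2 := h'.1
          simp only [Slice.Fits, Slice.next] at *
          omega
      exact key hV hV'
    obtain ⟨k, hk, e⟩ := colorOp_ambientMove hf h hX hY
    refine ⟨k, hk, emb_injective ?_⟩
    rw [map_smul, ColoredTangle.colored, ColoredTangle.colored, emb_colorWord, emb_colorWord,
      hT, hT', List.append_assoc, List.append_assoc, colorOp_append hf hU, colorOp_append hf hX,
      colorOp_append hf hU, colorOp_append hf hY, e, smul_mul_assoc, mul_smul_comm]
  | refl T => exact ⟨1, one_ne_zero, (one_smul _ _).symm⟩
  | symm T T' _ ih =>
    obtain ⟨k, hk, e⟩ := ih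
    exact ⟨k⁻¹, inv_ne_zero hk, by rw [e, inv_smul_smul₀ hk]⟩
  | trans T T' T'' _ _ ih ih' =>
    obtain ⟨k, hk, e⟩ := ih
    obtain ⟨k', hk', e'⟩ := ih'
    exact ⟨k * k', mul_ne_zero hk hk', by rw [e, e', smul_smul]⟩

end Projectors

/-! ## The basis elements span -/

/-- The element of two clusters on the left and two on the right with `2 * j` horizontal strands. -/
def arcOp (n : ℕ) (f : Skein A n n) (j : ℕ) : Op A :=
  clusters n f * wd A (n + n) (2 * j) (nestedDeaths (n - j) j) *
    (wd A (2 * j) (n + n) (nestedBirths (n - j) j) * clusters n f)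

theorem projOp_two (n : ℕ) : projOp A n 2 = clusters n (jonesWenzl A n) := by
  rw [projOp_eq, ← IsJonesWenzl.wd_nil_mul_clusters]
  have h0 : bundle A n 2 0 = pl 0 n (jonesWenzl A n) := by
    simpa using bundle_eq (A := A) (n := n) (a := 2) (i := 0) (c := 1) rfl
  have h1 : bundle A n 2 1 = pl n 0 (jonesWenzl A n) := by
    simpa using bundle_eq (A := A) (n := n) (a := 2) (i := 1) (c := 0) rfl
  have h2 : (List.range 2).map (bundle A n 2) = [bundle A n 2 0, bundle A n 2 1] := rfl
  rw [h2, h0, h1, Nat.mul_two, clusters]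
  simp

namespace IsJonesWenzl

variable {n : ℕ} {f : Skein A n n}

/-- A system of arcs between the clusters vanishes or is one of the standard ones. -/
theorem normal_mul_clusters (hf : IsJonesWenzl n f) {c : ℕ} {L M : List ℕ}
    (hL : IsDiagram (n + n) (L.map death) c) (hM : IsDiagram c (M.map birth) (n + n)) :
    clusters n f * wd A (n + n) c (L.map death) * (wd A c (n + n) (M.map birth) * clusters n f) = 0
      ∨ clusters n f * wd A (n + n) c (L.map death) *
        (wd A c (n + n) (M.map birth) * clusters n f) = arcOp n f (n - L.length) := by
  have h1 := IsDiagram.length_deaths hL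
  have h2 := IsDiagram.length_births hM
  rcases hf.clusters_mul_deaths hL with h | h
  · left; rw [h, zero_mul]
  rcases hf.births_mul_clusters hM with h' | h'
  · left; rw [h', mul_zero]
  right
  rw [h, h', arcOp, show M.length = L.length by omega, show c = 2 * (n - L.length) by omega,
    show n - (n - L.length) = L.length by omega]

theorem exists_nestedDeaths_eq (k l : ℕ) : ∃ L : List ℕ, L.length = k ∧
    nestedDeaths k l = L.map death :=
  ⟨((List.range k).map (l + ·)).reverse, by simp, by simp [nestedDeaths, Function.comp_def]⟩

theorem exists_nestedBirths_eq (k l : ℕ) : ∃ L : List ℕ, L.length = k ∧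
    nestedBirths k l = L.map birth :=
  ⟨(List.range k).map (l + ·), by simp, by simp [nestedBirths, Function.comp_def]⟩

/-- The element with a projector on the middle edge agrees with the one without up to elements with
fewer horizontal strands. -/
theorem middle_sub_arcOp_mem (hf : IsJonesWenzl n f) {j : ℕ} (hj : j ≤ n)
    {g : Skein A (2 * j) (2 * j)} (hg : IsJonesWenzl (2 * j) g) :
    clusters n f * wd A (n + n) (2 * j) (nestedDeaths (n - j) j) * emb g *
        (wd A (2 * j) (n + n) (nestedBirths (n - j) j) * clusters n f) - arcOp n f j ∈
      Submodule.span K (arcOp n f '' {i | i < j}) := by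
  set U := clusters n f * wd A (n + n) (2 * j) (nestedDeaths (n - j) j) with hU
  set V := wd A (2 * j) (n + n) (nestedBirths (n - j) j) * clusters n f with hV
  have key : ∀ x ∈ hookSpan A (2 * j),
      U * emb x * V ∈ Submodule.span K (arcOp n f '' {i | i < j}) := by
    intro x hx
    induction hx using Submodule.span_induction with
    | zero => simp
    | add x y _ _ hx hy => rw [map_add, mul_add, add_mul]; exact add_mem hx hy
    | smul k x _ hx =>
      rw [map_smul, mul_smul_comm, smul_mul_assoc]; exact Submodule.smul_mem _ _ hx
    | mem x hx =>
      obtain ⟨D, i, i', L, M, hD, rfl⟩ := hx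
      have hd := D.isDiagram
      rw [← wd_word]
      rw [hD] at hd ⊢
      obtain ⟨c, h1, h2⟩ := isDiagram_append_iff.1 hd
      obtain ⟨L', hL', eL⟩ := exists_nestedDeaths_eq (n - j) j
      obtain ⟨M', hM', eM⟩ := exists_nestedBirths_eq (n - j) j
      have dL : IsDiagram (n + n) (nestedDeaths (n - j) j) (2 * j) :=
        isDiagram_nestedDeaths' (by omega) (by omega)
      have dM : IsDiagram (2 * j) (nestedBirths (n - j) j) (n + n) :=
        isDiagram_nestedBirths' (by omega) (by omega)
      have e1 : nestedDeaths (n - j) j ++ death i :: L.map death = (L' ++ i :: L).map death := by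
        rw [eL]; simp
      have e2 : (M.map birth ++ [birth i']) ++ nestedBirths (n - j) j =
          (M ++ [i'] ++ M').map birth := by
        rw [eM]; simp
      have h3 := dL.append h1
      have h4 := h2.append dM
      have e : U * wd A (2 * j) (2 * j) (death i :: L.map death ++ (M.map birth ++ [birth i'])) * V =
          clusters n f * wd A (n + n) c ((L' ++ i :: L).map death) *
            (wd A c (n + n) ((M ++ [i'] ++ M').map birth) * clusters n f) := by
        rw [wd_append h1, ← e1, ← e2, wd_append dL, wd_append h2]
        simp only [hU, hV, mul_assoc]
      rw [e]
      rw [e1] at h3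
      rw [e2] at h4
      have hlen := IsDiagram.length_deaths h3
      -- The hook adds at least one arc to the `n - j` arcs of the vertex, so the index of the
      -- surviving system is below `j`.
      rcases hf.normal_mul_clusters h3 h4 with h | h
      · rw [h]; exact zero_mem _
      · rw [h]
        refine Submodule.subset_span ⟨_, ?_, rfl⟩
        simp only [Set.mem_ofPred_eq, List.length_append, List.length_cons, hL'] at hlen ⊢
        omega
  have := key _ hg.sub_one_mem
  rwa [map_sub, mul_sub, sub_mul, emb_one, hU, mul_assoc _ _ (wd A (2 * j) (2 * j) []),
    wd_mul_wd_nil] at this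

end IsJonesWenzl

theorem emb_basisElement (n : ℕ) (i : Fin (n + 1)) : emb (basisElement A n i) =
    clusters n (jonesWenzl A n) * wd A (n + n) (2 * i) (nestedDeaths (n - i) i) *
      emb (jonesWenzl A (2 * i)) *
      (wd A (2 * i) (n + n) (nestedBirths (n - i) i) * clusters n (jonesWenzl A n)) := by
  have hP : emb (projectors A n 2) = clusters n (jonesWenzl A n) := projOp_two n
  rw [basisElement, emb_comp, emb_comp, emb_comp, emb_comp, hP, ← wd_word, ← wd_word, mul_assoc]
  simp only [mergeDiagram, splitDiagram]
  rw [Nat.mul_two]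

theorem basisElement_mem_coloredTL (n : ℕ) (i : Fin (n + 1)) :
    basisElement A n i ∈ coloredTL A n := by
  refine Submodule.subset_span ⟨Skein.comp (Skein.comp (Skein.of A (mergeDiagram n i))
    (jonesWenzl A (2 * (i : ℕ)))) (Skein.of A (splitDiagram n i)), ?_⟩
  simp only [basisElement, Skein.comp_assoc]

section

variable {n : ℕ}

/-- `IsJonesWenzl.middle_sub_arcOp_mem` is a unitriangular relation in the number of horizontal
strands; strong induction inverts it. -/
theorem arcOp_mem_span (hf : ∀ m ≤ 2 * n, IsJonesWenzl m (jonesWenzl A m)) {j : ℕ} (hj : j ≤ n) :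
    arcOp n (jonesWenzl A n) j ∈
      (Submodule.span K (Set.range (basisElement A n))).map (emb : _ →ₗ[K] Op A) := by
  induction j using Nat.strong_induction_on with
  | _ j ih =>
    have h1 := (hf n (by omega)).middle_sub_arcOp_mem hj (hf (2 * j) (by omega))
    have h2 : Submodule.span K (arcOp n (jonesWenzl A n) '' {i | i < j}) ≤
        (Submodule.span K (Set.range (basisElement A n))).map (emb : _ →ₗ[K] Op A) := by
      rw [Submodule.span_le]
      rintro _ ⟨i, hi, rfl⟩
      exact ih i hi (le_trans (le_of_lt hi) hj)
    have h3 := emb_basisElement (A := A) n ⟨j, by omega⟩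
    have h4 : emb (basisElement A n ⟨j, by omega⟩) ∈
        (Submodule.span K (Set.range (basisElement A n))).map (emb : _ →ₗ[K] Op A) :=
      Submodule.mem_map_of_mem (Submodule.subset_span ⟨_, rfl⟩)
    have h5 := sub_mem h4 (h2 h1)
    rw [h3] at h5
    simpa only [sub_sub_cancel] using h5

/-- Between the outer projectors a normal form is zero or one of the elements `arcOp`, and these are
already in the span. -/
theorem span_basisElement (hf : ∀ m ≤ 2 * n, IsJonesWenzl m (jonesWenzl A m)) :
    Submodule.span K (Set.range (basisElement A n)) = coloredTL A n := by
  refine le_antisymm (Submodule.span_le.2 ?_) (Submodule.span_le.2 ?_)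
  · rintro _ ⟨i, rfl⟩
    exact basisElement_mem_coloredTL n i
  · rintro _ ⟨x, rfl⟩
    have key : emb (Skein.comp (Skein.comp (projectors A n 2) x) (projectors A n 2)) ∈
        (Submodule.span K (Set.range (basisElement A n))).map (emb : _ →ₗ[K] Op A) := by
      have hP : emb (projectors A n 2) = clusters n (jonesWenzl A n) := projOp_two n
      rw [emb_comp, emb_comp, hP]
      have hx := x.mem_span_normal
      induction hx using Submodule.span_induction with
      | zero => simp
      | add x y _ _ hx hy => rw [map_add, mul_add, add_mul]; exact add_mem hx hy
      | smul k x _ hx =>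
        rw [map_smul, mul_smul_comm, smul_mul_assoc]; exact Submodule.smul_mem _ _ hx
      | mem x hx =>
        obtain ⟨D, L, M, hD, rfl⟩ := hx
        have hd := D.isDiagram
        rw [← wd_word]
        rw [hD] at hd ⊢
        have h2n : ∀ w, wd A (n * 2) (n * 2) w = wd A (n + n) (n + n) w := by
          intro w; rw [Nat.mul_two]
        rw [h2n]
        rw [Nat.mul_two] at hd
        obtain ⟨c, h1, h2⟩ := isDiagram_append_iff.1 hd
        rw [wd_append h1, ← mul_assoc, mul_assoc (_ * _)]
        rcases (hf n (by omega)).normal_mul_clusters h1 h2 with h | h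
        · rw [h]; exact zero_mem _
        · rw [h]; exact arcOp_mem_span hf (Nat.sub_le _ _)
    obtain ⟨y, hy, e⟩ := key
    rw [emb_inj] at e
    exact e ▸ hy

/-- A coloring begins and ends with a row of projectors, so by idempotence it is itself the element
to be placed between them. -/
theorem colored_mem_coloredTL (hf : IsJonesWenzl n (jonesWenzl A n)) (T : TwoTangle) :
    colored A n T ∈ coloredTL A n := by
  refine Submodule.subset_span ⟨colored A n T, emb_injective ?_⟩
  have h := projOp_mul_colorOp hf 2 T.word
  have h' : colorOp A n 2 T.word * projOp A n 2 = colorOp A n 2 T.word := by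
    have := colorOp_append hf T.isDiagram []
    rw [List.append_nil] at this
    exact this.symm
  rw [emb_comp, emb_comp, colored, emb_colorWord]
  exact (congrArg (· * projOp A n 2) h ▸ h').symm

end

/-! ## Linear independence of the basis elements -/

/-- Restrict a function to the states whose first `n` strands have state `true`. -/
def restrictTops : ℕ → ((ℕ → Bool) → K) →ₗ[K] ((ℕ → Bool) → K)
  | 0 => LinearMap.id
  | n + 1 => restrictTops n ∘ₗ restrictTop true

theorem restrictTops_succ' (n : ℕ) (g : (ℕ → Bool) → K) :
    restrictTops (n + 1) g = restrictTop true (restrictTops n g) := by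
  induction n generalizing g with
  | zero => rfl
  | succ n ih => exact ih (restrictTop true g)

theorem restrictTops_liftOps (n : ℕ) (T : StateOp K) (g : (ℕ → Bool) → K) :
    restrictTops n (liftOps n T g) = T (restrictTops n g) := by
  induction n generalizing g with
  | zero => rfl
  | succ n ih => exact ih (restrictTop true g)

theorem restrictTop_restrictTop_deathOp (b c : Bool) (g : (ℕ → Bool) → K) :
    restrictTop c (restrictTop b (deathOp A g)) = capWeight A b c • g := by
  funext s; rfl

theorem restrictTops_deathOp {n i : ℕ} (h : i + 2 ≤ n) (g : (ℕ → Bool) → K) :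
    restrictTops n (liftOps i (deathOp A) g) = 0 := by
  induction i generalizing n g with
  | zero =>
    obtain ⟨m, rfl⟩ := Nat.exists_eq_add_of_le' h
    show restrictTops m (restrictTop true (restrictTop true (deathOp A g))) = 0
    rw [restrictTop_restrictTop_deathOp, show capWeight A true true = 0 from rfl, zero_smul, map_zero]
  | succ i ih =>
    obtain ⟨m, rfl⟩ := Nat.exists_eq_add_of_le' (show 1 ≤ n by omega)
    exact ih (by omega) (restrictTop true g)

theorem restrictTops_apply_true (n : ℕ) (g : (ℕ → Bool) → K) :
    restrictTops n g (fun _ => true) = g fun _ => true := by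
  induction n generalizing g with
  | zero => rfl
  | succ n ih =>
    refine (ih (restrictTop true g)).trans (congrArg g ?_)
    funext k; cases k <;> rfl

/-- A functional of weight `k` on the states of a bundle of `n` strands which kills all hooks. -/
def clusterForm (A : K) : ℕ → ℕ → ((ℕ → Bool) → K) →ₗ[K] K
  | 0, 0 => LinearMap.proj fun _ => true
  | 0, _ + 1 => 0
  | n + 1, 0 => clusterForm A n 0 ∘ₗ restrictTop true
  | n + 1, k + 1 => A ^ (2 * (k + 1)) • clusterForm A n (k + 1) ∘ₗ restrictTop true +
      clusterForm A n k ∘ₗ restrictTop false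

theorem clusterForm_succ_zero (n : ℕ) (g : (ℕ → Bool) → K) :
    clusterForm A (n + 1) 0 g = clusterForm A n 0 (restrictTop true g) := rfl

theorem clusterForm_succ_succ (n k : ℕ) (g : (ℕ → Bool) → K) :
    clusterForm A (n + 1) (k + 1) g = A ^ (2 * (k + 1)) * clusterForm A n (k + 1) (restrictTop true g) +
      clusterForm A n k (restrictTop false g) := rfl

theorem clusterForm_zero (n : ℕ) (g : (ℕ → Bool) → K) :
    clusterForm A n 0 g = g fun _ => true := by
  induction n generalizing g with
  | zero => rfl
  | succ n ih =>
    refine (ih (restrictTop true g)).trans (congrArg g ?_)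
    funext k; cases k <;> rfl

/-- The index `k` counts the states `false`. On two neighbouring strands the order `true, false` has
`A²` times the coefficient of `false, true`, which cancels against the weights `-A⁻²` and `1` of an
arc `⊃`. -/
theorem clusterForm_deathOp (hA : A ≠ 0) {n i : ℕ} (h : i + 2 ≤ n) (k : ℕ) (g : (ℕ → Bool) → K) :
    clusterForm A n k (liftOps i (deathOp A) g) = 0 := by
  induction i generalizing n k g with
  | zero =>
    obtain ⟨m, rfl⟩ := Nat.exists_eq_add_of_le' h
    rw [liftOps_zero]
    rcases k with _ | _ | k <;>
      simp only [clusterForm_succ_zero, clusterForm_succ_succ, restrictTop_restrictTop_deathOp,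
        capWeight, zero_smul, map_zero, map_smul, smul_eq_mul, one_mul, mul_zero, zero_add, add_zero]
    · field_simp; ring
    · field_simp; ring
  | succ i ih =>
    obtain ⟨m, rfl⟩ := Nat.exists_eq_add_of_le' (show 1 ≤ n by omega)
    rw [liftOps_succ]
    rcases k with _ | k <;>
      simp only [clusterForm_succ_zero, clusterForm_succ_succ, restrictTop_liftOp,
        ih (show i + 2 ≤ m by omega), mul_zero, add_zero]

/-- The upper end of the arc has state `true`, so its lower end must be `false`: an arc from the
upper cluster uses up one unit of the weight. -/
theorem clusterForm_restrictTop_deathOp (n k : ℕ) (g : (ℕ → Bool) → K) :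
    clusterForm A (n + 1) (k + 1) (restrictTop true (deathOp A g)) =
      -A⁻¹ ^ 2 * clusterForm A n k g := by
  simp only [clusterForm_succ_succ, restrictTop_restrictTop_deathOp, capWeight, zero_smul, map_zero,
    map_smul, smul_eq_mul, mul_zero, zero_add]

theorem clusterForm_restrictTop_deathOp_zero (n : ℕ) (g : (ℕ → Bool) → K) :
    clusterForm A (n + 1) 0 (restrictTop true (deathOp A g)) = 0 := by
  simp only [clusterForm_succ_zero, restrictTop_restrictTop_deathOp, capWeight, zero_smul, map_zero]

theorem wordOp_death (l : ℕ) : wordOp A [death l] = liftOps l (deathOp A) := by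
  simp [wordOp, sliceOp, pieceOp]

theorem wordOp_birth (l : ℕ) : wordOp A [birth l] = liftOps l (birthOp A) := by
  simp [wordOp, sliceOp, pieceOp]

theorem restrictTops_nestedDeaths_succ (p l : ℕ) (g : (ℕ → Bool) → K) :
    restrictTops (l + p + 1) (wordOp A (nestedDeaths (p + 1) l) g) =
      restrictTop true (deathOp A (restrictTops (l + p) (wordOp A (nestedDeaths p l) g))) := by
  rw [nestedDeaths_succ, ← List.singleton_append, wordOp_append, Module.End.mul_apply, wordOp_death,
    restrictTops_succ', restrictTops_liftOps]

/-- The `p` arcs from an upper cluster in state `true` force `p` states `false` in the lower one,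
more than weight `k` allows. -/
theorem clusterForm_nestedDeaths_of_lt {p k : ℕ} (h : k < p) (l : ℕ) (g : (ℕ → Bool) → K) :
    clusterForm A (l + p) k (restrictTops (l + p) (wordOp A (nestedDeaths p l) g)) = 0 := by
  induction p generalizing k with
  | zero => omega
  | succ p ih =>
    rw [← Nat.add_assoc, restrictTops_nestedDeaths_succ]
    rcases k with _ | k
    · rw [clusterForm_restrictTop_deathOp_zero]
    · rw [clusterForm_restrictTop_deathOp, ih (by omega), mul_zero]

theorem clusterForm_nestedDeaths_self (p l : ℕ) (g : (ℕ → Bool) → K) :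
    clusterForm A (l + p) p (restrictTops (l + p) (wordOp A (nestedDeaths p l) g)) =
      (-A⁻¹ ^ 2) ^ p * g fun _ => true := by
  induction p with
  | zero =>
    rw [Nat.add_zero, clusterForm_zero, restrictTops_apply_true, pow_zero, one_mul]; rfl
  | succ p ih =>
    rw [← Nat.add_assoc, restrictTops_nestedDeaths_succ, clusterForm_restrictTop_deathOp, ih]; ring

/-- A function of weight `k` of the states of a bundle of `n` strands which is killed by all hooks. -/
def clusterVector (A : K) : ℕ → ℕ → (ℕ → Bool) → K
  | 0, 0, _ => 1
  | 0, _ + 1, _ => 0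
  | n + 1, 0, s => if s 0 then clusterVector A n 0 (tailState s) else 0
  | n + 1, k + 1, s => if s 0 then A ^ (2 * (k + 1)) * clusterVector A n (k + 1) (tailState s)
      else clusterVector A n k (tailState s)

theorem restrictTop_clusterVector_true (n k : ℕ) :
    restrictTop true (clusterVector A (n + 1) k) = A ^ (2 * k) • clusterVector A n k := by
  funext s
  cases k <;> simp [clusterVector]

theorem restrictTop_clusterVector_false_zero (n : ℕ) :
    restrictTop false (clusterVector A (n + 1) 0) = 0 := by
  funext s
  simp [clusterVector]

theorem restrictTop_clusterVector_false (n k : ℕ) :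
    restrictTop false (clusterVector A (n + 1) (k + 1)) = clusterVector A n k := by
  funext s
  simp [clusterVector]

theorem birthOp_eq (g : (ℕ → Bool) → K) : birthOp A g = restrictTop false (restrictTop true g) -
    A ^ 2 • restrictTop true (restrictTop false g) := by
  funext s; simp [birthOp_apply]

theorem ext_restrictTop {g h : (ℕ → Bool) → K} (e : ∀ b, restrictTop b g = restrictTop b h) :
    g = h := by
  funext s
  have := congrFun (e (s 0)) (tailState s)
  simpa using this

/-- Dual to `clusterForm_deathOp`: interchanging neighbouring states changes the value by the factor
`A²`, and the weights `1` and `-A²` of an arc `⊂` cancel. -/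
theorem birthOp_clusterVector {n i : ℕ} (h : i + 2 ≤ n) (k : ℕ) :
    liftOps i (birthOp A) (clusterVector A n k) = 0 := by
  induction i generalizing n k with
  | zero =>
    obtain ⟨m, rfl⟩ := Nat.exists_eq_add_of_le' h
    rw [liftOps_zero, birthOp_eq, restrictTop_clusterVector_true, map_smul]
    rcases k with _ | k
    · rw [restrictTop_clusterVector_false_zero, restrictTop_clusterVector_false_zero]; simp
    · rw [restrictTop_clusterVector_false, restrictTop_clusterVector_false,
        restrictTop_clusterVector_true, smul_smul, ← pow_add, sub_eq_zero]
      congr 2; ring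
  | succ i ih =>
    obtain ⟨m, rfl⟩ := Nat.exists_eq_add_of_le' (show 1 ≤ n by omega)
    refine ext_restrictTop fun b => ?_
    rw [liftOps_succ, restrictTop_liftOp, map_zero]
    rcases b with _ | _
    · rcases k with _ | k
      · rw [restrictTop_clusterVector_false_zero, map_zero]
      · rw [restrictTop_clusterVector_false, ih (by omega)]
    · rw [restrictTop_clusterVector_true, map_smul, ih (by omega), smul_zero]

/-- Extend a function of states by `n` strands on top, all of which have state `true`. -/
def extendTops : ℕ → ((ℕ → Bool) → K) → (ℕ → Bool) → K
  | 0, g => g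
  | n + 1, g => fun s => if s 0 then extendTops n g (tailState s) else 0

@[simp] theorem restrictTop_extendTops_true (n : ℕ) (g : (ℕ → Bool) → K) :
    restrictTop true (extendTops (n + 1) g) = extendTops n g := by
  funext s; simp [extendTops]

@[simp] theorem restrictTop_extendTops_false (n : ℕ) (g : (ℕ → Bool) → K) :
    restrictTop false (extendTops (n + 1) g) = 0 := by
  funext s; simp [extendTops]

theorem extendTops_succ' (n : ℕ) (g : (ℕ → Bool) → K) :
    extendTops (n + 1) g = extendTops n (extendTops 1 g) := by
  induction n with
  | zero => rfl
  | succ n ih =>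
    refine ext_restrictTop fun b => ?_
    cases b <;> simp [ih]

theorem liftOps_extendTops (n : ℕ) (T : StateOp K) (g : (ℕ → Bool) → K) :
    liftOps n T (extendTops n g) = extendTops n (T g) := by
  induction n with
  | zero => rfl
  | succ n ih =>
    refine ext_restrictTop fun b => ?_
    cases b <;> simp [liftOps_succ, ih]

theorem birthOp_extendTops {n i : ℕ} (h : i + 2 ≤ n) (g : (ℕ → Bool) → K) :
    liftOps i (birthOp A) (extendTops n g) = 0 := by
  induction i generalizing n with
  | zero =>
    obtain ⟨m, rfl⟩ := Nat.exists_eq_add_of_le' h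
    rw [liftOps_zero, birthOp_eq]
    simp
  | succ i ih =>
    obtain ⟨m, rfl⟩ := Nat.exists_eq_add_of_le' (show 1 ≤ n by omega)
    refine ext_restrictTop fun b => ?_
    cases b <;> simp [liftOps_succ, ih (show i + 2 ≤ m by omega)]

theorem birthOp_extendTops_one (g : (ℕ → Bool) → K) :
    birthOp A (extendTops 1 g) = restrictTop false g := by
  rw [birthOp_eq, show (1 : ℕ) = 0 + 1 from rfl, restrictTop_extendTops_true,
    restrictTop_extendTops_false, map_zero, smul_zero, sub_zero]
  rfl

theorem extendTops_apply_true (n : ℕ) (g : (ℕ → Bool) → K) :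
    extendTops n g (fun _ => true) = g fun _ => true := by
  induction n with
  | zero => rfl
  | succ n ih => exact ih

theorem clusterVector_zero_apply_true (n : ℕ) : clusterVector A n 0 (fun _ => true) = 1 := by
  induction n with
  | zero => rfl
  | succ n ih => exact ih

/-- Every arc has its upper end in state `true`, hence selects `false` at its lower end, with
coefficient `1`, and lowers the weight by one. After `p` arcs the weight is zero. -/
theorem nestedBirths_extendTops (p l : ℕ) :
    wordOp A (nestedBirths p l) (extendTops (l + p) (clusterVector A (l + p) p))
      (fun _ => true) = 1 := by
  induction p with
  | zero =>
    exact (extendTops_apply_true _ _).trans (clusterVector_zero_apply_true _)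
  | succ p ih =>
    rw [nestedBirths_succ, wordOp_append, Module.End.mul_apply, wordOp_birth, ← Nat.add_assoc,
      extendTops_succ', liftOps_extendTops, birthOp_extendTops_one, restrictTop_clusterVector_false]
    exact ih

/-- The functional which detects the coefficient of a basis element. -/
def detect (hA : A ≠ 0) (n k : ℕ) : Skein A (n * 2) (n * 2) →ₗ[K] K where
  toFun x := clusterForm A n k (restrictTops n
    (stateRep hA x (extendTops n (clusterVector A n k))))
  map_add' x y := by simp
  map_smul' c x := by simp

theorem stateRep_projectors_two (hA : A ≠ 0) (n : ℕ) : stateRep hA (projectors A n 2) =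
    stateRep hA (jonesWenzl A n) * liftOps n (stateRep hA (jonesWenzl A n)) := by
  have h0 : stateRep hA (projectors A n 0) = 1 := stateRep_of hA _
  have h1 : stateRep hA (projectors A n 1) = stateRep hA (jonesWenzl A n) :=
    (stateRep_tensor hA _ _).trans (by rw [h0, one_mul]; rfl)
  exact (stateRep_tensor hA _ _).trans (by rw [h1, show n.mul 1 = n from Nat.mul_one n])

/-- The outer projectors drop out, since both the functional and the test vector are killed by the
hooks of each cluster: the upper one is constantly `true`, the lower one is symmetrized in weight
`k`. -/
theorem detect_basisElement (hA : A ≠ 0) {n : ℕ} (hf : IsJonesWenzl n (jonesWenzl A n)) (k : ℕ)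
    (j : Fin (n + 1)) : detect hA n k (basisElement A n j) =
      clusterForm A n k (restrictTops n (wordOp A (nestedDeaths (n - j) j)
        (stateRep hA (jonesWenzl A (2 * j)) (wordOp A (nestedBirths (n - j) j)
          (extendTops n (clusterVector A n k)))))) := by
  have hr : stateRep hA (projectors A n 2) (extendTops n (clusterVector A n k)) =
      extendTops n (clusterVector A n k) := by
    rw [stateRep_projectors_two, Module.End.mul_apply, liftOps_extendTops,
      hf.stateRep_apply hA _ fun i hi => birthOp_clusterVector hi k,
      hf.stateRep_apply hA _ fun i hi => birthOp_extendTops hi _]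
  have hl : ∀ g, clusterForm A n k (restrictTops n (stateRep hA (projectors A n 2) g)) =
      clusterForm A n k (restrictTops n g) := by
    intro g
    rw [stateRep_projectors_two, Module.End.mul_apply]
    refine (hf.functional_stateRep hA (clusterForm A n k ∘ₗ restrictTops n)
      (fun i hi g => ?_) _).trans ?_
    · rw [LinearMap.comp_apply, restrictTops_deathOp hi, map_zero]
    · rw [LinearMap.comp_apply, restrictTops_liftOps]
      exact hf.functional_stateRep hA (clusterForm A n k)
        (fun i hi g => clusterForm_deathOp hA hi k g) _
  show clusterForm A n k (restrictTops n (stateRep hA (basisElement A n j) _)) = _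
  rw [basisElement]
  simp only [stateRep_comp, Module.End.mul_apply, stateRep_of]
  rw [hr, hl]
  rfl

/-- The left vertex has `n - j` arcs between its clusters, too many for the weight `n - i`. -/
theorem detect_basisElement_of_lt (hA : A ≠ 0) {n : ℕ} (hf : IsJonesWenzl n (jonesWenzl A n))
    {i j : Fin (n + 1)} (h : j < i) : detect hA n (n - i) (basisElement A n j) = 0 := by
  rw [detect_basisElement hA hf]
  have h' : (j : ℕ) < i := h
  have := clusterForm_nestedDeaths_of_lt (A := A) (p := n - j) (k := n - i) (by omega) j
    (stateRep hA (jonesWenzl A (2 * j)) (wordOp A (nestedBirths (n - j) j)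
      (extendTops n (clusterVector A n (n - i)))))
  rwa [show (j : ℕ) + (n - j) = n by omega] at this

theorem detect_basisElement_self (hA : A ≠ 0) {n : ℕ} (hf : IsJonesWenzl n (jonesWenzl A n))
    (i : Fin (n + 1)) (hi : IsJonesWenzl (2 * i) (jonesWenzl A (2 * i))) :
    detect hA n (n - i) (basisElement A n i) = (-A⁻¹ ^ 2) ^ (n - i : ℕ) := by
  rw [detect_basisElement hA hf]
  have := clusterForm_nestedDeaths_self (A := A) (n - i) i
    (stateRep hA (jonesWenzl A (2 * i)) (wordOp A (nestedBirths (n - i) i)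
      (extendTops n (clusterVector A n (n - i)))))
  rw [show (i : ℕ) + (n - i) = n by omega] at this
  have h2 := nestedBirths_extendTops (A := A) (n - i) i
  rw [show (i : ℕ) + (n - i) = n by omega] at h2
  -- The arcs of the left vertex use up all the weight, so the value is taken at the constant state,
  -- where the middle projector has no effect; the right vertex contributes `1`.
  rw [this, hi.stateRep_apply_apply hA _ _ fun _ _ => rfl, h2, mul_one]

/-- The matrix of the functionals of weight `n - i` on the elements of index `j` is triangular, with
powers of `-A⁻²` on the diagonal. The coefficients vanish one after another, beginning with index
`n`. -/
theorem linearIndependent_basisElement (hA : A ≠ 0) {n : ℕ}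
    (hf : ∀ m ≤ 2 * n, IsJonesWenzl m (jonesWenzl A m)) :
    LinearIndependent K (basisElement A n) := by
  rw [Fintype.linearIndependent_iff]
  intro c hc
  have key : ∀ d, ∀ i : Fin (n + 1), n - (i : ℕ) = d → c i = 0 := by
    intro d
    induction d using Nat.strong_induction_on with
    | _ d ih =>
      intro i hi
      have h1 := congrArg (detect hA n (n - i)) hc
      rw [map_sum, map_zero, Finset.sum_eq_single i] at h1
      · rw [map_smul, detect_basisElement_self hA (hf n (by omega)) i (hf _ (by omega)),
          smul_eq_mul] at h1
        exact (mul_eq_zero.1 h1).resolve_right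
          (pow_ne_zero _ (neg_ne_zero.2 (pow_ne_zero _ (inv_ne_zero hA))))
      · intro j _ hj
        rcases lt_or_gt_of_ne hj with h | h
        · rw [map_smul, detect_basisElement_of_lt hA (hf n (by omega)) h, smul_zero]
        · have h' : (i : ℕ) < j := h
          rw [ih (n - j) (by omega) j rfl, zero_smul, map_zero]
      · simp
  exact fun i => key _ i rfl

end ColoredTangle

end

theorem mainTheorem5 {K : Type*} [Field K] (A : K) (hA : A ≠ 0) (n : ℕ)
    (hq : ∀ k : ℕ, 1 ≤ k → k ≤ 2 * n → ColoredTangle.quantumInt A k ≠ 0) :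
    (LinearIndependent K (ColoredTangle.basisElement A n) ∧
      Submodule.span K (Set.range (ColoredTangle.basisElement A n)) =
        ColoredTangle.coloredTL A n) ∧
    (∀ T : ColoredTangle.TwoTangle, ∃! γ : Fin (n + 1) → K,
      ColoredTangle.colored A n T = ∑ i, γ i • ColoredTangle.basisElement A n i) ∧
    ∀ (T T' : ColoredTangle.TwoTangle), ColoredTangle.AmbientIsotopic T T' →
      ∀ γ γ' : Fin (n + 1) → K,
        ColoredTangle.colored A n T = ∑ i, γ i • ColoredTangle.basisElement A n i →
        ColoredTangle.colored A n T' = ∑ i, γ' i • ColoredTangle.basisElement A n i →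
        (∀ i : Fin (n + 1), γ i = 0 ↔ γ' i = 0) ∧
        ∀ i : Fin (n + 1), i < Fin.last n →
          γ i / γ (Fin.last n) = γ' i / γ' (Fin.last n) := by
  have hf : ∀ m ≤ 2 * n, ColoredTangle.IsJonesWenzl m (ColoredTangle.jonesWenzl A m) := fun m hm =>
    ColoredTangle.isJonesWenzl_jonesWenzl hA fun k h1 h2 => hq k h1 (h2.trans hm)
  have hi := ColoredTangle.linearIndependent_basisElement hA hf
  have hs := ColoredTangle.span_basisElement hf
  have hu : ∀ γ γ' : Fin (n + 1) → K, ∑ i, γ i • ColoredTangle.basisElement A n i =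
      ∑ i, γ' i • ColoredTangle.basisElement A n i → γ = γ' := fun γ γ' h => by
    have := Fintype.linearIndependent_iff.1 hi (fun i => γ i - γ' i)
      (by simp only [sub_smul, Finset.sum_sub_distrib, h, sub_self])
    exact funext fun i => sub_eq_zero.1 (this i)
  refine ⟨⟨hi, hs⟩, fun T => ?_, fun T T' hT γ γ' h h' => ?_⟩
  · have hT := ColoredTangle.colored_mem_coloredTL (hf n (by omega)) T
    rw [← hs, Submodule.mem_span_range_iff_exists_fun] at hT
    obtain ⟨γ, hγ⟩ := hT
    exact ⟨γ, hγ.symm, fun γ' h' => hu _ _ (h'.symm.trans hγ.symm)⟩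
  · obtain ⟨k, hk, e⟩ := hT.colored (hf n (by omega))
    -- One constant scales the whole tangle, so by uniqueness of coordinates it scales every
    -- coefficient.
    have hγ : γ = fun i => k * γ' i := hu _ _ (by
      rw [← h, e, h', Finset.smul_sum]
      simp only [smul_smul])
    subst hγ
    -- Cancelling `k` requires only `k ≠ 0`. If the last coefficient is zero, it is zero for both
    -- tangles, and both quotients are `0` by convention.
    exact ⟨fun i => by simp [hk], fun i _ => mul_div_mul_left _ _ hk⟩
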